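/- Let $D\subseteq\mathbb R^4$ be open and connected, with coordinates $(u,v,x,y)$, and consider on $D$ a smooth metric-affine geometry $(g_{ab},\vartheta^a,\Gamma_a{}^b)$ (anholonomic metric, coframe with dual frame $e_a$, connection 1-form; all three otherwise arbitrary) such that - $g_{ab}\,\vartheta^a\otimes\vartheta^b$ is the pp-wave metric $ds^2=H(u,x,y)\,du^2+2\,du\,dv-dx^2-dy^2$; - the connection is metric-compatible, $Q_{ab}=-\mathrm D g_{ab}=0$; - the torsion $T^a=\mathrm D\vartheta^a$ is purely axial, $T^a=\tfrac13\,e^a\lrcorner\star\overline T$ with $\overline T=\mathcal A(\varphi)\,du$ and $\varphi=u+\text{const}$. Here $H$ and $\mathcal A$ are smooth, $\star$ is the Hodge dual of the pp-wave metric, and $k=du=k_a\vartheta^a$. Let $R_a{}^b=d\Gamma_a{}^b+\Gamma_c{}^b\wedge\Gamma_a{}^c$ be the curvature, $\mathrm{Ric}_{ab}=R_{acb}{}^c$ the Ricci tensor of the connection, and let $$L_{\rm s}=-\frac1{2\rho}R_{ab}\wedge\star\Big[\sum_{I=1}^6 w_I\,{}^{(I)}W^{ab}+v_1\vartheta^a\wedge(e_c\lrcorner{}^{(5)}W^{cb})+\sum_{I=1}^5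 z_I\,{}^{(I)}Z^{ab}+v_2\,\vartheta_c\wedge(e^a\lrcorner{}^{(2)}Z^{cb})+\sum_{I=3}^5 v_I\,\vartheta^a\wedge(e_c\lrcorner{}^{(I)}Z^{cb})\Big]$$ be the general even-parity curvature-square Lagrangian, with arbitrary real parameters $\rho\neq0$, $w_I$, $z_I$, $v_I$, where ${}^{(I)}W_{ab}$ and ${}^{(I)}Z_{ab}$ are the standard irreducible parts (under the pseudo-orthogonal group) of $W_{ab}=R_{[ab]}$ and $Z_{ab}=R_{(ab)}$. Its action $S_{\rm s}=\int L_{\rm s}$ is varied independently with respect to $\vartheta^a$ and $\Gamma_a{}^b$ at fixed $g_{ab}$; the variations are smooth with compact support in $D$, and those of $\Gamma_a{}^b$ need not preserve metric compatibility. Then $\nabla\mathrm{Ric}=0$ on $D$ if and only if $(\partial_x^2+\partial_y^2)H=\tfrac19\mathcal A(\varphi)^2+C$ for some constant $C\in\mathbb R$. If this holds, then the coframe equation $\delta S_{\rm s}/\delta\vartheta^a=0$ is satisfied for all values of the parameters, and $$\frac{\delta S_{\rm s}}{\delta\Gamma_a{}^b}=\frac{1}{18\rho}\,v_2\,\mathcal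 A(\varphi)\,\mathcal A'(\varphi)\;k^a k_b\,\star k ,$$ so the connection equation is proportional to $v_2\,\mathcal A\,\mathcal A'$. In particular both field equations hold for every such Lagrangian with $v_2=0$. -/

import Mathlib

open scoped ContDiff

namespace MAG

noncomputable section

/-! ### Coordinate differential forms on `ℝ⁴`, with coordinates `(u, v, x, y)` -/

/-- Points of the coordinate space; the coordinates are `x 0 = u`, `x 1 = v`, `x 2 = x`, `x 3 = y`. -/
abbrev Pt := Fin 4 → ℝ

/-- The array of components `α_{μ₁…μₚ}` of a `p`-form at a point, in the coordinate basis: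
`α = (1/p!) α_{μ₁…μₚ} dx^{μ₁} ∧ … ∧ dx^{μₚ}`. -/
abbrev Form (p : ℕ) := (Fin p → Fin 4) → ℝ

/-- The number represented by a `0`-form. -/
def Form.scalar (α : Form 0) : ℝ := α ![]

/-- The coefficient of `du ∧ dv ∧ dx ∧ dy` in a `4`-form. -/
def Form.top (α : Form 4) : ℝ := α ![0, 1, 2, 3]

/-- Exterior product, `(α ∧ β)_{i} = 1/(p! q!) ∑_σ sgn σ α_{iσ(1)…iσ(p)} β_{iσ(p+1)…iσ(p+q)}`. -/
def wedge {p q : ℕ} (α : Form p) (β : Form q) : Form (p + q) := fun i =>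
  (1 / ((p.factorial : ℝ) * (q.factorial : ℝ))) *
    ∑ σ : Equiv.Perm (Fin (p + q)), ((Equiv.Perm.sign σ : ℤ) : ℝ) *
      (α (fun k => i (σ (Fin.castAdd q k))) * β (fun k => i (σ (Fin.natAdd p k))))

/-- Interior product `e ⌟ α` with a vector `e = e^μ ∂_μ`. -/
def interiorProd {p : ℕ} (e : Pt) (α : Form (p + 1)) : Form p := fun i =>
  ∑ μ, e μ * α (Fin.cons μ i)

/-- The Levi-Civita symbol, with `ε_{0123} = 1`. -/
def leviCivita (i : Fin 4 → Fin 4) : ℝ :=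
  Matrix.det (Matrix.of fun a b => if i a = b then (1 : ℝ) else 0)

/-- Partial derivative `∂_μ f`. -/
def pd (μ : Fin 4) (f : Pt → ℝ) (x : Pt) : ℝ := fderiv ℝ f x (Pi.single μ 1)

/-- Exterior derivative of a `p`-form field. -/
def extd {p : ℕ} (α : Pt → Form p) (x : Pt) : Form (p + 1) := fun i =>
  ∑ k : Fin (p + 1), (-1 : ℝ) ^ (k : ℕ) * pd (i k) (fun y => α y (fun m => i (k.succAbove m))) x

/-- The `1`-form `df` of a function. -/
def gradForm (f : Pt → ℝ) (x : Pt) : Form 1 := fun i => pd (i 0) f x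

/-- The wave `1`-form `k = du`. -/
def waveForm : Form 1 := fun i => if i 0 = 0 then 1 else 0

/-! ### Pointwise algebra of an anholonomic metric and a coframe -/

/-- The anholonomic metric `g_ab` and the coframe `ϑ^a` at one point. -/
structure Frame where
  g : Fin 4 → Fin 4 → ℝ
  θ : Fin 4 → Form 1

namespace Frame

variable (F : Frame)

/-- The matrix `e_μ^a` of the coframe, `ϑ^a = e_μ^a dx^μ` (row index `a`, column index `μ`). -/
def coframeMatrix : Matrix (Fin 4) (Fin 4) ℝ := Matrix.of fun a μ => F.θ a ![μ]

/-- The inverse anholonomic metric `g^{ab}`. -/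
def gInv (a b : Fin 4) : ℝ := (Matrix.of F.g)⁻¹ a b

/-- The dual frame vectors `e_a = e^μ_a ∂_μ`. -/
def e (a : Fin 4) : Pt := fun μ => F.coframeMatrix⁻¹ μ a

/-- `e^a = g^{ab} e_b`. -/
def eUp (a : Fin 4) : Pt := ∑ b, F.gInv a b • F.e b

/-- `ϑ_a = g_ab ϑ^b`. -/
def θLow (a : Fin 4) : Form 1 := ∑ b, F.g a b • F.θ b

/-- The coordinate metric `g_μν = g_ab e_μ^a e_ν^b`. -/
def coordMetric : Matrix (Fin 4) (Fin 4) ℝ :=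
  Matrix.of fun μ ν => ∑ a, ∑ b, F.g a b * F.θ a ![μ] * F.θ b ![ν]

/-- `sgn(g)`, the sign of the determinant of the metric. -/
def sgn : ℝ := Real.sign (Matrix.of F.g).det

/-- All indices of a form raised with the metric. -/
def raiseForm {p : ℕ} (α : Form p) : Form p := fun i =>
  ∑ j : Fin p → Fin 4, (∏ m, F.coordMetric⁻¹ (i m) (j m)) * α j

/-- Hodge dual,
`(⋆α)_{ν₁…ν_q} = (1/p!) α^{μ₁…μₚ} √|det g_μν| ε_{μ₁…μₚν₁…ν_q}`, where `p + q = 4`. -/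
def star {p q : ℕ} (h : p + q = 4) (α : Form p) : Form q := fun j =>
  (1 / (p.factorial : ℝ)) * ∑ i : Fin p → Fin 4, F.raiseForm α i *
    (Real.sqrt |F.coordMetric.det| *
      leviCivita (fun k => Fin.append i j (Fin.cast h.symm k)))

/-- Components `k_a = e_a ⌟ k` of the wave form. -/
def kLow (a : Fin 4) : ℝ := (interiorProd (F.e a) waveForm).scalar

/-- Components `k^a = g^{ab} k_b`. -/
def kUp (a : Fin 4) : ℝ := ∑ b, F.gInv a b * F.kLow b

end Frame

/-- Families `M_ab` of two-forms. -/
abbrev TwoForms := Fin 4 → Fin 4 → Form 2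

/-- `M_{[ab]}`. -/
def altPart (M : TwoForms) : TwoForms := fun a b => (1 / 2 : ℝ) • (M a b - M b a)

/-- `M_{(ab)}`. -/
def symPart (M : TwoForms) : TwoForms := fun a b => (1 / 2 : ℝ) • (M a b + M b a)

namespace Frame

variable (F : Frame)

/-- `R_ab = g_bc R_a^c`. -/
def lowerCurv (R : TwoForms) : TwoForms := fun a b => ∑ c, F.g b c • R a c

/-- `M^{ab} = g^{ac} g^{bd} M_cd`. -/
def raiseTwo (M : TwoForms) : TwoForms := fun a b =>
  ∑ c, ∑ d, (F.gInv a c * F.gInv b d) • M c d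

/-! #### Irreducible parts of the antisymmetric piece `W_ab` of the curvature -/

/-- `X_a = e^b ⌟ W_ab`. -/
def X (W : TwoForms) (a : Fin 4) : Form 1 := ∑ b, interiorProd (F.eUp b) (W a b)

/-- `X̄_a = ⋆(W_ba ∧ ϑ^b)`. -/
def Xbar (W : TwoForms) (a : Fin 4) : Form 1 :=
  F.star (rfl : 3 + 1 = 4) (∑ b, (wedge (W b a) (F.θ b) : Form 3))

/-- The scalar `e_a ⌟ X^a`. -/
def Xscal (W : TwoForms) : ℝ := ∑ a, (interiorProd (F.eUp a) (F.X W a)).scalar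

/-- The scalar `e_a ⌟ X̄^a`. -/
def XbarScal (W : TwoForms) : ℝ := ∑ a, (interiorProd (F.eUp a) (F.Xbar W a)).scalar

/-- `ϑ^c ∧ B_c`. -/
def coframeWedge (B : Fin 4 → Form 1) : Form 2 := ∑ c, (wedge (F.θ c) (B c) : Form 2)

/-- `Ψ_a`. -/
def Psi (W : TwoForms) (a : Fin 4) : Form 1 :=
  F.X W a - ((1 / 4 : ℝ) * F.Xscal W) • F.θLow a
    - (1 / 2 : ℝ) • interiorProd (F.e a) (F.coframeWedge (F.X W))

/-- `Ψ̄_a`. -/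
def PsiBar (W : TwoForms) (a : Fin 4) : Form 1 :=
  F.Xbar W a - ((1 / 4 : ℝ) * F.XbarScal W) • F.θLow a
    - (1 / 2 : ℝ) • interiorProd (F.e a) (F.coframeWedge (F.Xbar W))

def W2 (W : TwoForms) : TwoForms := fun a b =>
  F.sgn • F.star (rfl : 2 + 2 = 4)
    (altPart (fun c d => (wedge (F.θLow c) (F.PsiBar W d) : Form 2)) a b)

def W3 (W : TwoForms) : TwoForms := fun a b =>
  (F.sgn * (1 / 12 : ℝ)) • F.star (rfl : 2 + 2 = 4)
    (F.XbarScal W • (wedge (F.θLow a) (F.θLow b) : Form 2))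

def W4 (W : TwoForms) : TwoForms := fun a b =>
  (-(2 / 2) : ℝ) • altPart (fun c d => (wedge (F.θLow c) (F.Psi W d) : Form 2)) a b

def W5 (W : TwoForms) : TwoForms := fun a b =>
  (-(1 / 2) : ℝ) • altPart (fun c d =>
    (wedge (F.θLow c) (interiorProd (F.e d) (F.coframeWedge (F.X W))) : Form 2)) a b

def W6 (W : TwoForms) : TwoForms := fun a b =>
  (-(1 / 12) * F.Xscal W : ℝ) • (wedge (F.θLow a) (F.θLow b) : Form 2)

def W1 (W : TwoForms) : TwoForms := fun a b =>
  W a b - (F.W2 W a b + F.W3 W a b + F.W4 W a b + F.W5 W a b + F.W6 W a b)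

/-! #### Irreducible parts of the symmetric piece `Z_ab` of the curvature -/

/-- The trace part `(1/4) g_ab Z_c^c`. -/
def Z5 (Z : TwoForms) : TwoForms := fun a b =>
  ((1 / 4 : ℝ) * F.g a b) • ∑ c, ∑ d, F.gInv c d • Z c d

/-- `Y_a = e^b ⌟ (Z_ab - ⁽⁵⁾Z_ab)`. -/
def Y (Z : TwoForms) (a : Fin 4) : Form 1 :=
  ∑ b, interiorProd (F.eUp b) (Z a b - F.Z5 Z a b)

/-- `Ȳ_a = ⋆((Z_ba - ⁽⁵⁾Z_ba) ∧ ϑ^b)`. -/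
def Ybar (Z : TwoForms) (a : Fin 4) : Form 1 :=
  F.star (rfl : 3 + 1 = 4) (∑ b, (wedge (Z b a - F.Z5 Z b a) (F.θ b) : Form 3))

/-- `Φ_a`. -/
def Phi (Z : TwoForms) (a : Fin 4) : Form 1 :=
  F.Y Z a - (1 / 2 : ℝ) • interiorProd (F.e a) (F.coframeWedge (F.Y Z))

/-- `Φ̄_a`. -/
def PhiBar (Z : TwoForms) (a : Fin 4) : Form 1 :=
  F.Ybar Z a - (1 / 2 : ℝ) • interiorProd (F.e a) (F.coframeWedge (F.Ybar Z))

def Z2 (Z : TwoForms) : TwoForms := fun a b =>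
  ((1 / 2 : ℝ) * F.sgn) • F.star (rfl : 2 + 2 = 4)
    (symPart (fun c d => (wedge (F.θLow c) (F.PhiBar Z d) : Form 2)) a b)

def Z3 (Z : TwoForms) : TwoForms := fun a b =>
  (1 / 12 : ℝ) •
    ((4 : ℝ) • symPart (fun c d =>
        (wedge (F.θLow c) (interiorProd (F.e d) (F.coframeWedge (F.Y Z))) : Form 2)) a b
      - (2 * F.g a b) • F.coframeWedge (F.Y Z))

def Z4 (Z : TwoForms) : TwoForms := fun a b =>
  (2 / 4 : ℝ) • symPart (fun c d => (wedge (F.θLow c) (F.Phi Z d) : Form 2)) a b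

def Z1 (Z : TwoForms) : TwoForms := fun a b =>
  Z a b - (F.Z2 Z a b + F.Z3 Z a b + F.Z4 Z a b + F.Z5 Z a b)

/-- `ϑ_a ∧ (e_c ⌟ M^c_b)`. -/
def crossTerm (M : TwoForms) : TwoForms := fun a b =>
  wedge (F.θLow a) (∑ c, interiorProd (F.eUp c) (M c b))

/-- `ϑ_c ∧ (e_a ⌟ M^c_b)`. -/
def crossTerm' (M : TwoForms) : TwoForms := fun a b =>
  ∑ c, (wedge (F.θ c) (interiorProd (F.e a) (M c b)) : Form 2)

end Frame

/-! ### The even-parity curvature-square Lagrangian -/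

/-- The parameters of the strong sector. -/
structure StrongParams where
  (ρ w₁ w₂ w₃ w₄ w₅ w₆ z₁ z₂ z₃ z₄ z₅ v₁ v₂ v₃ v₄ v₅ : ℝ)

/-- The bracket `[∑ w_I ⁽ᴵ⁾W_ab + v₁ … + ∑ z_I ⁽ᴵ⁾Z_ab + v₂ … + ∑ v_I …]` (indices lowered) in the
Lagrangian, for a curvature `R_a^b`. -/
def strongBracket (P : StrongParams) (F : Frame) (R : TwoForms) : TwoForms :=
  let W := altPart (F.lowerCurv R)
  let Z := symPart (F.lowerCurv R)
  P.w₁ • F.W1 W + P.w₂ • F.W2 W + P.w₃ • F.W3 W + P.w₄ • F.W4 W + P.w₅ • F.W5 W + P.w₆ • F.W6 W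
    + P.v₁ • F.crossTerm (F.W5 W)
    + P.z₁ • F.Z1 Z + P.z₂ • F.Z2 Z + P.z₃ • F.Z3 Z + P.z₄ • F.Z4 Z + P.z₅ • F.Z5 Z
    + P.v₂ • F.crossTerm' (F.Z2 Z)
    + P.v₃ • F.crossTerm (F.Z3 Z) + P.v₄ • F.crossTerm (F.Z4 Z) + P.v₅ • F.crossTerm (F.Z5 Z)

/-- The Lagrangian `4`-form `-(1/2ρ) R_ab ∧ ⋆[…]^{ab}` at a point. -/
def strongLagrangian (P : StrongParams) (F : Frame) (R : TwoForms) : Form 4 :=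
  (-(1 / (2 * P.ρ)) : ℝ) • ∑ a, ∑ b,
    (wedge (F.lowerCurv R a b)
      (F.star (rfl : 2 + 2 = 4) (F.raiseTwo (strongBracket P F R) a b)) : Form 4)

/-! ### Metric-affine geometries -/

/-- The three fields of a metric-affine geometry: the anholonomic metric `g_ab`, the coframe `ϑ^a`
and the connection `1`-forms `Γ x a b = Γ_a^b`. -/
structure Fields where
  g : Pt → Fin 4 → Fin 4 → ℝ
  θ : Pt → Fin 4 → Form 1
  Γ : Pt → Fin 4 → Fin 4 → Form 1

namespace Fields

variable (Φ : Fields)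

/-- The metric and the coframe at a point. -/
def frame (x : Pt) : Frame := ⟨Φ.g x, Φ.θ x⟩

/-- Curvature `R_a^b = dΓ_a^b + Γ_c^b ∧ Γ_a^c`. -/
def curvature (x : Pt) : TwoForms := fun a b =>
  extd (fun y => Φ.Γ y a b) x + ∑ c, wedge (Φ.Γ x c b) (Φ.Γ x a c)

/-- Torsion `T^a = dϑ^a + Γ_b^a ∧ ϑ^b`. -/
def torsion (x : Pt) (a : Fin 4) : Form 2 :=
  extd (fun y => Φ.θ y a) x + ∑ b, wedge (Φ.Γ x b a) (Φ.θ x b)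

/-- Covariant differential `DB_ab = dB_ab - Γ_a^c B_cb - Γ_b^c B_ac` of a covariant `2`-tensor given
by its components in the coframe. -/
def covD (B : Pt → Fin 4 → Fin 4 → ℝ) (x : Pt) (a b : Fin 4) : Form 1 :=
  gradForm (fun y => B y a b) x - ∑ c, B x c b • Φ.Γ x a c - ∑ c, B x a c • Φ.Γ x b c

/-- Nonmetricity `Q_ab = -Dg_ab`. -/
def nonmetricity (x : Pt) (a b : Fin 4) : Form 1 := -Φ.covD Φ.g x a b

/-- Ricci tensor `Ric_ab = R_{acb}^c`, where `R_a^b = ½ R_{μνa}^b dx^μ ∧ dx^ν`. -/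
def ricci (x : Pt) (a b : Fin 4) : ℝ :=
  ∑ c, (interiorProd ((Φ.frame x).e c) (interiorProd ((Φ.frame x).e a) (Φ.curvature x b c))).scalar

/-- The Ricci tensor of the connection is parallel on `D`: `∇Ric = 0`. -/
def RicciParallelOn (D : Set Pt) : Prop := ∀ x ∈ D, ∀ a b, Φ.covD Φ.ricci x a b = 0

/-- The density of the strong Lagrangian with respect to `du ∧ dv ∧ dx ∧ dy`. -/
def lagrangianDensity (P : StrongParams) (x : Pt) : ℝ :=
  (strongLagrangian P (Φ.frame x) (Φ.curvature x)).top

/-- The fields are smooth on `D`. -/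
def SmoothOn (D : Set Pt) : Prop :=
  ContDiffOn ℝ ∞ Φ.g D ∧ ContDiffOn ℝ ∞ Φ.θ D ∧ ContDiffOn ℝ ∞ Φ.Γ D

/-- The fields with `ϑ^a` replaced by `ϑ^a + δϑ^a`. -/
def addCoframe (δ : Pt → Fin 4 → Form 1) : Fields := { Φ with θ := Φ.θ + δ }

/-- The fields with `Γ_a^b` replaced by `Γ_a^b + δΓ_a^b`. -/
def addConnection (δ : Pt → Fin 4 → Fin 4 → Form 1) : Fields := { Φ with Γ := Φ.Γ + δ }

end Fields

/-! ### Variational derivatives of the action `S = ∫ L`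

The action itself may diverge; its change under a variation with compact support in `D` is the
integral of the change of the Lagrangian. -/

/-- Test fields: smooth with compact support in `D`. -/
def IsVariation {E : Type*} [NormedAddCommGroup E] [NormedSpace ℝ E] (D : Set Pt) (δ : Pt → E) :
    Prop :=
  ContDiff ℝ ∞ δ ∧ HasCompactSupport δ ∧ tsupport δ ⊆ D

/-- `δS/δϑ^a = E_a` on `D`: at `ε = 0`, the derivative of `S[g, ϑ + ε δϑ, Γ]` is `∫ δϑ^a ∧ E_a` for
every test field `δϑ`. -/
def HasCoframeDerivative (P : StrongParams) (D : Set Pt) (Φ : Fields)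
    (E : Pt → Fin 4 → Form 3) : Prop :=
  ∀ δ : Pt → Fin 4 → Form 1, IsVariation D δ →
    HasDerivAt
      (fun ε : ℝ => ∫ x in D,
        ((Φ.addCoframe (ε • δ)).lagrangianDensity P x - Φ.lagrangianDensity P x))
      (∫ x in D, ∑ a, (wedge (δ x a) (E x a) : Form 4).top) 0

/-- `δS/δΓ_a^b = E^a_b` on `D`: at `ε = 0`, the derivative of `S[g, ϑ, Γ + ε δΓ]` is
`∫ δΓ_a^b ∧ E^a_b` for every test field `δΓ` (no metric compatibility is imposed on the
variation). -/
def HasConnectionDerivative (P : StrongParams) (D : Set Pt) (Φ : Fields)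
    (E : Pt → Fin 4 → Fin 4 → Form 3) : Prop :=
  ∀ δ : Pt → Fin 4 → Fin 4 → Form 1, IsVariation D δ →
    HasDerivAt
      (fun ε : ℝ => ∫ x in D,
        ((Φ.addConnection (ε • δ)).lagrangianDensity P x - Φ.lagrangianDensity P x))
      (∫ x in D, ∑ a, ∑ b, (wedge (δ x a b) (E x a b) : Form 4).top) 0

/-- The coframe equation `δS/δϑ^a = 0`. -/
def CoframeEquation (P : StrongParams) (D : Set Pt) (Φ : Fields) : Prop :=
  HasCoframeDerivative P D Φ 0

/-- The connection equation `δS/δΓ_a^b = 0`. -/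
def ConnectionEquation (P : StrongParams) (D : Set Pt) (Φ : Fields) : Prop :=
  HasConnectionDerivative P D Φ 0

/-! ### pp-waves with purely axial torsion -/

/-- Matrix of `H du² + 2 du dv - dx² - dy²`. -/
def ppMetric (h : ℝ) : Matrix (Fin 4) (Fin 4) ℝ :=
  !![h, 1, 0, 0; 1, 0, 0, 0; 0, 0, -1, 0; 0, 0, 0, -1]

/-- The geometry on `D`: the metric is the pp-wave metric of `H(u,x,y)`, the connection is
metric-compatible, and its torsion is `T^a = (1/3) e^a ⌟ ⋆T̄` with `T̄ = A(φ) du`, where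
`φ = u + φ₀`. -/
structure IsAxialPPWave (D : Set Pt) (H : ℝ → ℝ → ℝ → ℝ) (A : ℝ → ℝ) (φ₀ : ℝ) (Φ : Fields) :
    Prop where
  metric : ∀ x ∈ D, (Φ.frame x).coordMetric = ppMetric (H (x 0) (x 2) (x 3))
  compatible : ∀ x ∈ D, ∀ a b, Φ.nonmetricity x a b = 0
  axial : ∀ x ∈ D, ∀ a, Φ.torsion x a =
    (1 / 3 : ℝ) • interiorProd ((Φ.frame x).eUp a)
      ((Φ.frame x).star (rfl : 1 + 3 = 4) (A (x 0 + φ₀) • waveForm))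

/-- `(∂_x² + ∂_y²) f`. -/
def transverseLaplacian (f : Pt → ℝ) (x : Pt) : ℝ := pd 2 (pd 2 f) x + pd 3 (pd 3 f) x

end

end MAG

open MAG

namespace MAG
noncomputable section

/-! ### The exterior algebra operations in components -/

/-! At each point the Lagrangian is −1/(2ρ) Q(R, R), where Q = `strongForm` is bilinear in the
curvature and built covariantly from metric and coframe. Q is invariant under linear changes of
frame and under unimodular diagonal rescalings of the coordinates (`strongForm_invariant`).
Invariance under frame changes allows all computations to be done in the null coframe du, dv + (H/2)
du, dx, dy with constant anholonomic metric. The change to it is smooth on all of D, carries test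
fields to test fields, and turns the geometry into the explicit `waveFields`, because metric and
torsion determine a metric-compatible connection (`connection_unique`, `gaugeRel_waveFields`).

In this frame the only curvature is R_0^i = R_i^1 = du ∧ M_ij dx^j with M_ij = (𝒜²/36) δ_ij − ½
∂_i∂_j H + (𝒜'/6) ε_ij, where i, j run over the transverse directions 2, 3 and ε_23 = 1. Hence Ric =
(tr M) k ⊗ k. Since Γ_i^0 = 0, the form k is parallel, so ∇Ric = 0 means that tr M = 𝒜²/18 − ½ ΔH is
constant on the connected set D.

Coframe equation. The connection is fixed, so varying the coframe changes Q but not R. A boost with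
du scaled by s and dv by 1/s, applied to coordinates and frame together, multiplies the wave
curvature by s², hence Q by s⁴, while a perturbation εδ of the coframe is amplified at most by s⁻².
With s² proportional to |ε| the boosted coframe stays in a fixed compact set of invertible coframes,
so Q = O(s⁴) = O(ε²) uniformly on the support of δ (`coframe_variation_bound`). The first variation
therefore vanishes for all parameters.

Connection equation. The curvature is quadratic in the variation, so the change of the action is a
polynomial in ε with linear coefficient −1/(2ρ) ∫ (Q(R, L) + Q(L, R)), where L is the linearised
curvature. Evaluated on the wave, all pieces drop out except those with coefficients w₁, w₂, w₄, v₂,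
v₄ (`strongForm_variation`). If tr M is constant, then M_22 − M_33 and M_23 + M_32 satisfy
Cauchy–Riemann type equations in (x, y), and M_23 − M_32 = 𝒜'/3 depends on u only. The integrand is
thus a divergence, up to undifferentiated terms produced by the torsion part f = 𝒜/6 of the
connection. These cancel in every sector but that of v₂, where −2 v₂ (𝒜'/3)(𝒜/6) δΓ_1^0(∂_v) remains
(`divergence_current`). The factor −1/(2ρ) turns this into v₂ 𝒜𝒜'/(18ρ), and δΓ_1^0(∂_v) is the
pairing of k^a k_b δΓ_a^b with ⋆k. -/

theorem Form.ext1 {α β : Form 1} (h : ∀ μ, α ![μ] = β ![μ]) : α = β := by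
  funext i
  have : i = ![i 0] := by ext k; fin_cases k; rfl
  rw [this]; exact h _

theorem Form.ext2 {α β : Form 2} (h : ∀ μ ν, α ![μ, ν] = β ![μ, ν]) : α = β := by
  funext i
  have : i = ![i 0, i 1] := by ext k; fin_cases k <;> rfl
  rw [this]; exact h _ _

theorem sum_fin_succ_arrow {n : ℕ} (f : (Fin (n + 1) → Fin 4) → ℝ) :
    ∑ i, f i = ∑ a : Fin 4, ∑ i : Fin n → Fin 4, f (Matrix.vecCons a i) := by
  rw [← (Fin.consEquiv (fun _ : Fin (n + 1) => Fin 4)).sum_comp, Fintype.sum_prod_type]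
  rfl

theorem sum_fin_zero_arrow (f : (Fin 0 → Fin 4) → ℝ) : ∑ i, f i = f ![] := by
  rw [Fintype.sum_unique]; congr 1

/-- Recursion on the image p of 0: the rest of σ is a smaller permutation followed by the swap of 0
and p, which costs a sign unless p = 0. The signed sums over two, three and four letters follow from
one another in this way. -/
theorem sum_perm_succ {n : ℕ} (f : Equiv.Perm (Fin (n + 1)) → ℝ) :
    ∑ σ, f σ = ∑ p : Fin (n + 1), ∑ e : Equiv.Perm (Fin n),
      f (Equiv.Perm.decomposeFin.symm (p, e)) := by
  rw [← Equiv.Perm.decomposeFin.symm.sum_comp, Fintype.sum_prod_type]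

theorem sum_sign_perm_two (G : Fin 2 → Fin 2 → ℝ) :
    ∑ σ : Equiv.Perm (Fin 2), ((Equiv.Perm.sign σ : ℤ) : ℝ) * G (σ 0) (σ 1) = G 0 1 - G 1 0 := by
  rw [sum_perm_succ]
  simp [Fin.sum_univ_succ]
  ring

theorem sum_sign_perm_three (G : Fin 3 → Fin 3 → Fin 3 → ℝ) :
    ∑ σ : Equiv.Perm (Fin 3), ((Equiv.Perm.sign σ : ℤ) : ℝ) * G (σ 0) (σ 1) (σ 2)
      = G 0 1 2 + G 1 2 0 + G 2 0 1 - G 0 2 1 - G 2 1 0 - G 1 0 2 := by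
  have h2 : (2 : Fin 3) = Fin.succ 1 := rfl
  rw [sum_perm_succ]
  have key : ∀ p : Fin 3, ∑ e : Equiv.Perm (Fin 2),
      ((Equiv.Perm.sign (Equiv.Perm.decomposeFin.symm (p, e)) : ℤ) : ℝ) *
        G (Equiv.Perm.decomposeFin.symm (p, e) 0) (Equiv.Perm.decomposeFin.symm (p, e) 1)
          (Equiv.Perm.decomposeFin.symm (p, e) 2)
      = (if p = 0 then 1 else -1) * (G p (Equiv.swap 0 p (Fin.succ 0)) (Equiv.swap 0 p (Fin.succ 1))
        - G p (Equiv.swap 0 p (Fin.succ 1)) (Equiv.swap 0 p (Fin.succ 0))) := by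
    intro p
    rw [← sum_sign_perm_two (fun a b => G p (Equiv.swap 0 p a.succ) (Equiv.swap 0 p b.succ)),
      Finset.mul_sum]
    refine Finset.sum_congr rfl fun e _ => ?_
    rw [h2, Equiv.Perm.decomposeFin.symm_sign]
    simp only [Equiv.Perm.decomposeFin_symm_apply_zero, Equiv.Perm.decomposeFin_symm_apply_succ,
      Equiv.Perm.decomposeFin_symm_apply_one]
    split_ifs <;> simp
  simp only [key]
  refine (Fin.sum_univ_three _).trans ?_
  simp [Equiv.swap_apply_def]
  ring

theorem sum_sign_perm_four (G : Fin 4 → Fin 4 → Fin 4 → Fin 4 → ℝ) :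
    ∑ σ : Equiv.Perm (Fin 4), ((Equiv.Perm.sign σ : ℤ) : ℝ) * G (σ 0) (σ 1) (σ 2) (σ 3)
      = ∑ p : Fin 4, (if p = 0 then 1 else -1) *
        ((fun K : Fin 3 → Fin 3 → Fin 3 → ℝ =>
          K 0 1 2 + K 1 2 0 + K 2 0 1 - K 0 2 1 - K 2 1 0 - K 1 0 2)
        (fun a b c => G p (Equiv.swap 0 p a.succ) (Equiv.swap 0 p b.succ)
          (Equiv.swap 0 p c.succ))) := by
  have h2 : (2 : Fin 4) = Fin.succ 1 := rfl
  have h3 : (3 : Fin 4) = Fin.succ 2 := rfl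
  rw [sum_perm_succ]
  refine Finset.sum_congr rfl fun p _ => ?_
  simp only
  rw [← sum_sign_perm_three (fun a b c => G p (Equiv.swap 0 p a.succ) (Equiv.swap 0 p b.succ)
          (Equiv.swap 0 p c.succ)), Finset.mul_sum]
  refine Finset.sum_congr rfl fun e _ => ?_
  rw [h2, h3, Equiv.Perm.decomposeFin.symm_sign]
  simp only [Equiv.Perm.decomposeFin_symm_apply_zero, Equiv.Perm.decomposeFin_symm_apply_succ,
      Equiv.Perm.decomposeFin_symm_apply_one]
  split_ifs <;> simp

theorem wedge_one_one (α β : Form 1) (μ ν : Fin 4) :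
    (wedge α β : Form 2) ![μ, ν] = α ![μ] * β ![ν] - α ![ν] * β ![μ] := by
  have := sum_sign_perm_two fun a b => α ![![μ, ν] a] * β ![![μ, ν] b]
  simp only [Matrix.cons_val_zero, Matrix.cons_val_one] at this
  rw [← this, wedge]
  simp only [Nat.factorial, Nat.cast_one, mul_one, div_one, one_mul]
  refine Finset.sum_congr rfl fun σ _ => ?_
  congr 3 <;> · ext k; fin_cases k; rfl

/-- A `Form 2` is an arbitrary array, so antisymmetry has to be assumed; it pairs the six
permutations and absorbs the factor 1/(2! 1!). -/
theorem wedge_two_one (α : Form 2) (β : Form 1) (hα : ∀ μ ν, α ![ν, μ] = - α ![μ, ν])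
    (μ ν κ : Fin 4) :
    (wedge α β : Form 3) ![μ, ν, κ]
      = α ![μ, ν] * β ![κ] + α ![ν, κ] * β ![μ] + α ![κ, μ] * β ![ν] := by
  have := sum_sign_perm_three
    fun a b c => α ![![μ, ν, κ] a, ![μ, ν, κ] b] * β ![![μ, ν, κ] c]
  have h : (wedge α β : Form 3) ![μ, ν, κ] = 1 / 2 * ∑ σ : Equiv.Perm (Fin 3),
      ((Equiv.Perm.sign σ : ℤ) : ℝ) * (α ![![μ, ν, κ] (σ 0), ![μ, ν, κ] (σ 1)]
        * β ![![μ, ν, κ] (σ 2)]) := by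
    rw [wedge]
    congr 1
    · norm_num
    refine Finset.sum_congr rfl fun σ _ => ?_
    congr 3 <;> · ext k; fin_cases k <;> rfl
  rw [h, this]
  simp only [Matrix.cons_val_zero, Matrix.cons_val_one, Matrix.cons_val]
  rw [hα ν μ, hα κ μ, hα κ ν]
  ring

theorem wedge_two_two_top (α β : Form 2) (hα : ∀ μ ν, α ![ν, μ] = - α ![μ, ν])
    (hβ : ∀ μ ν, β ![ν, μ] = - β ![μ, ν]) :
    (wedge α β : Form 4).top = α ![0, 1] * β ![2, 3] - α ![0, 2] * β ![1, 3]
      + α ![0, 3] * β ![1, 2] + α ![1, 2] * β ![0, 3] - α ![1, 3] * β ![0, 2]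
      + α ![2, 3] * β ![0, 1] := by
  have := sum_sign_perm_four fun a b c d => α ![a, b] * β ![c, d]
  have h : (wedge α β : Form 4).top = 1 / 4 * ∑ σ : Equiv.Perm (Fin 4),
      ((Equiv.Perm.sign σ : ℤ) : ℝ) * (α ![σ 0, σ 1] * β ![σ 2, σ 3]) := by
    rw [Form.top, wedge]
    congr 1
    · norm_num
    refine Finset.sum_congr rfl fun σ _ => ?_
    have e : ∀ a : Fin 4, (![0, 1, 2, 3] : Fin 4 → Fin 4) a = a := by decide
    congr 3 <;> · ext k; simp only [e]; fin_cases k <;> rfl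
  rw [h, this]
  simp [Fin.sum_univ_four, Equiv.swap_apply_def]
  rw [hα 0 1, hα 0 2, hα 0 3, hα 1 2, hα 1 3, hα 2 3, hβ 0 1, hβ 0 2, hβ 0 3, hβ 1 2, hβ 1 3,
    hβ 2 3]
  ring

theorem wedge_one_three_top (α : Form 1) (β : Form 3) (hα : ∀ μ ν κ, β ![ν, μ, κ] = - β ![μ, ν, κ])
    (hβ : ∀ μ ν κ, β ![μ, κ, ν] = - β ![μ, ν, κ]) :
    (wedge α β : Form 4).top = α ![0] * β ![1, 2, 3] - α ![1] * β ![0, 2, 3]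
      + α ![2] * β ![0, 1, 3] - α ![3] * β ![0, 1, 2] := by
  have := sum_sign_perm_four fun a b c d => α ![a] * β ![b, c, d]
  have h : (wedge α β : Form 4).top = 1 / 6 * ∑ σ : Equiv.Perm (Fin 4),
      ((Equiv.Perm.sign σ : ℤ) : ℝ) * (α ![σ 0] * β ![σ 1, σ 2, σ 3]) := by
    rw [Form.top, wedge]
    congr 1
    · norm_num [Nat.factorial]
    refine Finset.sum_congr rfl fun σ _ => ?_
    have e : ∀ a : Fin 4, (![0, 1, 2, 3] : Fin 4 → Fin 4) a = a := by decide
    congr 3 <;> · ext k; simp only [e]; fin_cases k <;> rfl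
  rw [h, this]
  have c : ∀ μ ν κ, β ![ν, κ, μ] = β ![μ, ν, κ] := fun μ ν κ => by
    rw [hβ ν μ κ, hα μ ν κ, neg_neg]
  have r : ∀ μ ν κ, β ![κ, ν, μ] = - β ![μ, ν, κ] := fun μ ν κ => by
    rw [hα ν κ μ, c μ ν κ]
  simp [Fin.sum_univ_four, Equiv.swap_apply_def]
  rw [hβ 1 2 3, hβ 0 2 3, hβ 0 1 3, hβ 0 1 2, ← c 3 1 2, r 1 2 3, hα 1 2 3, c 0 2 3, ← c 3 0 2,
    r 0 2 3, hα 0 2 3, r 0 1 3, hα 0 1 3, ← c 3 0 1, r 0 1 2, hα 0 1 2, c 0 1 2, ← c 2 0 1,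
    c 1 2 3, c 0 1 3]
  ring
/-! ### Linearity of the exterior algebra operations -/

/-- The exterior product as a bilinear map. -/
def wedgeₗ (p q : ℕ) : Form p →ₗ[ℝ] Form q →ₗ[ℝ] Form (p + q) :=
  LinearMap.mk₂ ℝ wedge
    (fun α α' β => by
      ext i; simp only [wedge, Pi.add_apply, add_mul, mul_add, Finset.sum_add_distrib])
    (fun c α β => by
      ext i; simp only [wedge, Pi.smul_apply, smul_eq_mul, Finset.mul_sum]
      exact Finset.sum_congr rfl fun σ _ => by ring)
    (fun α β β' => by
      ext i; simp only [wedge, Pi.add_apply, mul_add, Finset.sum_add_distrib])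
    (fun c α β => by
      ext i; simp only [wedge, Pi.smul_apply, smul_eq_mul, Finset.mul_sum]
      exact Finset.sum_congr rfl fun σ _ => by ring)

/-- The interior product as a bilinear map. -/
def interiorProdₗ (p : ℕ) : Pt →ₗ[ℝ] Form (p + 1) →ₗ[ℝ] Form p :=
  LinearMap.mk₂ ℝ interiorProd
    (fun α α' β => by
      ext i; simp only [interiorProd, Pi.add_apply, add_mul, Finset.sum_add_distrib])
    (fun c α β => by
      ext i; simp only [interiorProd, Pi.smul_apply, smul_eq_mul, Finset.mul_sum]
      exact Finset.sum_congr rfl fun σ _ => by ring)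
    (fun α β β' => by
      ext i; simp only [interiorProd, Pi.add_apply, mul_add, Finset.sum_add_distrib])
    (fun c α β => by
      ext i; simp only [interiorProd, Pi.smul_apply, smul_eq_mul, Finset.mul_sum]
      exact Finset.sum_congr rfl fun σ _ => by ring)

/-- The Hodge dual as a linear map. -/
def Frame.starₗ (F : Frame) {p q : ℕ} (h : p + q = 4) : Form p →ₗ[ℝ] Form q where
  toFun := F.star h
  map_add' α β := by
    ext i
    simp only [Frame.star, Frame.raiseForm, Pi.add_apply, mul_add, add_mul, Finset.sum_add_distrib]
  map_smul' c α := by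
    ext i
    simp only [Frame.star, Frame.raiseForm, Pi.smul_apply, smul_eq_mul, Finset.mul_sum,
      Finset.sum_mul, RingHom.id_apply]
    exact Finset.sum_congr rfl fun σ _ => Finset.sum_congr rfl fun σ _ => by ring

section
variable {p q : ℕ} {ι : Type*} (s : Finset ι)

theorem wedge_add_left (α α' : Form p) (β : Form q) :
    wedge (α + α') β = wedge α β + wedge α' β := (wedgeₗ p q).map_add₂ α α' β
theorem wedge_add_right (α : Form p) (β β' : Form q) :
    wedge α (β + β') = wedge α β + wedge α β' := (wedgeₗ p q α).map_add β β'
theorem wedge_smul_left (c : ℝ) (α : Form p) (β : Form q) :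
    wedge (c • α) β = c • wedge α β := (wedgeₗ p q).map_smul₂ c α β
theorem wedge_smul_right (c : ℝ) (α : Form p) (β : Form q) :
    wedge α (c • β) = c • wedge α β := (wedgeₗ p q α).map_smul c β
theorem wedge_sum_left (α : ι → Form p) (β : Form q) :
    wedge (∑ i ∈ s, α i) β = ∑ i ∈ s, wedge (α i) β :=
  (wedgeₗ p q).map_sum₂ s α β
theorem wedge_sum_right (α : Form p) (β : ι → Form q) :
    wedge α (∑ i ∈ s, β i) = ∑ i ∈ s, wedge α (β i) := map_sum (wedgeₗ p q α) β s
theorem wedge_zero_left (β : Form q) : wedge (0 : Form p) β = 0 := (wedgeₗ p q).map_zero₂ β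
theorem wedge_zero_right (α : Form p) : wedge α (0 : Form q) = 0 := (wedgeₗ p q α).map_zero

theorem interiorProd_add_right (e : Pt) (β β' : Form (p + 1)) :
    interiorProd e (β + β') = interiorProd e β + interiorProd e β' :=
  (interiorProdₗ p e).map_add β β'
theorem interiorProd_smul_right (c : ℝ) (e : Pt) (β : Form (p + 1)) :
    interiorProd e (c • β) = c • interiorProd e β := (interiorProdₗ p e).map_smul c β
theorem interiorProd_smul_left (c : ℝ) (e : Pt) (β : Form (p + 1)) :
    interiorProd (c • e) β = c • interiorProd e β := (interiorProdₗ p).map_smul₂ c e β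
theorem interiorProd_sum_left (e : ι → Pt) (β : Form (p + 1)) :
    interiorProd (∑ i ∈ s, e i) β = ∑ i ∈ s, interiorProd (e i) β :=
  (interiorProdₗ p).map_sum₂ s e β
theorem interiorProd_sum_right (e : Pt) (β : ι → Form (p + 1)) :
    interiorProd e (∑ i ∈ s, β i) = ∑ i ∈ s, interiorProd e (β i) :=
  map_sum (interiorProdₗ p e) β s
theorem interiorProd_zero_right (e : Pt) : interiorProd e (0 : Form (p + 1)) = 0 :=
  (interiorProdₗ p e).map_zero

theorem Frame.star_add (F : Frame) (h : p + q = 4) (α β : Form p) :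
    F.star h (α + β) = F.star h α + F.star h β := (F.starₗ h).map_add α β
theorem Frame.star_sub (F : Frame) (h : p + q = 4) (α β : Form p) :
    F.star h (α - β) = F.star h α - F.star h β := (F.starₗ h).map_sub α β
theorem Frame.star_smul (F : Frame) (h : p + q = 4) (c : ℝ) (α : Form p) :
    F.star h (c • α) = c • F.star h α := (F.starₗ h).map_smul c α
theorem Frame.star_sum (F : Frame) (h : p + q = 4) (α : ι → Form p) :
    F.star h (∑ i ∈ s, α i) = ∑ i ∈ s, F.star h (α i) := map_sum (F.starₗ h) α s
theorem Frame.star_zero (F : Frame) (h : p + q = 4) : F.star h (0 : Form p) = 0 :=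
  (F.starₗ h).map_zero
end

theorem scalar_add (α β : Form 0) : (α + β).scalar = α.scalar + β.scalar := rfl
theorem scalar_smul (c : ℝ) (α : Form 0) : (c • α).scalar = c * α.scalar := rfl
theorem top_smul (c : ℝ) (α : Form 4) : (c • α).top = c * α.top := rfl
theorem scalar_sum {ι : Type*} (s : Finset ι) (α : ι → Form 0) :
    (∑ i ∈ s, α i).scalar = ∑ i ∈ s, (α i).scalar := by simp [Form.scalar]

end
end MAG

namespace MAG
noncomputable section

/-! ### Linearity of the irreducible pieces in the curvature -/

/-- Linearity is stated throughout for c • M + N, which covers sums and multiples in one rewriting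
rule; the value at 0 is recovered from c = −1. -/
theorem altPart_lin (c : ℝ) (M N : TwoForms) :
    altPart (c • M + N) = c • altPart M + altPart N := by
  funext a b
  simp only [altPart, Pi.add_apply, Pi.smul_apply]
  module

theorem symPart_lin (c : ℝ) (M N : TwoForms) :
    symPart (c • M + N) = c • symPart M + symPart N := by
  funext a b
  simp only [symPart, Pi.add_apply, Pi.smul_apply]
  module

namespace Frame

variable (F : Frame) (c : ℝ) (M N : TwoForms)

theorem lowerCurv_lin : F.lowerCurv (c • M + N) = c • F.lowerCurv M + F.lowerCurv N := by
  funext a b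
  simp only [lowerCurv, Pi.add_apply, Pi.smul_apply, smul_add, Finset.sum_add_distrib,
    Finset.smul_sum, smul_comm c]

theorem raiseTwo_lin : F.raiseTwo (c • M + N) = c • F.raiseTwo M + F.raiseTwo N := by
  funext a b
  simp only [raiseTwo, Pi.add_apply, Pi.smul_apply, smul_add, Finset.sum_add_distrib,
    Finset.smul_sum, smul_comm c]

theorem X_lin : F.X (c • M + N) = c • F.X M + F.X N := by
  funext a
  simp only [X, Pi.add_apply, Pi.smul_apply, interiorProd_add_right, interiorProd_smul_right,
    Finset.sum_add_distrib, Finset.smul_sum]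

theorem Xbar_lin : F.Xbar (c • M + N) = c • F.Xbar M + F.Xbar N := by
  funext a
  simp only [Xbar, Pi.add_apply, Pi.smul_apply, wedge_add_left, wedge_smul_left,
    Finset.sum_add_distrib, ← Finset.smul_sum, star_add, star_smul]

theorem coframeWedge_lin (B C : Fin 4 → Form 1) :
    F.coframeWedge (c • B + C) = c • F.coframeWedge B + F.coframeWedge C := by
  simp only [coframeWedge, Pi.add_apply, Pi.smul_apply, wedge_add_right, wedge_smul_right,
    Finset.sum_add_distrib, Finset.smul_sum]

theorem Xscal_lin : F.Xscal (c • M + N) = c * F.Xscal M + F.Xscal N := by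
  simp only [Xscal, X_lin, Pi.add_apply, Pi.smul_apply, interiorProd_add_right,
    interiorProd_smul_right, scalar_add, scalar_smul, Finset.sum_add_distrib, Finset.mul_sum]

theorem XbarScal_lin : F.XbarScal (c • M + N) = c * F.XbarScal M + F.XbarScal N := by
  simp only [XbarScal, Xbar_lin, Pi.add_apply, Pi.smul_apply, interiorProd_add_right,
    interiorProd_smul_right, scalar_add, scalar_smul, Finset.sum_add_distrib, Finset.mul_sum]

theorem Psi_lin : F.Psi (c • M + N) = c • F.Psi M + F.Psi N := by
  funext a
  simp only [Psi, X_lin, Xscal_lin, coframeWedge_lin, Pi.add_apply, Pi.smul_apply,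
    interiorProd_add_right, interiorProd_smul_right]
  module

theorem PsiBar_lin : F.PsiBar (c • M + N) = c • F.PsiBar M + F.PsiBar N := by
  funext a
  simp only [PsiBar, Xbar_lin, XbarScal_lin, coframeWedge_lin, Pi.add_apply, Pi.smul_apply,
    interiorProd_add_right, interiorProd_smul_right]
  module

theorem W2_lin : F.W2 (c • M + N) = c • F.W2 M + F.W2 N := by
  funext a b
  simp only [W2, altPart, PsiBar_lin, Pi.add_apply, Pi.smul_apply, wedge_add_right,
    wedge_smul_right, star_smul, star_add, star_sub]
  module

theorem W3_lin : F.W3 (c • M + N) = c • F.W3 M + F.W3 N := by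
  funext a b
  simp only [W3, XbarScal_lin, Pi.add_apply, Pi.smul_apply, star_smul]
  module

theorem W4_lin : F.W4 (c • M + N) = c • F.W4 M + F.W4 N := by
  funext a b
  simp only [W4, altPart, Psi_lin, Pi.add_apply, Pi.smul_apply, wedge_add_right, wedge_smul_right]
  module

theorem W5_lin : F.W5 (c • M + N) = c • F.W5 M + F.W5 N := by
  funext a b
  simp only [W5, altPart, X_lin, coframeWedge_lin, Pi.add_apply, Pi.smul_apply, wedge_add_right,
    wedge_smul_right, interiorProd_add_right, interiorProd_smul_right]
  module

theorem W6_lin : F.W6 (c • M + N) = c • F.W6 M + F.W6 N := by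
  funext a b
  simp only [W6, Xscal_lin, Pi.add_apply, Pi.smul_apply]
  module

theorem W1_lin : F.W1 (c • M + N) = c • F.W1 M + F.W1 N := by
  funext a b
  simp only [W1, W2_lin, W3_lin, W4_lin, W5_lin, W6_lin, Pi.add_apply, Pi.smul_apply]
  module

theorem Z5_lin : F.Z5 (c • M + N) = c • F.Z5 M + F.Z5 N := by
  funext a b
  simp only [Z5, Pi.add_apply, Pi.smul_apply, smul_add, Finset.sum_add_distrib,
    Finset.smul_sum, smul_comm c]

theorem Y_lin : F.Y (c • M + N) = c • F.Y M + F.Y N := by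
  have h : ∀ a b, (c • M + N) a b - F.Z5 (c • M + N) a b
      = c • (M a b - F.Z5 M a b) + (N a b - F.Z5 N a b) := fun a b => by
    simp only [Z5_lin, Pi.add_apply, Pi.smul_apply]; module
  funext a
  simp only [Y, h]
  simp only [Y, Pi.add_apply, Pi.smul_apply, interiorProd_add_right, interiorProd_smul_right,
    Finset.sum_add_distrib, Finset.smul_sum]

theorem Ybar_lin : F.Ybar (c • M + N) = c • F.Ybar M + F.Ybar N := by
  have h : ∀ a b, (c • M + N) a b - F.Z5 (c • M + N) a b
      = c • (M a b - F.Z5 M a b) + (N a b - F.Z5 N a b) := fun a b => by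
    simp only [Z5_lin, Pi.add_apply, Pi.smul_apply]; module
  funext a
  simp only [Ybar, h]
  simp only [Ybar, Pi.add_apply, Pi.smul_apply, wedge_add_left, wedge_smul_left,
    Finset.sum_add_distrib, ← Finset.smul_sum, star_add, star_smul]

theorem Phi_lin : F.Phi (c • M + N) = c • F.Phi M + F.Phi N := by
  funext a
  simp only [Phi, Y_lin, coframeWedge_lin, Pi.add_apply, Pi.smul_apply,
    interiorProd_add_right, interiorProd_smul_right]
  module

theorem PhiBar_lin : F.PhiBar (c • M + N) = c • F.PhiBar M + F.PhiBar N := by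
  funext a
  simp only [PhiBar, Ybar_lin, coframeWedge_lin, Pi.add_apply, Pi.smul_apply,
    interiorProd_add_right, interiorProd_smul_right]
  module

theorem Z2_lin : F.Z2 (c • M + N) = c • F.Z2 M + F.Z2 N := by
  funext a b
  simp only [Z2, symPart, PhiBar_lin, Pi.add_apply, Pi.smul_apply, wedge_add_right,
    wedge_smul_right, star_smul, star_add]
  module

theorem Z3_lin : F.Z3 (c • M + N) = c • F.Z3 M + F.Z3 N := by
  funext a b
  simp only [Z3, symPart, Y_lin, coframeWedge_lin, Pi.add_apply, Pi.smul_apply, wedge_add_right,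
    wedge_smul_right, interiorProd_add_right, interiorProd_smul_right]
  module

theorem Z4_lin : F.Z4 (c • M + N) = c • F.Z4 M + F.Z4 N := by
  funext a b
  simp only [Z4, symPart, Phi_lin, Pi.add_apply, Pi.smul_apply, wedge_add_right, wedge_smul_right]
  module

theorem Z1_lin : F.Z1 (c • M + N) = c • F.Z1 M + F.Z1 N := by
  funext a b
  simp only [Z1, Z2_lin, Z3_lin, Z4_lin, Z5_lin, Pi.add_apply, Pi.smul_apply]
  module

theorem crossTerm_lin : F.crossTerm (c • M + N) = c • F.crossTerm M + F.crossTerm N := by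
  funext a b
  simp only [crossTerm, Pi.add_apply, Pi.smul_apply, interiorProd_add_right,
    interiorProd_smul_right, Finset.sum_add_distrib, ← Finset.smul_sum, wedge_add_right,
    wedge_smul_right]

theorem crossTerm'_lin : F.crossTerm' (c • M + N) = c • F.crossTerm' M + F.crossTerm' N := by
  funext a b
  simp only [crossTerm', Pi.add_apply, Pi.smul_apply, interiorProd_add_right,
    interiorProd_smul_right, Finset.sum_add_distrib, Finset.smul_sum, wedge_add_right,
    wedge_smul_right]

end Frame

theorem strongBracket_lin (P : StrongParams) (F : Frame) (c : ℝ) (M N : TwoForms) :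
    strongBracket P F (c • M + N) = c • strongBracket P F M + strongBracket P F N := by
  simp only [strongBracket, Frame.lowerCurv_lin, altPart_lin, symPart_lin, Frame.W1_lin,
    Frame.W2_lin, Frame.W3_lin, Frame.W4_lin, Frame.W5_lin, Frame.W6_lin, Frame.Z1_lin,
    Frame.Z2_lin, Frame.Z3_lin, Frame.Z4_lin, Frame.Z5_lin, Frame.crossTerm_lin,
    Frame.crossTerm'_lin]
  module

theorem top_wedge_lin_left (c : ℝ) (α α' β : Form 2) :
    (wedge (c • α + α') β : Form 4).top
      = c * (wedge α β : Form 4).top + (wedge α' β : Form 4).top := by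
  rw [wedge_add_left, wedge_smul_left]; rfl

theorem top_wedge_lin_right (c : ℝ) (α β β' : Form 2) :
    (wedge α (c • β + β') : Form 4).top
      = c * (wedge α β : Form 4).top + (wedge α β' : Form 4).top := by
  rw [wedge_add_right, wedge_smul_right]; rfl

/-- The bilinear form `R_ab ∧ ⋆[…](S)^{ab}` underlying the Lagrangian. -/
def strongForm (P : StrongParams) (F : Frame) (R S : TwoForms) : ℝ :=
  ∑ a, ∑ b, (wedge (F.lowerCurv R a b)
      (F.star (rfl : 2 + 2 = 4) (F.raiseTwo (strongBracket P F S) a b)) : Form 4).top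

theorem strongLagrangian_top (P : StrongParams) (F : Frame) (R : TwoForms) :
    (strongLagrangian P F R).top = -(1 / (2 * P.ρ)) * strongForm P F R R := by
  simp only [strongLagrangian, strongForm]
  refine (top_smul _ _).trans ?_
  simp only [Form.top, Finset.sum_apply]

theorem strongForm_lin_left (P : StrongParams) (F : Frame) (c : ℝ) (R R' S : TwoForms) :
    strongForm P F (c • R + R') S = c * strongForm P F R S + strongForm P F R' S := by
  simp only [strongForm, Frame.lowerCurv_lin, Pi.add_apply, Pi.smul_apply,
    top_wedge_lin_left, Finset.sum_add_distrib, Finset.mul_sum]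

theorem strongForm_lin_right (P : StrongParams) (F : Frame) (c : ℝ) (R S S' : TwoForms) :
    strongForm P F R (c • S + S') = c * strongForm P F R S + strongForm P F R S' := by
  simp only [strongForm, strongBracket_lin, Frame.raiseTwo_lin, Pi.add_apply, Pi.smul_apply,
    Frame.star_add, Frame.star_smul, top_wedge_lin_right,
    Finset.sum_add_distrib, Finset.mul_sum]

end
end MAG

namespace MAG
noncomputable section

/-! ### Changes of frame and rescalings of the coordinates -/

/-- Pullback of a form under the diagonal map with entries `t`. -/
def scale (t : Fin 4 → ℝ) {p : ℕ} : Form p →ₗ[ℝ] Form p where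
  toFun α := fun i => (∏ m, t (i m)) * α i
  map_add' α β := by ext i; simp only [Pi.add_apply, mul_add]
  map_smul' c α := by ext i; simp only [Pi.smul_apply, smul_eq_mul, RingHom.id_apply]; ring

theorem scale_apply (t : Fin 4 → ℝ) {p : ℕ} (α : Form p) (i : Fin p → Fin 4) :
    scale t α i = (∏ m, t (i m)) * α i := rfl

/-- The corresponding transformation of vectors. -/
def scaleVec (t : Fin 4 → ℝ) : Pt →ₗ[ℝ] Pt where
  toFun e := fun μ => (t μ)⁻¹ * e μ
  map_add' α β := by ext i; simp only [Pi.add_apply, mul_add]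
  map_smul' c α := by ext i; simp only [Pi.smul_apply, smul_eq_mul, RingHom.id_apply]; ring

theorem scaleVec_apply (t : Fin 4 → ℝ) (e : Pt) (μ : Fin 4) :
    scaleVec t e μ = (t μ)⁻¹ * e μ := rfl

theorem scale_one {p : ℕ} (α : Form p) : scale 1 α = α := by
  ext i; simp [scale_apply]

theorem scale_scalar (t : Fin 4 → ℝ) (α : Form 0) : (scale t α).scalar = α.scalar := by
  simp [Form.scalar, scale_apply]

theorem scale_top {t : Fin 4 → ℝ} (ht : ∏ μ, t μ = 1) (α : Form 4) :
    (scale t α).top = α.top := by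
  have : ∏ m, t ((![0, 1, 2, 3] : Fin 4 → Fin 4) m) = 1 := by
    rw [← ht]; refine Finset.prod_congr rfl fun m _ => ?_
    fin_cases m <;> rfl
  rw [Form.top, scale_apply, this, one_mul, Form.top]

theorem wedge_scale (t : Fin 4 → ℝ) {p q : ℕ} (α : Form p) (β : Form q) :
    wedge (scale t α) (scale t β) = scale t (wedge α β) := by
  ext i
  rw [scale_apply, wedge, wedge, mul_left_comm]
  congr 1
  rw [Finset.mul_sum]
  refine Finset.sum_congr rfl fun σ _ => ?_
  have h : ∏ m, t (i m) = (∏ k, t (i (σ (Fin.castAdd q k)))) * ∏ k, t (i (σ (Fin.natAdd p k))) := by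
    rw [← Fin.prod_univ_add (fun m => t (i (σ m))), Equiv.prod_comp σ (fun m => t (i m))]
  rw [scale_apply, scale_apply, h]
  ring

theorem interiorProd_scale {t : Fin 4 → ℝ} (ht : ∀ μ, t μ ≠ 0) {p : ℕ} (e : Pt)
    (α : Form (p + 1)) :
    interiorProd (scaleVec t e) (scale t α) = scale t (interiorProd e α) := by
  ext i
  rw [scale_apply, interiorProd, interiorProd, Finset.mul_sum]
  refine Finset.sum_congr rfl fun μ _ => ?_
  rw [scale_apply, scaleVec_apply, Fin.prod_univ_succ]
  simp only [Fin.cons_zero, Fin.cons_succ]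
  field_simp [ht μ]

/-- For a permutation i the weights multiply to ∏ t = 1; otherwise two rows of the determinant agree
and the symbol vanishes. -/
theorem leviCivita_mul_prod {t : Fin 4 → ℝ} (ht : ∏ μ, t μ = 1) (i : Fin 4 → Fin 4) :
    leviCivita i * ∏ k, t (i k) = leviCivita i := by
  by_cases hi : Function.Injective i
  · have hb : Function.Bijective i := Finite.injective_iff_bijective.mp hi
    rw [Function.Bijective.prod_comp hb t, ht, mul_one]
  · obtain ⟨a, b, hab, hne⟩ : ∃ a b, i a = i b ∧ a ≠ b := by
      simpa [Function.Injective] using hi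
    have : leviCivita i = 0 := by
      refine Matrix.det_zero_of_row_eq hne ?_
      funext c; simp [hab]
    rw [this, zero_mul]

/-- Transformation of a family of forms with one covariant frame index. -/
def tr1 (U : Matrix (Fin 4) (Fin 4) ℝ) (t : Fin 4 → ℝ) {p : ℕ} :
    (Fin 4 → Form p) →ₗ[ℝ] (Fin 4 → Form p) where
  toFun X := fun a => ∑ c, U c a • scale t (X c)
  map_add' X Y := by
    funext a; simp only [Pi.add_apply, map_add, smul_add, Finset.sum_add_distrib]
  map_smul' r X := by
    funext a
    simp only [Pi.smul_apply, map_smul, Finset.smul_sum, smul_comm r, RingHom.id_apply]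

/-- Transformation of a family of two-forms with two covariant frame indices. -/
def tr2 (U : Matrix (Fin 4) (Fin 4) ℝ) (t : Fin 4 → ℝ) : TwoForms →ₗ[ℝ] TwoForms where
  toFun M := fun a b => ∑ c, ∑ d, (U c a * U d b) • scale t (M c d)
  map_add' X Y := by
    funext a b; simp only [Pi.add_apply, map_add, smul_add, Finset.sum_add_distrib]
  map_smul' r X := by
    funext a b
    simp only [Pi.smul_apply, map_smul, Finset.smul_sum, smul_comm r, RingHom.id_apply]

theorem tr1_apply (U : Matrix (Fin 4) (Fin 4) ℝ) (t : Fin 4 → ℝ) {p : ℕ} (X : Fin 4 → Form p)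
    (a : Fin 4) : tr1 U t X a = ∑ c, U c a • scale t (X c) := rfl

theorem tr2_apply (U : Matrix (Fin 4) (Fin 4) ℝ) (t : Fin 4 → ℝ) (M : TwoForms) (a b : Fin 4) :
    tr2 U t M a b = ∑ c, ∑ d, (U c a * U d b) • scale t (M c d) := rfl

theorem tr2_eq_left (U : Matrix (Fin 4) (Fin 4) ℝ) (t : Fin 4 → ℝ) (M : TwoForms) (a b : Fin 4) :
    tr2 U t M a b = ∑ c, U c a • ∑ d, U d b • scale t (M c d) := by
  simp only [tr2_apply, mul_smul, Finset.smul_sum]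

theorem tr2_eq_right (U : Matrix (Fin 4) (Fin 4) ℝ) (t : Fin 4 → ℝ) (M : TwoForms) (a b : Fin 4) :
    tr2 U t M a b = ∑ d, U d b • ∑ c, U c a • scale t (M c d) := by
  rw [tr2_apply, Finset.sum_comm]
  refine Finset.sum_congr rfl fun d _ => ?_
  rw [Finset.smul_sum]
  exact Finset.sum_congr rfl fun c _ => by rw [smul_smul, mul_comm]

theorem altPart_tr2 (U : Matrix (Fin 4) (Fin 4) ℝ) (t : Fin 4 → ℝ) (M : TwoForms) :
    altPart (tr2 U t M) = tr2 U t (altPart M) := by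
  funext a b
  have h1 : ∀ c d, (U c a * U d b) • scale t ((1 / 2 : ℝ) • (M c d - M d c))
      = (1 / 2 : ℝ) • ((U c a * U d b) • scale t (M c d) - (U c a * U d b) • scale t (M d c)) :=
    fun c d => by rw [map_smul, map_sub]; module
  have h2 : tr2 U t M b a = ∑ c, ∑ d, (U c a * U d b) • scale t (M d c) := by
    rw [tr2_apply, Finset.sum_comm]
    exact Finset.sum_congr rfl fun _ _ => Finset.sum_congr rfl fun _ _ => by rw [mul_comm]
  rw [altPart, h2, tr2_apply, tr2_apply]
  simp only [altPart, h1, ← Finset.smul_sum, Finset.sum_sub_distrib]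

theorem symPart_tr2 (U : Matrix (Fin 4) (Fin 4) ℝ) (t : Fin 4 → ℝ) (M : TwoForms) :
    symPart (tr2 U t M) = tr2 U t (symPart M) := by
  funext a b
  have h1 : ∀ c d, (U c a * U d b) • scale t ((1 / 2 : ℝ) • (M c d + M d c))
      = (1 / 2 : ℝ) • ((U c a * U d b) • scale t (M c d) + (U c a * U d b) • scale t (M d c)) :=
    fun c d => by rw [map_smul, map_add]; module
  have h2 : tr2 U t M b a = ∑ c, ∑ d, (U c a * U d b) • scale t (M d c) := by
    rw [tr2_apply, Finset.sum_comm]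
    exact Finset.sum_congr rfl fun _ _ => Finset.sum_congr rfl fun _ _ => by rw [mul_comm]
  rw [symPart, h2, tr2_apply, tr2_apply]
  simp only [symPart, h1, ← Finset.smul_sum, Finset.sum_add_distrib]

theorem wedge_tr1 (U : Matrix (Fin 4) (Fin 4) ℝ) (t : Fin 4 → ℝ) (X Y : Fin 4 → Form 1)
    (a b : Fin 4) :
    (wedge (tr1 U t X a) (tr1 U t Y b) : Form 2)
      = tr2 U t (fun c d => (wedge (X c) (Y d) : Form 2)) a b := by
  simp only [tr1_apply, tr2_eq_left]
  refine (wedge_sum_left _ _ _).trans (Finset.sum_congr rfl fun c _ => ?_)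
  rw [wedge_smul_left]
  congr 1
  refine (wedge_sum_right _ _ _).trans (Finset.sum_congr rfl fun d _ => ?_)
  rw [wedge_smul_right, wedge_scale]

/-- Contraction of a contravariant with a covariant frame index. -/
theorem contract {E G K : Type*} [AddCommGroup E] [Module ℝ E] [AddCommGroup G] [Module ℝ G]
    [AddCommGroup K] [Module ℝ K] {U V : Matrix (Fin 4) (Fin 4) ℝ} (hUV : U * V = 1)
    (f : E →ₗ[ℝ] G →ₗ[ℝ] K) (x : Fin 4 → E) (y : Fin 4 → G) :
    ∑ b, f (∑ c, V b c • x c) (∑ d, U d b • y d) = ∑ c, f (x c) (y c) := by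
  have h : ∀ b, f (∑ c, V b c • x c) (∑ d, U d b • y d)
      = ∑ c, ∑ d, (U d b * V b c) • f (x c) (y d) := fun b => by
    rw [LinearMap.map_sum₂]
    refine Finset.sum_congr rfl fun c _ => ?_
    rw [LinearMap.map_smul₂, map_sum, Finset.smul_sum]
    refine Finset.sum_congr rfl fun d _ => ?_
    rw [map_smul, smul_smul, mul_comm]
  simp only [h]
  rw [Finset.sum_comm]
  refine Finset.sum_congr rfl fun c _ => ?_
  rw [Finset.sum_comm]
  simp only [← Finset.sum_smul]
  have h2 : ∀ d, ∑ b, U d b * V b c = (1 : Matrix (Fin 4) (Fin 4) ℝ) d c := fun d => by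
    rw [← hUV, Matrix.mul_apply]
  simp [h2, Matrix.one_apply]

/-- `F'` arises from `F` by a change of frame with matrix `U` (inverse `V`) and a unimodular
rescaling `t` of the coordinates. -/
structure FrameRel (U V : Matrix (Fin 4) (Fin 4) ℝ) (t : Fin 4 → ℝ) (F F' : Frame) : Prop where
  inv : U * V = 1
  prod : ∏ μ, t μ = 1
  g : ∀ a b, F'.g a b = ∑ c, ∑ d, (U c a * U d b) * F.g c d
  θ : ∀ a, F'.θ a = ∑ b, V a b • scale t (F.θ b)

namespace FrameRel

variable {U V : Matrix (Fin 4) (Fin 4) ℝ} {t : Fin 4 → ℝ} {F F' : Frame}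

theorem ne (h : FrameRel U V t F F') (μ : Fin 4) : t μ ≠ 0 := fun h0 => by
  have := h.prod
  rw [Finset.prod_eq_zero (Finset.mem_univ μ) h0] at this
  exact zero_ne_one this

theorem inv' (h : FrameRel U V t F F') : V * U = 1 := mul_eq_one_comm.mp h.inv

theorem g_matrix (h : FrameRel U V t F F') :
    Matrix.of F'.g = U.transpose * Matrix.of F.g * U := by
  ext a b
  simp only [Matrix.of_apply, h.g, Matrix.mul_apply, Matrix.transpose_apply, Finset.sum_mul]
  rw [Finset.sum_comm]
  exact Finset.sum_congr rfl fun _ _ => Finset.sum_congr rfl fun _ _ => by ring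

theorem coframe_matrix (h : FrameRel U V t F F') :
    F'.coframeMatrix = V * F.coframeMatrix * Matrix.diagonal t := by
  ext a μ
  rw [Matrix.mul_diagonal, Matrix.mul_apply, Finset.sum_mul]
  simp only [Frame.coframeMatrix, Matrix.of_apply, h.θ, Finset.sum_apply, Pi.smul_apply,
    smul_eq_mul, scale_apply]
  refine Finset.sum_congr rfl fun b _ => ?_
  simp only [Fin.prod_univ_one, Matrix.cons_val_fin_one]
  ring

theorem U_inv (h : FrameRel U V t F F') : U⁻¹ = V := Matrix.inv_eq_right_inv h.inv

theorem V_inv (h : FrameRel U V t F F') : V⁻¹ = U := Matrix.inv_eq_right_inv h.inv'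

theorem diag_inv (h : FrameRel U V t F F') :
    (Matrix.diagonal t)⁻¹ = Matrix.diagonal fun μ => (t μ)⁻¹ := by
  refine Matrix.inv_eq_right_inv ?_
  rw [Matrix.diagonal_mul_diagonal]
  simp [h.ne]

theorem gInv (h : FrameRel U V t F F') (a b : Fin 4) :
    F'.gInv a b = ∑ c, V a c * ∑ d, V b d * F.gInv c d := by
  rw [Frame.gInv, h.g_matrix, Matrix.mul_inv_rev, Matrix.mul_inv_rev, ← Matrix.transpose_nonsing_inv,
    h.U_inv]
  simp only [Matrix.mul_apply, Matrix.transpose_apply, Finset.mul_sum, Frame.gInv]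
  exact Finset.sum_congr rfl fun _ _ => Finset.sum_congr rfl fun _ _ => by ring

theorem e (h : FrameRel U V t F F') (a : Fin 4) : F'.e a = ∑ b, U b a • scaleVec t (F.e b) := by
  funext μ
  rw [Frame.e, h.coframe_matrix, Matrix.mul_inv_rev, Matrix.mul_inv_rev, h.V_inv, h.diag_inv]
  rw [Matrix.diagonal_mul, Matrix.mul_apply, Finset.mul_sum]
  simp only [Finset.sum_apply, Pi.smul_apply, smul_eq_mul, scaleVec_apply, Frame.e]
  exact Finset.sum_congr rfl fun _ _ => by ring

theorem eUp (h : FrameRel U V t F F') (a : Fin 4) :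
    F'.eUp a = ∑ b, V a b • scaleVec t (F.eUp b) := by
  have := contract (K := Pt) h.inv (LinearMap.lsmul ℝ Pt)
    (fun d => ∑ c, V a c * F.gInv c d) (fun b => scaleVec t (F.e b))
  simp only [LinearMap.lsmul_apply] at this
  rw [Frame.eUp]
  simp only [h.gInv, h.e]
  rw [show (∑ b, (∑ c, V a c * ∑ d, V b d * F.gInv c d) • ∑ b_1, U b_1 b • scaleVec t (F.e b_1))
    = ∑ b, (∑ d, V b d • ∑ c, V a c * F.gInv c d) • ∑ b_1, U b_1 b • scaleVec t (F.e b_1) from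
    Finset.sum_congr rfl fun b _ => by
      congr 1
      simp only [smul_eq_mul, Finset.mul_sum]
      rw [Finset.sum_comm]
      exact Finset.sum_congr rfl fun _ _ => Finset.sum_congr rfl fun _ _ => by ring, this]
  simp only [Frame.eUp, map_sum, map_smul, Finset.sum_smul, Finset.smul_sum, mul_smul]
  rw [Finset.sum_comm]

theorem θLow (h : FrameRel U V t F F') : F'.θLow = tr1 U t F.θLow := by
  funext a
  have := contract (K := Form 1) h.inv (LinearMap.lsmul ℝ (Form 1)).flip
    (fun d => scale t (F.θ d)) (fun d => ∑ c, U c a * F.g c d)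
  simp only [LinearMap.flip_apply, LinearMap.lsmul_apply] at this
  rw [Frame.θLow]
  simp only [h.g, h.θ]
  rw [show (∑ b, (∑ c, ∑ d, (U c a * U d b) * F.g c d) • ∑ d, V b d • scale t (F.θ d))
    = ∑ b, (∑ d, U d b • ∑ c, U c a * F.g c d) • ∑ d, V b d • scale t (F.θ d) from
    Finset.sum_congr rfl fun b _ => by
      congr 1
      simp only [smul_eq_mul, Finset.mul_sum]
      rw [Finset.sum_comm]
      exact Finset.sum_congr rfl fun _ _ => Finset.sum_congr rfl fun _ _ => by ring, this]
  simp only [Frame.θLow, tr1_apply, map_sum, map_smul, Finset.sum_smul, Finset.smul_sum, mul_smul]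
  rw [Finset.sum_comm]

theorem coordMetric_eq (F : Frame) :
    F.coordMetric = F.coframeMatrix.transpose * Matrix.of F.g * F.coframeMatrix := by
  ext μ ν
  simp only [Frame.coordMetric, Frame.coframeMatrix, Matrix.of_apply, Matrix.mul_apply,
    Matrix.transpose_apply, Finset.sum_mul]
  rw [Finset.sum_comm]
  exact Finset.sum_congr rfl fun _ _ => Finset.sum_congr rfl fun _ _ => by ring

theorem coordMetric (h : FrameRel U V t F F') :
    F'.coordMetric = Matrix.diagonal t * F.coordMetric * Matrix.diagonal t := by
  have h1 : V.transpose * U.transpose = 1 := by rw [← Matrix.transpose_mul, h.inv, Matrix.transpose_one]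
  rw [coordMetric_eq, coordMetric_eq, h.g_matrix, h.coframe_matrix, Matrix.transpose_mul,
    Matrix.transpose_mul, Matrix.diagonal_transpose]
  calc _ = Matrix.diagonal t * (F.coframeMatrix.transpose * (V.transpose * U.transpose)
        * Matrix.of F.g * ((U * V) * F.coframeMatrix)) * Matrix.diagonal t := by
        simp only [Matrix.mul_assoc]
    _ = _ := by rw [h1, h.inv, Matrix.mul_one, Matrix.one_mul]

theorem det (h : FrameRel U V t F F') : F'.coordMetric.det = F.coordMetric.det := by
  rw [h.coordMetric, Matrix.det_mul, Matrix.det_mul, Matrix.det_diagonal, h.prod]; ring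

/-- The determinant of the anholonomic metric is multiplied by (det U)² > 0. -/
theorem sgn (h : FrameRel U V t F F') : F'.sgn = F.sgn := by
  have hU : U.det ≠ 0 := fun h0 => by
    have := congrArg Matrix.det h.inv
    simp [h0] at this
  rw [Frame.sgn, Frame.sgn, h.g_matrix, Matrix.det_mul, Matrix.det_mul, Matrix.det_transpose,
    show U.det * (Matrix.of F.g).det * U.det = U.det ^ 2 * (Matrix.of F.g).det by ring]
  rcases lt_trichotomy (Matrix.of F.g).det 0 with h1 | h1 | h1
  · rw [Real.sign_of_neg h1, Real.sign_of_neg (mul_neg_of_pos_of_neg (by positivity) h1)]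
  · rw [h1, mul_zero]
  · rw [Real.sign_of_pos h1, Real.sign_of_pos (by positivity)]

/-- Raising the p indices yields inverse weights. Since the weights of all four indices of the
Levi-Civita symbol multiply to 1, these inverse weights are exactly the weights of the q free
indices. -/
theorem star (h : FrameRel U V t F F') {p q : ℕ} (hpq : p + q = 4) (α : Form p) :
    F'.star hpq (scale t α) = scale t (F.star hpq α) := by
  have hinv : ∀ μ ν, F'.coordMetric⁻¹ μ ν = (t μ)⁻¹ * F.coordMetric⁻¹ μ ν * (t ν)⁻¹ := by
    intro μ ν
    rw [h.coordMetric, Matrix.mul_inv_rev, Matrix.mul_inv_rev, h.diag_inv]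
    simp only [Matrix.mul_diagonal, Matrix.diagonal_mul]
    ring
  have hr : ∀ i, F'.raiseForm (scale t α) i = (∏ m, (t (i m))⁻¹) * F.raiseForm α i := by
    intro i
    rw [Frame.raiseForm, Frame.raiseForm, Finset.mul_sum]
    refine Finset.sum_congr rfl fun j _ => ?_
    simp only [hinv, Finset.prod_mul_distrib, scale_apply]
    have : (∏ m, (t (j m))⁻¹) * ∏ m, t (j m) = 1 := by
      rw [← Finset.prod_mul_distrib]
      exact Finset.prod_eq_one fun m _ => inv_mul_cancel₀ (h.ne _)
    linear_combination ((∏ m, (t (i m))⁻¹) * (∏ m, F.coordMetric⁻¹ (i m) (j m)) * α j) * this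
  ext j
  rw [scale_apply, Frame.star, Frame.star, mul_left_comm]
  congr 1
  rw [Finset.mul_sum]
  refine Finset.sum_congr rfl fun i _ => ?_
  rw [hr, h.det]
  have hl := leviCivita_mul_prod h.prod (fun k => Fin.append i j (Fin.cast hpq.symm k))
  have hp : ∏ k, t (Fin.append i j (Fin.cast hpq.symm k)) = (∏ m, t (i m)) * ∏ m, t (j m) := by
    refine (Fintype.prod_equiv (finCongr hpq.symm) _ (fun k => t (Fin.append i j k))
      (fun _ => rfl)).trans ?_
    rw [Fin.prod_univ_add]
    simp only [Fin.append_left, Fin.append_right]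
  have hi : (∏ m, (t (i m))⁻¹) * ∏ m, t (i m) = 1 := by
    rw [← Finset.prod_mul_distrib]
    exact Finset.prod_eq_one fun m _ => inv_mul_cancel₀ (h.ne _)
  rw [hp] at hl
  linear_combination (-(∏ m, (t (i m))⁻¹) * F.raiseForm α i * √|F.coordMetric.det|) * hl
    + (F.raiseForm α i * √|F.coordMetric.det| * (∏ m, t (j m)) *
      leviCivita (fun k => Fin.append i j (Fin.cast hpq.symm k))) * hi

end FrameRel
end
end MAG

namespace MAG
noncomputable section

/-! ### Covariance of the irreducible pieces -/

namespace FrameRel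

variable {U V : Matrix (Fin 4) (Fin 4) ℝ} {t : Fin 4 → ℝ} {F F' : Frame}
  (h : FrameRel U V t F F') (M : TwoForms)
include h

theorem interiorProd_e {p : ℕ} (α : Form (p + 1)) :
    (fun a => interiorProd (F'.e a) (scale t α)) = tr1 U t fun a => interiorProd (F.e a) α := by
  funext a
  simp only [h.e, tr1_apply, interiorProd_sum_left, interiorProd_smul_left,
    MAG.interiorProd_scale h.ne]

theorem X : F'.X (tr2 U t M) = tr1 U t (F.X M) := by
  funext a
  have := contract h.inv (interiorProdₗ 1) (fun c => scaleVec t (F.eUp c))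
    (fun d => ∑ c, U c a • scale t (M c d))
  simp only [Frame.X, h.eUp, tr2_eq_right]
  refine this.trans ?_
  simp only [tr1_apply, Frame.X, map_sum, Finset.smul_sum]
  rw [Finset.sum_comm]
  refine Finset.sum_congr rfl fun d _ => Finset.sum_congr rfl fun c _ => ?_
  rw [map_smul, ← MAG.interiorProd_scale h.ne]
  rfl

theorem sum_wedge_θ {p : ℕ} (y : Fin 4 → Form p) :
    ∑ b, wedge (∑ d, U d b • scale t (y d)) (F'.θ b) = scale t (∑ b, wedge (y b) (F.θ b)) := by
  have := contract h.inv (wedgeₗ p 1).flip (fun c => scale t (F.θ c)) (fun d => scale t (y d))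
  simp only [h.θ]
  refine this.trans ?_
  rw [map_sum]
  exact Finset.sum_congr rfl fun d _ => wedge_scale t _ _

theorem Xbar : F'.Xbar (tr2 U t M) = tr1 U t (F.Xbar M) := by
  funext a
  have h1 : (∑ b, (wedge (tr2 U t M b a) (F'.θ b) : Form 3))
      = ∑ c, U c a • scale t (∑ b, (wedge (M b c) (F.θ b) : Form 3)) := by
    have := h.sum_wedge_θ (fun d => ∑ c, U c a • M d c)
    simp only [map_sum, map_smul] at this
    simp only [tr2_eq_left]
    refine this.trans ?_
    simp only [wedge_sum_left, wedge_smul_left, map_sum, map_smul, Finset.smul_sum]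
    rw [Finset.sum_comm]
  rw [Frame.Xbar, h1, Frame.star_sum, tr1_apply]
  exact Finset.sum_congr rfl fun c _ => by rw [Frame.star_smul, h.star]; rfl

theorem sum_scalar (B : Fin 4 → Form 1) :
    ∑ a, (interiorProd (F'.eUp a) (tr1 U t B a)).scalar
      = ∑ a, (interiorProd (F.eUp a) (B a)).scalar := by
  have := contract h.inv (interiorProdₗ 0) (fun c => scaleVec t (F.eUp c)) (fun d => scale t (B d))
  simp only [h.eUp, tr1_apply, ← scalar_sum]
  refine (congrArg Form.scalar this).trans ?_
  rw [scalar_sum, scalar_sum]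
  refine Finset.sum_congr rfl fun d _ => ?_
  rw [← scale_scalar t (interiorProd (F.eUp d) (B d)), ← MAG.interiorProd_scale h.ne]
  rfl

theorem Xscal : F'.Xscal (tr2 U t M) = F.Xscal M := by
  rw [Frame.Xscal, h.X, h.sum_scalar]; rfl

theorem XbarScal : F'.XbarScal (tr2 U t M) = F.XbarScal M := by
  rw [Frame.XbarScal, h.Xbar, h.sum_scalar]; rfl

theorem coframeWedge (B : Fin 4 → Form 1) :
    F'.coframeWedge (tr1 U t B) = scale t (F.coframeWedge B) := by
  have := contract h.inv (wedgeₗ 1 1) (fun c => scale t (F.θ c)) (fun d => scale t (B d))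
  simp only [Frame.coframeWedge, h.θ, tr1_apply]
  refine this.trans ?_
  rw [map_sum]
  exact Finset.sum_congr rfl fun d _ => wedge_scale t _ _

/-- The common shape of Ψ and Ψ̄, and with s = 0 of Φ and Φ̄, so that covariance of these four
follows from covariance of X, X̄, Y, Ȳ. -/
theorem trace_correction (B : Fin 4 → Form 1) (s r : ℝ) :
    (fun a => tr1 U t B a - s • F'.θLow a
      - r • interiorProd (F'.e a) (F'.coframeWedge (tr1 U t B)))
    = tr1 U t fun a => B a - s • F.θLow a - r • interiorProd (F.e a) (F.coframeWedge B) := by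
  have h1 : (fun a => B a - s • F.θLow a - r • interiorProd (F.e a) (F.coframeWedge B))
    = B - s • F.θLow - r • fun a => interiorProd (F.e a) (F.coframeWedge B) := rfl
  rw [h1, map_sub, map_sub, map_smul, map_smul, ← h.interiorProd_e, ← h.θLow, h.coframeWedge]
  rfl

theorem Psi : F'.Psi (tr2 U t M) = tr1 U t (F.Psi M) := by
  have := h.trace_correction (F.X M) ((1 / 4 : ℝ) * F.Xscal M) (1 / 2)
  rw [← h.X, ← h.Xscal M] at this
  rw [h.Xscal M] at this
  unfold Frame.Psi
  rw [← this, h.Xscal]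

theorem PsiBar : F'.PsiBar (tr2 U t M) = tr1 U t (F.PsiBar M) := by
  have := h.trace_correction (F.Xbar M) ((1 / 4 : ℝ) * F.XbarScal M) (1 / 2)
  rw [← h.Xbar] at this
  unfold Frame.PsiBar
  rw [← this, h.XbarScal]

theorem star_tr2 (N : TwoForms) :
    (fun a b => F'.star (rfl : 2 + 2 = 4) (tr2 U t N a b))
      = tr2 U t fun a b => F.star (rfl : 2 + 2 = 4) (N a b) := by
  funext a b
  simp only [tr2_apply, Frame.star_sum, Frame.star_smul, h.star]

theorem wedge_θLow (B : Fin 4 → Form 1) :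
    (fun c d => (wedge (F'.θLow c) (tr1 U t B d) : Form 2))
      = tr2 U t fun c d => (wedge (F.θLow c) (B d) : Form 2) := by
  funext c d
  rw [h.θLow, wedge_tr1]

theorem W2 : F'.W2 (tr2 U t M) = tr2 U t (F.W2 M) := by
  have h1 : F.W2 M = F.sgn • fun a b => F.star (rfl : 2 + 2 = 4)
    (altPart (fun c d => (wedge (F.θLow c) (F.PsiBar M d) : Form 2)) a b) := rfl
  rw [h1, map_smul, ← h.star_tr2, ← altPart_tr2, ← h.wedge_θLow, ← h.PsiBar, ← h.sgn]
  rfl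

theorem W3 : F'.W3 (tr2 U t M) = tr2 U t (F.W3 M) := by
  have h1 : F.W3 M = (F.sgn * (1 / 12 : ℝ)) • fun a b => F.star (rfl : 2 + 2 = 4)
    ((F.XbarScal M • fun a b => (wedge (F.θLow a) (F.θLow b) : Form 2) : TwoForms) a b) := rfl
  rw [h1, map_smul, ← h.star_tr2, map_smul, ← h.wedge_θLow, ← h.θLow, ← h.XbarScal, ← h.sgn]
  rfl

theorem W4 : F'.W4 (tr2 U t M) = tr2 U t (F.W4 M) := by
  have h1 : F.W4 M = (-(2 / 2) : ℝ) •
    altPart (fun c d => (wedge (F.θLow c) (F.Psi M d) : Form 2)) := rfl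
  rw [h1, map_smul, ← altPart_tr2, ← h.wedge_θLow, ← h.Psi]
  rfl

theorem W5 : F'.W5 (tr2 U t M) = tr2 U t (F.W5 M) := by
  have h1 : F.W5 M = (-(1 / 2) : ℝ) • altPart (fun c d =>
    (wedge (F.θLow c) ((fun d => interiorProd (F.e d) (F.coframeWedge (F.X M))) d) : Form 2)) := rfl
  rw [h1, map_smul, ← altPart_tr2, ← h.wedge_θLow, ← h.interiorProd_e, ← h.coframeWedge, ← h.X]
  rfl

theorem W6 : F'.W6 (tr2 U t M) = tr2 U t (F.W6 M) := by
  have h1 : F.W6 M = (-(1 / 12) * F.Xscal M : ℝ) •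
    fun a b => (wedge (F.θLow a) (F.θLow b) : Form 2) := rfl
  rw [h1, map_smul, ← h.wedge_θLow, ← h.θLow, ← h.Xscal]
  rfl

theorem W1 : F'.W1 (tr2 U t M) = tr2 U t (F.W1 M) := by
  have h1 : F.W1 M = M - (F.W2 M + F.W3 M + F.W4 M + F.W5 M + F.W6 M) := rfl
  rw [h1, map_sub, map_add, map_add, map_add, map_add, ← h.W2, ← h.W3, ← h.W4, ← h.W5, ← h.W6]
  rfl

theorem trace : (∑ c, ∑ d, F'.gInv c d • tr2 U t M c d)
    = scale t (∑ c, ∑ d, F.gInv c d • M c d) := by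
  have h1 := fun c => contract (K := Form 2) h.inv (LinearMap.lsmul ℝ (Form 2))
    (fun d' => ∑ c', V c c' * F.gInv c' d') (fun d => ∑ c', U c' c • scale t (M c' d))
  have h2 := fun d' => contract (K := Form 2) h.inv (LinearMap.lsmul ℝ (Form 2))
    (fun c' => F.gInv c' d') (fun c' => scale t (M c' d'))
  simp only [LinearMap.lsmul_apply, smul_eq_mul] at h1 h2
  have h3 : ∀ c d, F'.gInv c d = ∑ d', V d d' * ∑ c', V c c' * F.gInv c' d' := fun c d => by
    rw [h.gInv]; simp only [Finset.mul_sum]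
    rw [Finset.sum_comm]
    exact Finset.sum_congr rfl fun _ _ => Finset.sum_congr rfl fun _ _ => by ring
  simp only [tr2_eq_right, h3, h1]
  rw [Finset.sum_comm]
  simp only [h2]
  rw [Finset.sum_comm]
  simp only [map_sum, map_smul]

theorem Z5 : F'.Z5 (tr2 U t M) = tr2 U t (F.Z5 M) := by
  funext a b
  rw [Frame.Z5, h.trace, h.g, tr2_apply, Finset.mul_sum, Finset.sum_smul]
  refine Finset.sum_congr rfl fun c _ => ?_
  rw [Finset.mul_sum, Finset.sum_smul]
  refine Finset.sum_congr rfl fun d _ => ?_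
  rw [Frame.Z5, map_smul, smul_smul]
  congr 1; ring

theorem Y : F'.Y (tr2 U t M) = tr1 U t (F.Y M) := by
  -- Y is X applied to Z − ⁽⁵⁾Z, so its covariance reduces to that of X and of ⁽⁵⁾Z.
  have h1 : F'.Y (tr2 U t M) = F'.X (tr2 U t M - F'.Z5 (tr2 U t M)) := rfl
  rw [h1, h.Z5, ← map_sub, h.X]
  rfl

theorem Ybar : F'.Ybar (tr2 U t M) = tr1 U t (F.Ybar M) := by
  have h1 : F'.Ybar (tr2 U t M) = F'.Xbar (tr2 U t M - F'.Z5 (tr2 U t M)) := rfl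
  rw [h1, h.Z5, ← map_sub, h.Xbar]
  rfl

theorem trace_correction' (B : Fin 4 → Form 1) (r : ℝ) :
    (fun a => tr1 U t B a - r • interiorProd (F'.e a) (F'.coframeWedge (tr1 U t B)))
    = tr1 U t fun a => B a - r • interiorProd (F.e a) (F.coframeWedge B) := by
  simpa using h.trace_correction B 0 r

theorem Phi : F'.Phi (tr2 U t M) = tr1 U t (F.Phi M) := by
  have := h.trace_correction' (F.Y M) (1 / 2)
  rw [← h.Y] at this
  exact this

theorem PhiBar : F'.PhiBar (tr2 U t M) = tr1 U t (F.PhiBar M) := by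
  have := h.trace_correction' (F.Ybar M) (1 / 2)
  rw [← h.Ybar] at this
  exact this

theorem Z2 : F'.Z2 (tr2 U t M) = tr2 U t (F.Z2 M) := by
  have h1 : F.Z2 M = ((1 / 2 : ℝ) * F.sgn) • fun a b => F.star (rfl : 2 + 2 = 4)
    (symPart (fun c d => (wedge (F.θLow c) (F.PhiBar M d) : Form 2)) a b) := rfl
  rw [h1, map_smul, ← h.star_tr2, ← symPart_tr2, ← h.wedge_θLow, ← h.PhiBar, ← h.sgn]
  rfl

theorem g_smul (α : Form 2) :
    (fun a b => F'.g a b • scale t α) = tr2 U t fun a b => F.g a b • α := by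
  funext a b
  simp only [h.g, tr2_apply, map_smul, Finset.sum_smul, smul_smul]

theorem Z3 : F'.Z3 (tr2 U t M) = tr2 U t (F.Z3 M) := by
  have h1 : ∀ (F : Frame) (M : TwoForms), F.Z3 M = (1 / 12 : ℝ) • ((4 : ℝ) • symPart (fun c d =>
      (wedge (F.θLow c) ((fun d => interiorProd (F.e d) (F.coframeWedge (F.Y M))) d) : Form 2))
      - (2 : ℝ) • fun a b => F.g a b • F.coframeWedge (F.Y M)) := fun F M => by
    funext a b
    simp only [Frame.Z3, Pi.smul_apply, Pi.sub_apply, smul_smul]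
  rw [h1 F, map_smul, map_sub, map_smul, map_smul, ← symPart_tr2, ← h.wedge_θLow,
    ← h.interiorProd_e, ← h.g_smul, ← h.coframeWedge, ← h.Y, ← h1]

theorem Z4 : F'.Z4 (tr2 U t M) = tr2 U t (F.Z4 M) := by
  have h1 : F.Z4 M = (2 / 4 : ℝ) •
    symPart (fun c d => (wedge (F.θLow c) (F.Phi M d) : Form 2)) := rfl
  rw [h1, map_smul, ← symPart_tr2, ← h.wedge_θLow, ← h.Phi]
  rfl

theorem Z1 : F'.Z1 (tr2 U t M) = tr2 U t (F.Z1 M) := by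
  have h1 : F.Z1 M = M - (F.Z2 M + F.Z3 M + F.Z4 M + F.Z5 M) := rfl
  rw [h1, map_sub, map_add, map_add, map_add, ← h.Z2, ← h.Z3, ← h.Z4, ← h.Z5]
  rfl

theorem crossTerm : F'.crossTerm (tr2 U t M) = tr2 U t (F.crossTerm M) := by
  have h1 : (fun b => ∑ c, interiorProd (F'.eUp c) (tr2 U t M c b))
      = tr1 U t fun b => ∑ c, interiorProd (F.eUp c) (M c b) := by
    funext b
    have := contract h.inv (interiorProdₗ 1) (fun c => scaleVec t (F.eUp c))
      (fun c => ∑ d, U d b • scale t (M c d))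
    simp only [h.eUp, tr2_eq_left]
    refine this.trans ?_
    simp only [tr1_apply, map_sum, Finset.smul_sum]
    rw [Finset.sum_comm]
    refine Finset.sum_congr rfl fun d _ => Finset.sum_congr rfl fun c _ => ?_
    rw [map_smul, ← MAG.interiorProd_scale h.ne]
    rfl
  have h2 : F'.crossTerm (tr2 U t M) = fun a b => (wedge (F'.θLow a)
    ((fun b => ∑ c, interiorProd (F'.eUp c) (tr2 U t M c b)) b) : Form 2) := rfl
  rw [h2, h1, h.wedge_θLow]
  rfl

/-- For fixed a and b this is ϑ^c ∧ B_c with B_c = e_a ⌟ M_cb. The contracted index is handled by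
covariance of `coframeWedge`; the indices a and b are carried along linearly. -/
theorem crossTerm' : F'.crossTerm' (tr2 U t M) = tr2 U t (F.crossTerm' M) := by
  funext a b
  have h1 : ∀ c, interiorProd (F'.e a) (tr2 U t M c b)
      = ∑ c', U c' c • scale t (∑ d, U d b • ∑ a', U a' a • interiorProd (F.e a') (M c' d)) := by
    intro c
    rw [tr2_eq_left, interiorProd_sum_right]
    refine Finset.sum_congr rfl fun c' _ => ?_
    rw [interiorProd_smul_right, interiorProd_sum_right, map_sum]
    congr 1
    refine Finset.sum_congr rfl fun d _ => ?_
    rw [interiorProd_smul_right, map_smul, map_sum]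
    congr 1
    have := congrFun (h.interiorProd_e (M c' d)) a
    refine this.trans ?_
    simp only [tr1_apply, map_smul]
  have h2 := h.coframeWedge
    (fun c => ∑ d, U d b • ∑ a', U a' a • interiorProd (F.e a') (M c d))
  have h3 : F'.crossTerm' (tr2 U t M) a b = F'.coframeWedge (tr1 U t
      (fun c => ∑ d, U d b • ∑ a', U a' a • interiorProd (F.e a') (M c d))) := by
    simp only [Frame.crossTerm', Frame.coframeWedge, h1]
    rfl
  rw [h3, h2, tr2_eq_right]
  simp only [Frame.coframeWedge, Frame.crossTerm']
  rw [show (∑ c, (wedge (F.θ c) (∑ d, U d b • ∑ a', U a' a • interiorProd (F.e a') (M c d)) :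
      Form 2)) = ∑ d, U d b • ∑ a', U a' a • ∑ c, (wedge (F.θ c) (interiorProd (F.e a') (M c d)) :
        Form 2) by
    simp only [wedge_sum_right, wedge_smul_right, Finset.smul_sum]
    rw [Finset.sum_comm]
    refine Finset.sum_congr rfl fun d _ => ?_
    rw [Finset.sum_comm]]
  simp only [map_sum, map_smul]

theorem gInv_contract {E : Type*} [AddCommGroup E] [Module ℝ E] (a : Fin 4) (y : Fin 4 → E) :
    ∑ c, F'.gInv a c • ∑ d, U d c • y d = ∑ b, V a b • ∑ c, F.gInv b c • y c := by
  have := contract h.inv (LinearMap.lsmul ℝ E) (fun d => ∑ b, V a b * F.gInv b d) y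
  simp only [LinearMap.lsmul_apply, smul_eq_mul] at this
  have h3 : ∀ c, F'.gInv a c = ∑ d, V c d * ∑ b, V a b * F.gInv b d := fun c => by
    rw [h.gInv]; simp only [Finset.mul_sum]
    rw [Finset.sum_comm]
    exact Finset.sum_congr rfl fun _ _ => Finset.sum_congr rfl fun _ _ => by ring
  simp only [h3, this]
  simp only [Finset.sum_smul, Finset.smul_sum, mul_smul]
  rw [Finset.sum_comm]

theorem raiseTwo (a b : Fin 4) : F'.raiseTwo (tr2 U t M) a b
    = ∑ c, V a c • ∑ d, V b d • scale t (F.raiseTwo M c d) := by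
  have h1 : ∀ (F : Frame) (M : TwoForms) a b, F.raiseTwo M a b
      = ∑ c, F.gInv a c • ∑ d, F.gInv b d • M c d := fun F M a b => by
    simp only [Frame.raiseTwo, Finset.smul_sum, mul_smul]
  have h2 : ∀ c, ∑ d, F'.gInv b d • tr2 U t M c d
      = ∑ c', U c' c • ∑ d, V b d • ∑ d', F.gInv d d' • scale t (M c' d') := fun c => by
    simp only [tr2_eq_right, h.gInv_contract]
    symm
    simp only [Finset.smul_sum]
    rw [Finset.sum_comm]
    refine Finset.sum_congr rfl fun d _ => ?_
    rw [Finset.sum_comm]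
    refine Finset.sum_congr rfl fun d' _ => Finset.sum_congr rfl fun c' _ => ?_
    simp only [smul_smul]
    congr 1; ring
  rw [h1]
  simp only [h2, h.gInv_contract]
  refine Finset.sum_congr rfl fun c _ => ?_
  congr 1
  simp only [h1, map_sum, map_smul]
  simp only [Finset.smul_sum]
  rw [Finset.sum_comm]
  refine Finset.sum_congr rfl fun d _ => ?_
  refine Finset.sum_congr rfl fun c' _ => ?_
  refine Finset.sum_congr rfl fun d' _ => ?_
  rw [smul_comm]

theorem lowerCurv {R R' : TwoForms}
    (hR : ∀ a b, R' a b = ∑ c, ∑ d, (U c a * V b d) • scale t (R c d)) :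
    F'.lowerCurv R' = tr2 U t (F.lowerCurv R) := by
  funext a b
  have := contract h.inv (LinearMap.lsmul ℝ (Form 2)).flip
    (fun d => ∑ a', U a' a • scale t (R a' d)) (fun c => ∑ b', U b' b * F.g b' c)
  simp only [LinearMap.flip_apply, LinearMap.lsmul_apply, smul_eq_mul] at this
  have h1 : ∀ c, F'.g b c = ∑ d, U d c * ∑ b', U b' b * F.g b' d := fun c => by
    rw [h.g]; simp only [Finset.mul_sum]
    rw [Finset.sum_comm]
    exact Finset.sum_congr rfl fun _ _ => Finset.sum_congr rfl fun _ _ => by ring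
  have h2 : ∀ c, R' a c = ∑ d, V c d • ∑ a', U a' a • scale t (R a' d) := fun c => by
    rw [hR, Finset.sum_comm]
    refine Finset.sum_congr rfl fun d _ => ?_
    rw [Finset.smul_sum]
    exact Finset.sum_congr rfl fun c _ => by rw [smul_smul, mul_comm]
  simp only [Frame.lowerCurv, h1, h2, this]
  rw [tr2_apply]
  simp only [Frame.lowerCurv, map_sum, map_smul, Finset.smul_sum, smul_smul]
  rw [Finset.sum_comm]
  refine Finset.sum_congr rfl fun a' _ => ?_
  rw [Finset.sum_comm]
  refine Finset.sum_congr rfl fun c _ => ?_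
  rw [Finset.sum_mul, Finset.sum_smul]
  refine Finset.sum_congr rfl fun b' _ => ?_
  congr 1; ring

end FrameRel

theorem strongBracket_tr2 {U V : Matrix (Fin 4) (Fin 4) ℝ} {t : Fin 4 → ℝ} {F F' : Frame}
    (h : FrameRel U V t F F') (P : StrongParams) {R R' : TwoForms}
    (hR : F'.lowerCurv R' = tr2 U t (F.lowerCurv R)) :
    strongBracket P F' R' = tr2 U t (strongBracket P F R) := by
  simp only [strongBracket, hR, altPart_tr2, symPart_tr2, h.W1, h.W2, h.W3, h.W4, h.W5, h.W6, h.Z1,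
    h.Z2, h.Z3, h.Z4, h.Z5, h.crossTerm, h.crossTerm', map_add, map_smul]

/-- The Lagrangian is invariant under changes of frame and unimodular rescalings of the
coordinates. -/
theorem strongForm_invariant {U V : Matrix (Fin 4) (Fin 4) ℝ} {t : Fin 4 → ℝ} {F F' : Frame}
    (h : FrameRel U V t F F') (P : StrongParams) {R R' : TwoForms}
    (hR : ∀ a b, R' a b = ∑ c, ∑ d, (U c a * V b d) • scale t (R c d)) :
    strongForm P F' R' R' = strongForm P F R R := by
  have hlow := h.lowerCurv hR
  have hb := strongBracket_tr2 h P hlow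
  -- The pairing of α with the primed dual of β. Bilinearity lets `contract` remove U against V for
  -- one frame index at a time; on rescaled forms the pairing equals the unprimed one, since the
  -- total weight of a four-form is 1.
  let f : Form 2 →ₗ[ℝ] Form 2 →ₗ[ℝ] ℝ := LinearMap.mk₂ ℝ
    (fun α β => (wedge α (F'.star (rfl : 2 + 2 = 4) β) : Form 4).top)
    (fun α α' β => by simpa using top_wedge_lin_left 1 α α' (F'.star (rfl : 2 + 2 = 4) β))
    (fun c α β => by
      have := top_wedge_lin_left c α 0 (F'.star (rfl : 2 + 2 = 4) β)
      rw [wedge_zero_left] at this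
      simpa [Form.top] using this)
    (fun α β β' => by
      rw [Frame.star_add]
      simpa using top_wedge_lin_right 1 α (F'.star (rfl : 2 + 2 = 4) β) (F'.star rfl β'))
    (fun c α β => by
      have := top_wedge_lin_right c α (F'.star (rfl : 2 + 2 = 4) β) 0
      rw [wedge_zero_right] at this
      rw [Frame.star_smul]
      simpa [Form.top] using this)
  have hf : ∀ α β, f (scale t α) (scale t β)
      = (wedge α (F.star (rfl : 2 + 2 = 4) β) : Form 4).top := fun α β => by
    change (wedge (scale t α) (F'.star (rfl : 2 + 2 = 4) (scale t β)) : Form 4).top = _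
    rw [h.star, wedge_scale]
    exact scale_top h.prod _
  set A := F.lowerCurv R
  set B := F.raiseTwo (strongBracket P F R)
  have h1 : strongForm P F' R' R' = ∑ a, ∑ b, f (tr2 U t A a b)
      (∑ c, V a c • ∑ d, V b d • scale t (B c d)) := by
    simp only [strongForm, hlow, hb, h.raiseTwo]
    rfl
  have h2 := fun b => contract h.inv f.flip (fun c => ∑ d, V b d • scale t (B c d))
    (fun c => ∑ d, U d b • scale t (A c d))
  have h3 := fun c => contract h.inv f.flip (fun d => scale t (B c d)) (fun d => scale t (A c d))
  simp only [LinearMap.flip_apply] at h2 h3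
  rw [h1, Finset.sum_comm]
  simp only [tr2_eq_left, h2]
  rw [Finset.sum_comm]
  simp only [h3, hf]
  rfl

end
end MAG

namespace MAG
noncomputable section

/-! ### Continuity of the Lagrangian -/

section
variable {τ : Type*} [TopologicalSpace τ]

theorem continuous_wedge {p q : ℕ} {α : τ → Form p} {β : τ → Form q} (hα : Continuous α)
    (hβ : Continuous β) : Continuous fun s => wedge (α s) (β s) := by
  unfold wedge; fun_prop

theorem continuous_interiorProd {p : ℕ} {e : τ → Pt} {α : τ → Form (p + 1)} (he : Continuous e)
    (hα : Continuous α) : Continuous fun s => interiorProd (e s) (α s) := by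
  unfold interiorProd; fun_prop

theorem continuous_scalar {α : τ → Form 0} (hα : Continuous α) :
    Continuous fun s => (α s).scalar := by
  unfold Form.scalar; fun_prop

theorem continuous_top {α : τ → Form 4} (hα : Continuous α) :
    Continuous fun s => (α s).top := by
  unfold Form.top; fun_prop

attribute [fun_prop] continuous_wedge continuous_interiorProd continuous_scalar continuous_top

theorem continuous_altPart {M : τ → TwoForms} (hM : Continuous M) :
    Continuous fun s => altPart (M s) := by
  unfold altPart; fun_prop

theorem continuous_symPart {M : τ → TwoForms} (hM : Continuous M) :
    Continuous fun s => symPart (M s) := by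
  unfold symPart; fun_prop

attribute [fun_prop] continuous_altPart continuous_symPart

/-- A family of frames depending continuously on a parameter. -/
structure ContFrame (F : τ → Frame) : Prop where
  g : ∀ a b, Continuous fun s => (F s).g a b
  gInv : ∀ a b, Continuous fun s => (F s).gInv a b
  θ : ∀ a, Continuous fun s => (F s).θ a
  e : ∀ a, Continuous fun s => (F s).e a
  coordInv : ∀ μ ν, Continuous fun s => (F s).coordMetric⁻¹ μ ν
  sqrt : Continuous fun s => √|(F s).coordMetric.det|
  sgn : Continuous fun s => (F s).sgn

namespace ContFrame

variable {F : τ → Frame} (hF : ContFrame F)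
include hF

theorem star {p q : ℕ} (h : p + q = 4) {α : τ → Form p} (hα : Continuous α) :
    Continuous fun s => (F s).star h (α s) := by
  refine continuous_pi fun j => continuous_const.mul (continuous_finsetSum _ fun i _ => ?_)
  refine Continuous.mul (continuous_finsetSum _ fun k _ => ?_) (hF.sqrt.mul continuous_const)
  exact (continuous_finsetProd _ fun m _ => hF.coordInv _ _).mul ((continuous_apply k).comp hα)

theorem eUp (a : Fin 4) : Continuous fun s => (F s).eUp a := by
  have := hF.gInv
  have := hF.e
  unfold Frame.eUp; fun_prop

theorem θLow (a : Fin 4) : Continuous fun s => (F s).θLow a := by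
  have := hF.g
  have := hF.θ
  unfold Frame.θLow; fun_prop

variable {M : τ → TwoForms} (hM : Continuous M)

theorem coframeWedge {B : τ → Fin 4 → Form 1} (hB : Continuous B) :
    Continuous fun s => (F s).coframeWedge (B s) := by
  have := hF.θ
  unfold Frame.coframeWedge; fun_prop

include hM

theorem lowerCurv : Continuous fun s => (F s).lowerCurv (M s) := by
  have := hF.g
  unfold Frame.lowerCurv; fun_prop

theorem raiseTwo : Continuous fun s => (F s).raiseTwo (M s) := by
  have := hF.gInv
  unfold Frame.raiseTwo; fun_prop

theorem X : Continuous fun s => (F s).X (M s) := by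
  have := hF.eUp
  unfold Frame.X; fun_prop

theorem Xbar : Continuous fun s => (F s).Xbar (M s) := by
  have := hF.θ
  unfold Frame.Xbar
  refine continuous_pi fun a => hF.star _ ?_
  fun_prop

theorem Xscal : Continuous fun s => (F s).Xscal (M s) := by
  have := hF.eUp
  have := hF.X hM
  unfold Frame.Xscal; fun_prop

theorem XbarScal : Continuous fun s => (F s).XbarScal (M s) := by
  have := hF.eUp
  have := hF.Xbar hM
  unfold Frame.XbarScal; fun_prop

theorem Psi : Continuous fun s => (F s).Psi (M s) := by
  have := hF.e
  have := hF.θLow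
  have h := hF.X hM
  have := hF.Xscal hM
  have := hF.coframeWedge h
  unfold Frame.Psi; fun_prop

theorem PsiBar : Continuous fun s => (F s).PsiBar (M s) := by
  have := hF.e
  have := hF.θLow
  have h := hF.Xbar hM
  have := hF.XbarScal hM
  have := hF.coframeWedge h
  unfold Frame.PsiBar; fun_prop

theorem W2 : Continuous fun s => (F s).W2 (M s) := by
  have := hF.sgn
  have := hF.θLow
  have := hF.PsiBar hM
  have := fun a b => hF.star (rfl : 2 + 2 = 4) (α := fun s =>
    altPart (fun c d => (wedge ((F s).θLow c) ((F s).PsiBar (M s) d) : Form 2)) a b) (by fun_prop)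
  unfold Frame.W2; fun_prop

theorem W3 : Continuous fun s => (F s).W3 (M s) := by
  have := hF.sgn
  have := hF.θLow
  have := hF.XbarScal hM
  have := fun a b => hF.star (rfl : 2 + 2 = 4) (α := fun s =>
    (F s).XbarScal (M s) • (wedge ((F s).θLow a) ((F s).θLow b) : Form 2)) (by fun_prop)
  unfold Frame.W3; fun_prop

theorem W4 : Continuous fun s => (F s).W4 (M s) := by
  have := hF.θLow
  have := hF.Psi hM
  unfold Frame.W4; fun_prop

theorem W5 : Continuous fun s => (F s).W5 (M s) := by
  have := hF.e
  have := hF.θLow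
  have := hF.coframeWedge (hF.X hM)
  unfold Frame.W5; fun_prop

theorem W6 : Continuous fun s => (F s).W6 (M s) := by
  have := hF.θLow
  have := hF.Xscal hM
  unfold Frame.W6; fun_prop

theorem W1 : Continuous fun s => (F s).W1 (M s) := by
  have := hF.W2 hM
  have := hF.W3 hM
  have := hF.W4 hM
  have := hF.W5 hM
  have := hF.W6 hM
  unfold Frame.W1; fun_prop

theorem Z5 : Continuous fun s => (F s).Z5 (M s) := by
  have := hF.g
  have := hF.gInv
  unfold Frame.Z5; fun_prop

theorem Y : Continuous fun s => (F s).Y (M s) := by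
  have := hF.eUp
  have := hF.Z5 hM
  unfold Frame.Y; fun_prop

theorem Ybar : Continuous fun s => (F s).Ybar (M s) := by
  have := hF.θ
  have := hF.Z5 hM
  unfold Frame.Ybar
  refine continuous_pi fun a => hF.star _ ?_
  fun_prop

theorem Phi : Continuous fun s => (F s).Phi (M s) := by
  have := hF.e
  have h := hF.Y hM
  have := hF.coframeWedge h
  unfold Frame.Phi; fun_prop

theorem PhiBar : Continuous fun s => (F s).PhiBar (M s) := by
  have := hF.e
  have h := hF.Ybar hM
  have := hF.coframeWedge h
  unfold Frame.PhiBar; fun_prop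

theorem Z2 : Continuous fun s => (F s).Z2 (M s) := by
  have := hF.sgn
  have := hF.θLow
  have := hF.PhiBar hM
  have := fun a b => hF.star (rfl : 2 + 2 = 4) (α := fun s =>
    symPart (fun c d => (wedge ((F s).θLow c) ((F s).PhiBar (M s) d) : Form 2)) a b) (by fun_prop)
  unfold Frame.Z2; fun_prop

theorem Z3 : Continuous fun s => (F s).Z3 (M s) := by
  have := hF.g
  have := hF.e
  have := hF.θLow
  have := hF.coframeWedge (hF.Y hM)
  unfold Frame.Z3; fun_prop

theorem Z4 : Continuous fun s => (F s).Z4 (M s) := by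
  have := hF.θLow
  have := hF.Phi hM
  unfold Frame.Z4; fun_prop

theorem Z1 : Continuous fun s => (F s).Z1 (M s) := by
  have := hF.Z2 hM
  have := hF.Z3 hM
  have := hF.Z4 hM
  have := hF.Z5 hM
  unfold Frame.Z1; fun_prop

theorem crossTerm : Continuous fun s => (F s).crossTerm (M s) := by
  have := hF.eUp
  have := hF.θLow
  unfold Frame.crossTerm; fun_prop

theorem crossTerm' : Continuous fun s => (F s).crossTerm' (M s) := by
  have := hF.e
  have := hF.θ
  unfold Frame.crossTerm'; fun_prop

theorem strongBracket (P : StrongParams) : Continuous fun s => strongBracket P (F s) (M s) := by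
  have hW := continuous_altPart (hF.lowerCurv hM)
  have hZ := continuous_symPart (hF.lowerCurv hM)
  have := hF.W1 hW
  have := hF.W2 hW
  have := hF.W3 hW
  have := hF.W4 hW
  have h5 := hF.W5 hW
  have := hF.W6 hW
  have := hF.Z1 hZ
  have h2 := hF.Z2 hZ
  have h3 := hF.Z3 hZ
  have h4 := hF.Z4 hZ
  have h6 := hF.Z5 hZ
  have := hF.crossTerm h5
  have := hF.crossTerm h3
  have := hF.crossTerm h4
  have := hF.crossTerm h6
  have := hF.crossTerm' h2
  simp only [MAG.strongBracket]
  fun_prop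

/-- Needed twice: for a uniform bound over a compact set of coframes in the coframe variation, and
for integrability of the coefficients in the connection variation. -/
theorem strongForm (P : StrongParams) {N : τ → TwoForms} (hN : Continuous N) :
    Continuous fun s => strongForm P (F s) (M s) (N s) := by
  have := hF.lowerCurv hM
  have h := hF.raiseTwo (hF.strongBracket hN P)
  have := fun a b => hF.star (rfl : 2 + 2 = 4) (α := fun s => (F s).raiseTwo
    (MAG.strongBracket P (F s) (N s)) a b) (by fun_prop)
  unfold MAG.strongForm
  fun_prop

end ContFrame

/-- Coframes depending continuously on a parameter, with constant anholonomic metric. -/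
theorem contFrame_of_coframe (g : Fin 4 → Fin 4 → ℝ) (hg : (Matrix.of g).det ≠ 0)
    {θ : τ → Fin 4 → Form 1} (hθ : Continuous θ)
    (hdet : ∀ s, (Frame.mk g (θ s)).coframeMatrix.det ≠ 0) :
    ContFrame fun s => (⟨g, θ s⟩ : Frame) := by
  have hc : Continuous fun s => (Frame.mk g (θ s)).coframeMatrix :=
    continuous_matrix fun a μ => by
      simp only [Frame.coframeMatrix, Matrix.of_apply]; fun_prop
  have hG : Continuous fun s => (Frame.mk g (θ s)).coordMetric :=
    continuous_matrix fun a μ => by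
      simp only [Frame.coordMetric, Matrix.of_apply]; fun_prop
  have hinv : ∀ {A : τ → Matrix (Fin 4) (Fin 4) ℝ}, Continuous A → (∀ s, (A s).det ≠ 0) →
      Continuous fun s => (A s)⁻¹ := fun {A} hA hd => by
    simp only [Matrix.inv_def, Ring.inverse_eq_inv]
    exact (hA.matrix_det.inv₀ hd).smul hA.matrix_adjugate
  have hGd : ∀ s, (Frame.mk g (θ s)).coordMetric.det ≠ 0 := fun s => by
    rw [FrameRel.coordMetric_eq, Matrix.det_mul, Matrix.det_mul, Matrix.det_transpose]
    exact mul_ne_zero (mul_ne_zero (hdet s) hg) (hdet s)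
  have hGi := hinv hG hGd
  have hci := hinv hc hdet
  exact ⟨fun a b => continuous_const, fun a b => by
      simp only [Frame.gInv]; exact continuous_const, fun a => by fun_prop,
    fun a => continuous_pi fun μ => by
      simp only [Frame.e]; exact hci.matrix_elem μ a,
    fun μ ν => hGi.matrix_elem μ ν, by
      have := hG.matrix_det
      fun_prop, by
      simp only [Frame.sgn]; exact continuous_const⟩

end
end
end MAG

/-! ### The Levi-Civita symbol as a product of signs. -/

namespace MAG
noncomputable section

/-- The Levi-Civita symbol by cases. -/
def leviInt (a b c d : Fin 4) : ℤ :=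
  ((b : ℤ) - a).sign * ((c : ℤ) - a).sign * ((d : ℤ) - a).sign * ((c : ℤ) - b).sign *
    ((d : ℤ) - b).sign * ((d : ℤ) - c).sign

/-- Once the determinant is expanded over the permutations of four letters, the claim is an integer
identity for finitely many index quadruples and can be decided. -/
theorem leviCivita_eq (a b c d : Fin 4) : leviCivita ![a, b, c, d] = (leviInt a b c d : ℝ) := by
  have h : ∀ a b c d : Fin 4,
      ∑ p : Fin 4, (if p = 0 then (1:ℤ) else -1) *
        ((fun K : Fin 3 → Fin 3 → Fin 3 → ℤ =>
          K 0 1 2 + K 1 2 0 + K 2 0 1 - K 0 2 1 - K 2 1 0 - K 1 0 2)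
        (fun x y z => (if ![a,b,c,d] p = 0 then 1 else 0) * (if ![a,b,c,d] (Equiv.swap 0 p x.succ) = 1 then 1 else 0) *
          (if ![a,b,c,d] (Equiv.swap 0 p y.succ) = 2 then 1 else 0) *
          (if ![a,b,c,d] (Equiv.swap 0 p z.succ) = 3 then 1 else 0))) = leviInt a b c d := by
    decide
  have h2 := sum_sign_perm_four fun x y z w => (if ![a,b,c,d] x = 0 then (1:ℝ) else 0) *
    (if ![a,b,c,d] y = 1 then 1 else 0) * (if ![a,b,c,d] z = 2 then 1 else 0) *
    (if ![a,b,c,d] w = 3 then 1 else 0)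
  rw [← h]
  push_cast
  refine Eq.trans ?_ h2
  rw [leviCivita, Matrix.det_apply']
  refine Finset.sum_congr rfl fun σ _ => ?_
  simp [Fin.prod_univ_four]

/-! ### The adapted frame of a pp-wave -/

/-- The anholonomic metric `2 θ⁰ θ¹ - (θ²)² - (θ³)²`. -/
def nullMetric : Fin 4 → Fin 4 → ℝ :=
  ![![0, 1, 0, 0], ![1, 0, 0, 0], ![0, 0, -1, 0], ![0, 0, 0, -1]]

/-- The one-form with components `v`. -/
def oneForm (v : Fin 4 → ℝ) : Form 1 := fun i => v (i 0)

@[simp] theorem oneForm_apply (v : Fin 4 → ℝ) (μ : Fin 4) : oneForm v ![μ] = v μ := rfl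

/-- The coframe `du, dv + (h/2) du, dx, dy`. -/
def nullCoframe (h : ℝ) : Fin 4 → Form 1 := fun a =>
  oneForm (![![1, 0, 0, 0], ![h / 2, 1, 0, 0], ![0, 0, 1, 0], ![0, 0, 0, 1]] a)

/-- The adapted frame of the pp-wave metric with profile value `h`. -/
def nullFrame (h : ℝ) : Frame := ⟨nullMetric, nullCoframe h⟩

namespace nullFrame

variable (h : ℝ)

theorem g_inv : (Matrix.of nullMetric)⁻¹ = Matrix.of nullMetric := by
  refine Matrix.inv_eq_right_inv ?_
  ext a b
  fin_cases a <;> fin_cases b <;>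
    simp [nullMetric, Matrix.mul_apply, Fin.sum_univ_four]

theorem det_g : (Matrix.of nullMetric).det = -1 := by
  simp [nullMetric, Matrix.det_succ_row_zero, Fin.sum_univ_succ, Fin.succAbove]

theorem sgn : (nullFrame h).sgn = -1 := by
  rw [Frame.sgn, nullFrame, det_g, Real.sign_of_neg (by norm_num)]

theorem gInv (a b : Fin 4) : (nullFrame h).gInv a b = nullMetric a b := by
  rw [Frame.gInv, nullFrame, g_inv]; rfl

theorem coframeMatrix_inv : (nullFrame h).coframeMatrix⁻¹
    = !![1, 0, 0, 0; -h / 2, 1, 0, 0; 0, 0, 1, 0; 0, 0, 0, 1] := by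
  refine Matrix.inv_eq_right_inv ?_
  ext a b
  fin_cases a <;> fin_cases b <;>
    simp [nullFrame, nullCoframe, Frame.coframeMatrix, Matrix.mul_apply, Fin.sum_univ_four]
  ring

theorem coframeMatrix_det : (nullFrame h).coframeMatrix.det = 1 := by
  simp [nullFrame, nullCoframe, Frame.coframeMatrix, Matrix.det_succ_row_zero, Fin.sum_univ_succ,
    Fin.succAbove]

theorem coordMetric : (nullFrame h).coordMetric = ppMetric h := by
  ext a b
  fin_cases a <;> fin_cases b <;>
    simp [nullFrame, nullMetric, nullCoframe, Frame.coordMetric, ppMetric, Fin.sum_univ_four]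

theorem ppMetric_inv : (ppMetric h)⁻¹
    = !![0, 1, 0, 0; 1, -h, 0, 0; 0, 0, -1, 0; 0, 0, 0, -1] := by
  refine Matrix.inv_eq_right_inv ?_
  ext a b
  fin_cases a <;> fin_cases b <;>
    simp [ppMetric, Matrix.mul_apply, Fin.sum_univ_four]

theorem ppMetric_det : (ppMetric h).det = -1 := by
  simp [ppMetric, Matrix.det_succ_row_zero, Fin.sum_univ_succ, Fin.succAbove]

theorem e (a : Fin 4) : (nullFrame h).e a
    = ![![1, -h / 2, 0, 0], ![0, 1, 0, 0], ![0, 0, 1, 0], ![0, 0, 0, 1]] a := by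
  ext μ
  rw [Frame.e, coframeMatrix_inv]
  fin_cases a <;> fin_cases μ <;> simp

theorem eUp (a : Fin 4) : (nullFrame h).eUp a
    = ![![0, 1, 0, 0], ![1, -h / 2, 0, 0], ![0, 0, -1, 0], ![0, 0, 0, -1]] a := by
  simp only [Frame.eUp, gInv, e]
  fin_cases a <;> · ext μ; fin_cases μ <;> simp [nullMetric, Fin.sum_univ_four]

theorem θLow (a : Fin 4) : (nullFrame h).θLow a
    = oneForm (![![h / 2, 1, 0, 0], ![1, 0, 0, 0], ![0, 0, -1, 0], ![0, 0, 0, -1]] a) := by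
  refine Form.ext1 fun μ => ?_
  fin_cases a <;> fin_cases μ <;>
    simp [nullFrame, Frame.θLow, nullMetric, nullCoframe, Fin.sum_univ_four]

end nullFrame

/-! ### The Hodge dual in components -/

section
variable {F : Frame} {h : ℝ} (hF : F.coordMetric = ppMetric h)
include hF

theorem raise_sum (f : Fin 4 → ℝ) (μ : Fin 4) : ∑ a, F.coordMetric⁻¹ μ a * f a
    = ![f 1, f 0 - h * f 1, -f 2, -f 3] μ := by
  rw [hF, nullFrame.ppMetric_inv]
  fin_cases μ <;> simp [Fin.sum_univ_four]; ring

theorem sqrt_det : √|F.coordMetric.det| = 1 := by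
  rw [hF, nullFrame.ppMetric_det]; simp

omit hF in
theorem raiseForm_one (α : Form 1) (i : Fin 4) : F.raiseForm α ![i]
    = ∑ a, F.coordMetric⁻¹ i a * α ![a] := by
  simp only [Frame.raiseForm, sum_fin_succ_arrow, sum_fin_zero_arrow]
  simp

omit hF in
theorem raiseForm_two (α : Form 2) (i j : Fin 4) : F.raiseForm α ![i, j]
    = ∑ a, F.coordMetric⁻¹ i a * ∑ b, F.coordMetric⁻¹ j b * α ![a, b] := by
  simp only [Frame.raiseForm, sum_fin_succ_arrow, sum_fin_zero_arrow]
  simp [Fin.prod_univ_two, Finset.mul_sum, mul_assoc]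

omit hF in
theorem raiseForm_three (α : Form 3) (i j k : Fin 4) : F.raiseForm α ![i, j, k]
    = ∑ a, F.coordMetric⁻¹ i a * ∑ b, F.coordMetric⁻¹ j b *
      ∑ c, F.coordMetric⁻¹ k c * α ![a, b, c] := by
  simp only [Frame.raiseForm, sum_fin_succ_arrow, sum_fin_zero_arrow]
  simp [Fin.prod_univ_three, Finset.mul_sum, mul_assoc]

theorem star_one (α : Form 1) (κ l m : Fin 4) : (F.star (rfl : 1 + 3 = 4) α) ![κ, l, m]
    = ∑ i, F.raiseForm α ![i] * leviInt i κ l m := by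
  have e : ∀ i : Fin 4, (fun k => Fin.append ![i] ![κ, l, m] (Fin.cast rfl k)) = ![i, κ, l, m] :=
    fun i => by ext k; fin_cases k <;> rfl
  simp only [Frame.star, sqrt_det hF, sum_fin_succ_arrow, sum_fin_zero_arrow, one_mul]
  simp only [← leviCivita_eq, ← e]
  simp

theorem star_two (α : Form 2) (κ l : Fin 4) : (F.star (rfl : 2 + 2 = 4) α) ![κ, l]
    = 1 / 2 * ∑ i, ∑ j, F.raiseForm α ![i, j] * leviInt i j κ l := by
  have e : ∀ i j : Fin 4, (fun k => Fin.append ![i, j] ![κ, l] (Fin.cast rfl k)) = ![i, j, κ, l] :=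
    fun i j => by ext k; fin_cases k <;> rfl
  simp only [Frame.star, sqrt_det hF, sum_fin_succ_arrow, sum_fin_zero_arrow, one_mul]
  simp only [← leviCivita_eq, ← e]
  simp

theorem star_three (α : Form 3) (κ : Fin 4) : (F.star (rfl : 3 + 1 = 4) α) ![κ]
    = 1 / 6 * ∑ i, ∑ j, ∑ k, F.raiseForm α ![i, j, k] * leviInt i j k κ := by
  have e : ∀ i j k : Fin 4, (fun m => Fin.append ![i, j, k] ![κ] (Fin.cast rfl m)) = ![i, j, k, κ] :=
    fun i j k => by ext k; fin_cases k <;> rfl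
  simp only [Frame.star, sqrt_det hF, sum_fin_succ_arrow, sum_fin_zero_arrow, one_mul]
  simp only [← leviCivita_eq, ← e]
  simp [Nat.factorial]

/-- The Hodge dual of the wave form. -/
theorem star_waveForm (κ l m : Fin 4) : (F.star (rfl : 1 + 3 = 4) waveForm) ![κ, l, m]
    = leviInt 1 κ l m := by
  rw [star_one hF]
  simp only [raiseForm_one, raise_sum hF, Fin.sum_univ_four]
  simp [waveForm]

/-- No antisymmetry of α is assumed: the dual only sees α_μν − α_νμ, and the table is written in
these combinations. -/
theorem star_two_table (α : Form 2) (κ l : Fin 4) : (F.star (rfl : 2 + 2 = 4) α) ![κ, l]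
    = 1 / 2 * (fun A : Fin 4 → Fin 4 → ℝ =>
      ![![0, A 2 3, A 0 3 - h * A 1 3, -(A 0 2 - h * A 1 2)], ![-A 2 3, 0, -A 1 3, A 1 2],
        ![-(A 0 3 - h * A 1 3), A 1 3, 0, -A 0 1], ![A 0 2 - h * A 1 2, -A 1 2, A 0 1, 0]] κ l)
      (fun μ ν => α ![μ, ν] - α ![ν, μ]) := by
  rw [star_two hF]
  congr 1
  simp only [raiseForm_two, raise_sum hF, Fin.sum_univ_four]
  have s2 : Int.sign 2 = 1 := rfl
  have s3 : Int.sign 3 = 1 := rfl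
  fin_cases κ <;> fin_cases l <;> simp [leviInt, s2, s3] <;> ring

theorem star_three_table (α : Form 3) (h1 : ∀ μ ν κ, α ![ν, μ, κ] = - α ![μ, ν, κ])
    (h2 : ∀ μ ν κ, α ![μ, κ, ν] = - α ![μ, ν, κ]) (κ : Fin 4) :
    (F.star (rfl : 3 + 1 = 4) α) ![κ]
    = ![-(α ![0, 2, 3] - h * α ![1, 2, 3]), α ![1, 2, 3], -α ![0, 1, 3], α ![0, 1, 2]] κ := by
  have c : ∀ μ ν κ, α ![ν, κ, μ] = α ![μ, ν, κ] := fun μ ν κ => by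
    rw [h2 ν μ κ, h1 μ ν κ, neg_neg]
  have hz : ∀ μ ν, α ![μ, ν, ν] = 0 := fun μ ν => by linarith [h2 μ ν ν]
  have hz' : ∀ μ ν, α ![μ, μ, ν] = 0 := fun μ ν => by linarith [h1 μ μ ν]
  have hz'' : ∀ μ ν, α ![μ, ν, μ] = 0 := fun μ ν => by rw [c, hz']
  rw [star_three hF]
  simp only [raiseForm_three, raise_sum hF, Fin.sum_univ_four]
  have s2 : Int.sign 2 = 1 := rfl
  have s3 : Int.sign 3 = 1 := rfl
  have r : ∀ μ ν κ, α ![κ, ν, μ] = - α ![μ, ν, κ] := fun μ ν κ => by rw [h1 ν κ μ, c μ ν κ]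
  have c' : ∀ μ ν κ, α ![κ, μ, ν] = α ![μ, ν, κ] := fun μ ν κ => by rw [← c κ μ ν]
  fin_cases κ <;>
    simp [leviInt, s2, s3, hz, hz', hz'', c 0 1 2, c 0 1 3, c 0 2 3, c 1 2 3, c' 0 1 2, c' 0 1 3,
      c' 0 2 3, c' 1 2 3, r 0 1 2, r 0 1 3, r 0 2 3, r 1 2 3, h1 0 1 2, h1 0 1 3, h1 0 2 3,
      h1 1 2 3, h2 0 1 2, h2 0 1 3, h2 0 2 3, h2 1 2 3] <;> ring
end
end
end MAG

namespace MAG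
noncomputable section

/-! ### The curvature of the wave and its irreducible pieces -/

/-- `du ∧ (x dx + y dy)`. -/
def duWedge (x y : ℝ) : Form 2 := fun i =>
  ![![0, 0, x, y], ![0, 0, 0, 0], ![-x, 0, 0, 0], ![-y, 0, 0, 0]] (i 0) (i 1)

@[simp] theorem duWedge_apply (x y : ℝ) (μ ν : Fin 4) : duWedge x y ![μ, ν]
    = ![![0, 0, x, y], ![0, 0, 0, 0], ![-x, 0, 0, 0], ![-y, 0, 0, 0]] μ ν := rfl

/-- The curvature `R_0^i = R_i^1 = du ∧ M_ij dx^j`, where `M = (a, b; c, d)`. -/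
def waveCurv (a b c d : ℝ) : TwoForms :=
  ![![0, 0, duWedge a b, duWedge c d], 0, ![0, duWedge a b, 0, 0], ![0, duWedge c d, 0, 0]]

/-- The same curvature with lowered index. -/
def waveLow (a b c d : ℝ) : TwoForms :=
  ![![0, 0, -duWedge a b, -duWedge c d], 0, ![duWedge a b, 0, 0, 0], ![duWedge c d, 0, 0, 0]]

theorem TwoForms.ext {M N : TwoForms} (h : ∀ a b μ ν, M a b ![μ, ν] = N a b ![μ, ν]) : M = N :=
  funext fun a => funext fun b => Form.ext2 (h a b)

theorem interiorProd_two (e : Pt) (α : Form 2) (μ : Fin 4) :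
    interiorProd e α ![μ] = ∑ ν, e ν * α ![ν, μ] := rfl

theorem interiorProd_one (e : Pt) (α : Form 1) :
    (interiorProd e α).scalar = ∑ ν, e ν * α ![ν] := rfl

section
variable (h a b c d : ℝ)

theorem nullFrame_g (i j : Fin 4) : (nullFrame h).g i j = nullMetric i j := rfl

theorem nullFrame_θ (i : Fin 4) : (nullFrame h).θ i = nullCoframe h i := rfl

theorem lowerCurv_waveCurv :
    (nullFrame h).lowerCurv (waveCurv a b c d) = waveLow a b c d := by
  funext i j
  simp only [Frame.lowerCurv, nullFrame_g, Fin.sum_univ_four]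
  fin_cases i <;> fin_cases j <;> simp [waveCurv, waveLow, nullMetric]

theorem altPart_waveLow : altPart (waveLow a b c d) = waveLow a b c d := by
  funext i j
  fin_cases i <;> fin_cases j <;> simp [altPart, waveLow] <;> module

theorem symPart_waveLow : symPart (waveLow a b c d) = 0 := by
  funext i j
  fin_cases i <;> fin_cases j <;> simp [symPart, waveLow]

theorem star_duWedge {F : Frame} (hF : F.coordMetric = ppMetric h) (x y : ℝ) :
    F.star (rfl : 2 + 2 = 4) (duWedge x y) = duWedge y (-x) := by
  refine Form.ext2 fun μ ν => ?_
  rw [star_two_table hF]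
  fin_cases μ <;> fin_cases ν <;> simp <;> ring

theorem X_waveLow : (nullFrame h).X (waveLow a b c d)
    = ![oneForm ![-(a + d), 0, 0, 0], 0, 0, 0] := by
  funext i
  refine Form.ext1 fun μ => ?_
  simp only [Frame.X, nullFrame.eUp, Finset.sum_apply, interiorProd_two, Fin.sum_univ_four]
  fin_cases i <;> fin_cases μ <;> simp [waveLow]; ring

theorem wedge_sum_antisymm (M : TwoForms) (θ : Fin 4 → Form 1)
    (hM : ∀ i j μ ν, M i j ![ν, μ] = - M i j ![μ, ν]) (j : Fin 4) (μ ν κ : Fin 4) :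
    (∑ i, (wedge (M i j) (θ i) : Form 3)) ![μ, ν, κ]
      = ∑ i, (M i j ![μ, ν] * θ i ![κ] + M i j ![ν, κ] * θ i ![μ] + M i j ![κ, μ] * θ i ![ν]) := by
  rw [Finset.sum_apply]
  exact Finset.sum_congr rfl fun i _ => wedge_two_one _ _ (hM i j) _ _ _

theorem star_wedge_sum {F : Frame} (hF : F.coordMetric = ppMetric h) (M : TwoForms)
    (θ : Fin 4 → Form 1) (hM : ∀ i j μ ν, M i j ![ν, μ] = - M i j ![μ, ν]) (j κ : Fin 4) :
    F.star (rfl : 3 + 1 = 4) (∑ i, (wedge (M i j) (θ i) : Form 3)) ![κ]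
      = (fun β : Fin 4 → Fin 4 → Fin 4 → ℝ =>
        ![-(β 0 2 3 - h * β 1 2 3), β 1 2 3, -β 0 1 3, β 0 1 2] κ) (fun μ ν κ =>
          ∑ i, (M i j ![μ, ν] * θ i ![κ] + M i j ![ν, κ] * θ i ![μ] + M i j ![κ, μ] * θ i ![ν])) := by
  rw [star_three_table hF]
  · simp only [wedge_sum_antisymm M θ hM]
  · intro μ ν κ
    rw [wedge_sum_antisymm M θ hM, wedge_sum_antisymm M θ hM, ← Finset.sum_neg_distrib]
    refine Finset.sum_congr rfl fun i _ => ?_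
    rw [hM i j μ ν, hM i j κ μ, hM i j ν κ]; ring
  · intro μ ν κ
    rw [wedge_sum_antisymm M θ hM, wedge_sum_antisymm M θ hM, ← Finset.sum_neg_distrib]
    refine Finset.sum_congr rfl fun i _ => ?_
    rw [hM i j μ ν, hM i j κ μ, hM i j ν κ]; ring

theorem waveLow_antisymm (i j μ ν : Fin 4) :
    waveLow a b c d i j ![ν, μ] = - waveLow a b c d i j ![μ, ν] := by
  have hd : ∀ x y μ ν, duWedge x y ![ν, μ] = - duWedge x y ![μ, ν] := fun x y μ ν => by
    fin_cases μ <;> fin_cases ν <;> simp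
  fin_cases i <;> fin_cases j <;> simp only [waveLow] <;>
    first | exact hd _ _ _ _ | (simp; done) | exact congrArg Neg.neg (hd _ _ _ _)

theorem Xbar_waveLow : (nullFrame h).Xbar (waveLow a b c d)
    = ![oneForm ![b - c, 0, 0, 0], 0, 0, 0] := by
  funext i
  refine Form.ext1 fun μ => ?_
  rw [Frame.Xbar, star_wedge_sum h (nullFrame.coordMetric h) _ _ (waveLow_antisymm a b c d)]
  simp only [Fin.sum_univ_four, nullFrame_θ]
  fin_cases i <;> fin_cases μ <;> simp [waveLow, nullCoframe]; ring

/-- X_a and X̄_a of the wave are multiples of k_a k. Because k ∧ k = 0 and k is null, neither the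
antisymmetric part nor the trace survives, which leaves Ψ = X, Ψ̄ = X̄ and kills ⁽³⁾W, ⁽⁵⁾W and
⁽⁶⁾W. -/
theorem coframeWedge_du (x : ℝ) :
    (nullFrame h).coframeWedge ![oneForm ![x, 0, 0, 0], 0, 0, 0] = 0 := by
  refine Form.ext2 fun μ ν => ?_
  rw [Frame.coframeWedge, Finset.sum_apply]
  simp only [wedge_one_one, Fin.sum_univ_four, nullFrame_θ]
  fin_cases μ <;> fin_cases ν <;> simp [nullCoframe]

theorem scalar_du (x : ℝ) : ∑ i, (interiorProd ((nullFrame h).eUp i)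
    ((![oneForm ![x, 0, 0, 0], 0, 0, 0] : Fin 4 → Form 1) i)).scalar = 0 := by
  simp only [interiorProd_one, nullFrame.eUp, Fin.sum_univ_four]
  simp

theorem Psi_waveLow : (nullFrame h).Psi (waveLow a b c d)
    = ![oneForm ![-(a + d), 0, 0, 0], 0, 0, 0] := by
  funext i
  rw [Frame.Psi, Frame.Xscal, X_waveLow, coframeWedge_du, scalar_du, interiorProd_zero_right]
  simp

theorem PsiBar_waveLow : (nullFrame h).PsiBar (waveLow a b c d)
    = ![oneForm ![b - c, 0, 0, 0], 0, 0, 0] := by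
  funext i
  rw [Frame.PsiBar, Frame.XbarScal, Xbar_waveLow, coframeWedge_du, scalar_du,
    interiorProd_zero_right]
  simp

theorem altPart_wedge_du (x : ℝ) : altPart (fun i j => (wedge ((nullFrame h).θLow i)
    ((![oneForm ![x, 0, 0, 0], 0, 0, 0] : Fin 4 → Form 1) j) : Form 2))
    = waveLow (x / 2) 0 0 (x / 2) := by
  refine TwoForms.ext fun i j μ ν => ?_
  simp only [altPart, Pi.smul_apply, Pi.sub_apply, wedge_one_one, nullFrame.θLow]
  fin_cases i <;> fin_cases j <;> fin_cases μ <;> fin_cases ν <;> simp [waveLow] <;> ring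

theorem waveLow_smul (r : ℝ) : r • waveLow a b c d = waveLow (r * a) (r * b) (r * c) (r * d) := by
  refine TwoForms.ext fun i j μ ν => ?_
  fin_cases i <;> fin_cases j <;> simp [waveLow] <;> fin_cases μ <;> fin_cases ν <;> simp

theorem waveLow_add (a' b' c' d' : ℝ) : waveLow a b c d + waveLow a' b' c' d'
    = waveLow (a + a') (b + b') (c + c') (d + d') := by
  refine TwoForms.ext fun i j μ ν => ?_
  fin_cases i <;> fin_cases j <;> simp [waveLow] <;> fin_cases μ <;> fin_cases ν <;> simp <;> ring

theorem waveLow_neg : -waveLow a b c d = waveLow (-a) (-b) (-c) (-d) := by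
  simpa using waveLow_smul a b c d (-1)

theorem star_waveLow {F : Frame} (hF : F.coordMetric = ppMetric h) :
    (fun i j => F.star (rfl : 2 + 2 = 4) (waveLow a b c d i j)) = waveLow b (-a) d (-c) := by
  have hs := star_duWedge h hF
  have hn : ∀ x y, F.star (rfl : 2 + 2 = 4) (-duWedge x y) = -duWedge y (-x) := fun x y => by
    rw [← hs]; exact (F.starₗ (rfl : 2 + 2 = 4)).map_neg _
  have h0 := F.star_zero (rfl : 2 + 2 = 4)
  funext i j
  fin_cases i <;> fin_cases j <;> simp [waveLow, hs, hn, h0]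

theorem W2_waveLow : (nullFrame h).W2 (waveLow a b c d)
    = waveLow 0 ((b - c) / 2) (-((b - c) / 2)) 0 := by
  have h1 : (nullFrame h).W2 (waveLow a b c d) = (-1 : ℝ) • fun i j =>
      (nullFrame h).star (rfl : 2 + 2 = 4) (waveLow ((b - c) / 2) 0 0 ((b - c) / 2) i j) := by
    funext i j
    rw [Frame.W2, PsiBar_waveLow, altPart_wedge_du, nullFrame.sgn]
    rfl
  rw [h1, star_waveLow h _ _ _ _ (nullFrame.coordMetric h), waveLow_smul]
  congr 1 <;> ring

theorem W3_waveLow : (nullFrame h).W3 (waveLow a b c d) = 0 := by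
  funext i j
  rw [Frame.W3, Frame.XbarScal, Xbar_waveLow, scalar_du, zero_smul, Frame.star_zero, smul_zero]
  rfl

theorem W4_waveLow : (nullFrame h).W4 (waveLow a b c d)
    = waveLow ((a + d) / 2) 0 0 ((a + d) / 2) := by
  have h1 : (nullFrame h).W4 (waveLow a b c d)
      = (-(2 / 2) : ℝ) • waveLow (-(a + d) / 2) 0 0 (-(a + d) / 2) := by
    rw [← altPart_wedge_du h, ← Psi_waveLow h a b c d]; rfl
  rw [h1, waveLow_smul]
  congr 1 <;> ring

theorem W5_waveLow : (nullFrame h).W5 (waveLow a b c d) = 0 := by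
  funext i j
  simp only [Frame.W5, X_waveLow, coframeWedge_du, interiorProd_zero_right, altPart]
  simp [wedge_zero_right]

theorem W6_waveLow : (nullFrame h).W6 (waveLow a b c d) = 0 := by
  funext i j
  rw [Frame.W6, Frame.Xscal, X_waveLow, scalar_du, mul_zero, zero_smul]
  rfl

/-- The surviving pieces split the matrix M: ⁽¹⁾W carries its symmetric trace-free part, ⁽²⁾W its
antisymmetric part and ⁽⁴⁾W its trace. -/
theorem W1_waveLow : (nullFrame h).W1 (waveLow a b c d)
    = waveLow ((a - d) / 2) ((b + c) / 2) ((b + c) / 2) (-((a - d) / 2)) := by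
  have h1 : (nullFrame h).W1 (waveLow a b c d) = waveLow a b c d +
      -(waveLow 0 ((b - c) / 2) (-((b - c) / 2)) 0 + 0
        + waveLow ((a + d) / 2) 0 0 ((a + d) / 2) + 0 + 0) := by
    -- The zero summands are turned back into ⁽³⁾W, ⁽⁵⁾W, ⁽⁶⁾W one after another; a backward
    -- rewriting hits every 0, so the later occurrences are restored before the next one.
    rw [← sub_eq_add_neg, ← W2_waveLow h, ← W4_waveLow h, ← W3_waveLow h a b c d]
    nth_rewrite 2 [W3_waveLow h a b c d]
    nth_rewrite 2 [W3_waveLow h a b c d]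
    rw [← W5_waveLow h a b c d]
    nth_rewrite 2 [W5_waveLow h a b c d]
    rw [← W6_waveLow h a b c d]
    rfl
  rw [h1, add_zero, add_zero, add_zero, waveLow_add, waveLow_neg, waveLow_add]
  congr 1 <;> ring

theorem map_zero_of_lin {E : Type*} [AddCommGroup E] [Module ℝ E] (f : TwoForms → E)
    (hf : ∀ (c : ℝ) M N, f (c • M + N) = c • f M + f N) : f 0 = 0 := by
  simpa using hf (-1) 0 0

/-- The bracket in the Lagrangian for the curvature of the wave. -/
theorem strongBracket_waveCurv (P : StrongParams) :
    strongBracket P (nullFrame h) (waveCurv a b c d)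
      = waveLow (P.w₁ * ((a - d) / 2) + P.w₄ * ((a + d) / 2))
        (P.w₁ * ((b + c) / 2) + P.w₂ * ((b - c) / 2))
        (P.w₁ * ((b + c) / 2) - P.w₂ * ((b - c) / 2))
        (-(P.w₁ * ((a - d) / 2)) + P.w₄ * ((a + d) / 2)) := by
  set F := nullFrame h
  simp only [strongBracket, lowerCurv_waveCurv, altPart_waveLow, symPart_waveLow, W1_waveLow,
    W2_waveLow, W3_waveLow, W4_waveLow, W5_waveLow, W6_waveLow, F,
    map_zero_of_lin _ (Frame.Z1_lin _), map_zero_of_lin _ (Frame.Z2_lin _),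
    map_zero_of_lin _ (Frame.Z3_lin _), map_zero_of_lin _ (Frame.Z4_lin _),
    map_zero_of_lin _ (Frame.Z5_lin _), map_zero_of_lin _ (Frame.crossTerm_lin _),
    map_zero_of_lin _ (Frame.crossTerm'_lin _), smul_zero, add_zero, waveLow_smul, waveLow_add]
  congr 1 <;> ring

theorem top_wedge_duWedge (α : Form 2) (hα : ∀ μ ν, α ![ν, μ] = - α ![μ, ν]) (x y : ℝ) :
    (wedge α (duWedge x y) : Form 4).top = α ![1, 2] * y - α ![1, 3] * x := by
  rw [wedge_two_two_top _ _ hα]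
  · simp
  · intro μ ν; fin_cases μ <;> fin_cases ν <;> simp

theorem raiseTwo_waveLow : (nullFrame h).raiseTwo (waveLow a b c d)
    = ![0, ![0, 0, duWedge a b, duWedge c d], ![0, -duWedge a b, 0, 0], ![0, -duWedge c d, 0, 0]] := by
  funext i j
  simp only [Frame.raiseTwo, nullFrame.gInv, Fin.sum_univ_four]
  fin_cases i <;> fin_cases j <;> simp [waveLow, nullMetric]

/-- The Lagrangian form with the curvature of the wave in the second slot. -/
theorem strongForm_waveCurv_right (P : StrongParams) (R : TwoForms)
    (hR : ∀ i j μ ν, R i j ![ν, μ] = - R i j ![μ, ν]) :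
    strongForm P (nullFrame h) R (waveCurv a b c d)
      = (P.w₁ * ((a - d) / 2) + P.w₄ * ((a + d) / 2)) * (R 1 2 ![1, 2] + R 2 0 ![1, 2])
      + (P.w₁ * ((b + c) / 2) + P.w₂ * ((b - c) / 2)) * (R 1 2 ![1, 3] + R 2 0 ![1, 3])
      + (P.w₁ * ((b + c) / 2) - P.w₂ * ((b - c) / 2)) * (R 1 3 ![1, 2] + R 3 0 ![1, 2])
      + (-(P.w₁ * ((a - d) / 2)) + P.w₄ * ((a + d) / 2)) * (R 1 3 ![1, 3] + R 3 0 ![1, 3]) := by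
  have hs := star_duWedge h (nullFrame.coordMetric h)
  have hn : ∀ x y, (nullFrame h).star (rfl : 2 + 2 = 4) (-duWedge x y) = duWedge (-y) x :=
    fun x y => by
      rw [show -duWedge x y = duWedge (-x) (-y) by
        refine Form.ext2 fun μ ν => ?_
        fin_cases μ <;> fin_cases ν <;> simp, hs, neg_neg]
  have h0 := (nullFrame h).star_zero (rfl : 2 + 2 = 4)
  have hl : ∀ i j μ ν, (nullFrame h).lowerCurv R i j ![ν, μ]
      = - (nullFrame h).lowerCurv R i j ![μ, ν] := fun i j μ ν => by
    simp only [Frame.lowerCurv, Finset.sum_apply, Pi.smul_apply, hR i _ μ ν, smul_neg,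
      Finset.sum_neg_distrib]
  have ht := fun i j => top_wedge_duWedge _ (hl i j)
  have hz : ∀ α : Form 2, (wedge α (0 : Form 2) : Form 4).top = 0 := fun α => by
    rw [wedge_zero_right]; rfl
  rw [strongForm, strongBracket_waveCurv, raiseTwo_waveLow]
  simp only [Fin.sum_univ_four, Matrix.cons_val_zero, Matrix.cons_val_one, Matrix.cons_val,
    Pi.zero_apply, hs, hn, h0, hz, ht]
  simp [Frame.lowerCurv, nullFrame_g, nullMetric, Fin.sum_univ_four]
  ring

end
end
end MAG

namespace MAG
noncomputable section

/-! ### The Lagrangian form with the curvature of the wave in the first slot -/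

theorem star_two_antisymm {F : Frame} {h : ℝ} (hF : F.coordMetric = ppMetric h) (α : Form 2)
    (μ ν : Fin 4) : F.star (rfl : 2 + 2 = 4) α ![ν, μ] = - F.star (rfl : 2 + 2 = 4) α ![μ, ν] := by
  simp only [star_two_table hF]
  fin_cases μ <;> fin_cases ν <;> simp <;> ring

/-- The components of a family of two-forms that couple to the curvature of the wave. -/
def waveComp (B : TwoForms) (j k : Fin 4) : ℝ :=
  (B 1 j ![1, k] - B 1 j ![k, 1]) - (B j 1 ![1, k] - B j 1 ![k, 1])

theorem waveComp_lin (r : ℝ) (B C : TwoForms) (j k : Fin 4) :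
    waveComp (r • B + C) j k = r * waveComp B j k + waveComp C j k := by
  simp only [waveComp, Pi.add_apply, Pi.smul_apply, smul_eq_mul]; ring

theorem waveComp_add (B C : TwoForms) (j k : Fin 4) :
    waveComp (B + C) j k = waveComp B j k + waveComp C j k := by
  simpa using waveComp_lin 1 B C j k

theorem waveComp_smul (r : ℝ) (B : TwoForms) (j k : Fin 4) :
    waveComp (r • B) j k = r * waveComp B j k := by
  simp only [waveComp, Pi.smul_apply, smul_eq_mul]; ring

/-- In du ∧ dx^k ∧ ⋆B only the ∂_v components of B count, and raising the frame indices of the wave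
moves 0 to 1. The cross terms of the bracket have no symmetry in their frame indices, which is why
`waveComp` antisymmetrises in both index pairs explicitly. -/
theorem strongForm_waveCurv_left (h a b c d : ℝ) (P : StrongParams) (R : TwoForms) :
    strongForm P (nullFrame h) (waveCurv a b c d) R
      = -(1 / 2) * (fun B => a * waveComp B 2 2 + b * waveComp B 2 3 + c * waveComp B 3 2
        + d * waveComp B 3 3) (strongBracket P (nullFrame h) R) := by
  have hd : ∀ x y (α : Form 2), (wedge (duWedge x y) ((nullFrame h).star (rfl : 2 + 2 = 4) α) :
      Form 4).top = -(1 / 2) * (x * (α ![1, 2] - α ![2, 1]) + y * (α ![1, 3] - α ![3, 1])) := by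
    intro x y α
    rw [wedge_two_two_top]
    · simp only [star_two_table (nullFrame.coordMetric h)]
      simp; ring
    · intro μ ν; fin_cases μ <;> fin_cases ν <;> simp
    · exact star_two_antisymm (nullFrame.coordMetric h) α
  have hdn : ∀ x y (α : Form 2), (wedge (-duWedge x y)
      ((nullFrame h).star (rfl : 2 + 2 = 4) α) : Form 4).top
      = (1 / 2) * (x * (α ![1, 2] - α ![2, 1]) + y * (α ![1, 3] - α ![3, 1])) := fun x y α => by
    rw [show -duWedge x y = duWedge (-x) (-y) by
        refine Form.ext2 fun μ ν => ?_
        fin_cases μ <;> fin_cases ν <;> simp, hd]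
    ring
  have hz : ∀ α : Form 2, (wedge (0 : Form 2) α : Form 4).top = 0 := fun α => by
    rw [wedge_zero_left]; rfl
  rw [strongForm, lowerCurv_waveCurv]
  generalize strongBracket P (nullFrame h) R = B
  simp only [waveLow, Fin.sum_univ_four, Matrix.cons_val_zero, Matrix.cons_val_one, Matrix.cons_val,
    Pi.zero_apply, hz, hd, hdn]
  simp [Frame.raiseTwo, nullFrame.gInv, nullMetric, Fin.sum_univ_four, waveComp]
  ring

/-! ### Coupling of each term of the bracket to the wave. -/

section
variable (h : ℝ) (M : TwoForms)

/-- The lowered wave curvature is antisymmetric in its frame indices, so all ⁽ᴵ⁾Z drop out and Z can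
enter through the cross terms only. -/
theorem waveComp_of_symm (hM : ∀ i j, M j i = M i j) (j k : Fin 4) : waveComp M j k = 0 := by
  rw [waveComp, hM 1 j]; ring

/-- A two-form ϑ^c ∧ B_c vanishes on a repeated vector. Together with e_1 = ∂_v and ϑ_1 = du this
removes all trace corrections from the (1, ∂_v) components of Ψ, Ψ̄, Φ, Φ̄, through which these
one-forms couple to the wave. -/
theorem interiorProd_self (i : Fin 4) (B : Fin 4 → Form 1) (v : Pt) (hv : v = Pi.single i 1) :
    interiorProd v ((nullFrame h).coframeWedge B) ![i] = 0 := by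
  rw [interiorProd_two, hv, Frame.coframeWedge]
  simp [Finset.sum_apply, Pi.single_apply, wedge_one_one]

theorem e_one : (nullFrame h).e 1 = Pi.single 1 1 := by
  rw [nullFrame.e]; ext μ; fin_cases μ <;> simp

theorem Psi_one : (nullFrame h).Psi M 1 ![1] = (nullFrame h).X M 1 ![1] := by
  simp only [Frame.Psi, Pi.sub_apply, Pi.smul_apply, nullFrame.θLow,
    interiorProd_self h 1 _ _ (e_one h)]
  simp

theorem PsiBar_one : (nullFrame h).PsiBar M 1 ![1] = (nullFrame h).Xbar M 1 ![1] := by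
  simp only [Frame.PsiBar, Pi.sub_apply, Pi.smul_apply, nullFrame.θLow,
    interiorProd_self h 1 _ _ (e_one h)]
  simp

theorem Phi_one : (nullFrame h).Phi M 1 ![1] = (nullFrame h).Y M 1 ![1] := by
  simp only [Frame.Phi, Pi.sub_apply, Pi.smul_apply, interiorProd_self h 1 _ _ (e_one h)]
  simp

theorem PhiBar_one : (nullFrame h).PhiBar M 1 ![1] = (nullFrame h).Ybar M 1 ![1] := by
  simp only [Frame.PhiBar, Pi.sub_apply, Pi.smul_apply, interiorProd_self h 1 _ _ (e_one h)]
  simp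

variable {j k : Fin 4} (hj : j = 2 ∨ j = 3) (hk : k = 2 ∨ k = 3)
include hj hk

theorem waveComp_W2 : waveComp ((nullFrame h).W2 M) j k
    = 2 * (nullFrame h).Xbar M 1 ![1] * (if j = 2 ∧ k = 3 then 1 else if j = 3 ∧ k = 2 then -1 else 0) := by
  rw [← PsiBar_one]
  simp only [waveComp, Frame.W2, Pi.smul_apply, star_two_table (nullFrame.coordMetric h), altPart,
    Pi.sub_apply, wedge_one_one, nullFrame.θLow, nullFrame.sgn]
  rcases hj with rfl | rfl <;> rcases hk with rfl | rfl <;> simp <;> ring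

theorem waveComp_W3 : waveComp ((nullFrame h).W3 M) j k = 0 := by
  simp only [waveComp, Frame.W3, Pi.smul_apply, star_two_table (nullFrame.coordMetric h),
    wedge_one_one, nullFrame.θLow, nullFrame.sgn]
  rcases hj with rfl | rfl <;> rcases hk with rfl | rfl <;> simp

theorem waveComp_W4 : waveComp ((nullFrame h).W4 M) j k
    = 2 * (nullFrame h).X M 1 ![1] * (if j = k then 1 else 0) := by
  rw [← Psi_one]
  simp only [waveComp, Frame.W4, Pi.smul_apply, altPart, Pi.sub_apply, wedge_one_one,
    nullFrame.θLow]
  rcases hj with rfl | rfl <;> rcases hk with rfl | rfl <;> simp <;> ring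

theorem waveComp_W5 : waveComp ((nullFrame h).W5 M) j k = 0 := by
  simp only [waveComp, Frame.W5, Pi.smul_apply, altPart, Pi.sub_apply, wedge_one_one,
    nullFrame.θLow, interiorProd_self h 1 _ _ (e_one h)]
  rcases hj with rfl | rfl <;> rcases hk with rfl | rfl <;> simp

theorem waveComp_W6 : waveComp ((nullFrame h).W6 M) j k = 0 := by
  simp only [waveComp, Frame.W6, Pi.smul_apply, wedge_one_one, nullFrame.θLow]
  rcases hj with rfl | rfl <;> rcases hk with rfl | rfl <;> simp

theorem waveComp_W1 : waveComp ((nullFrame h).W1 M) j k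
    = waveComp M j k - waveComp ((nullFrame h).W2 M) j k - waveComp ((nullFrame h).W4 M) j k := by
  have h1 : (nullFrame h).W1 M = M + (-1 : ℝ) • ((nullFrame h).W2 M + (nullFrame h).W3 M
      + (nullFrame h).W4 M + (nullFrame h).W5 M + (nullFrame h).W6 M) := by
    funext i j
    simp only [Frame.W1, Pi.add_apply, Pi.smul_apply]
    module
  rw [h1, waveComp_add, waveComp_smul]
  simp only [waveComp_add, waveComp_W3 h M hj hk, waveComp_W5 h M hj hk, waveComp_W6 h M hj hk]
  ring

theorem waveComp_crossTerm : waveComp ((nullFrame h).crossTerm M) j k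
    = -(2 * (if j = k then 1 else 0) * (M 0 1 ![1, 1] + (M 1 1 ![0, 1] - h / 2 * M 1 1 ![1, 1])
      - M 2 1 ![2, 1] - M 3 1 ![3, 1])) := by
  simp only [waveComp, Frame.crossTerm, wedge_one_one, nullFrame.θLow, nullFrame.eUp,
    Fin.sum_univ_four, Pi.add_apply, interiorProd_two]
  rcases hj with rfl | rfl <;> rcases hk with rfl | rfl <;> simp <;> ring

theorem waveComp_crossTerm' (hM : ∀ i j μ ν, M i j ![ν, μ] = - M i j ![μ, ν]) :
    waveComp ((nullFrame h).crossTerm' M) j k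
      = 2 * (M 1 j ![1, k] - M 1 1 ![j, k] + M k 1 ![j, 1]) := by
  have hz : ∀ i j μ, M i j ![μ, μ] = 0 := fun i j μ => by linarith [hM i j μ μ]
  have e1 := hM 1 j 1 k
  have e2 := hM k 1 j 1
  simp only [waveComp, Frame.crossTerm', wedge_one_one, Finset.sum_apply,
    interiorProd_two, nullFrame.e, Fin.sum_univ_four, nullFrame_θ, nullCoframe]
  rcases hj with rfl | rfl <;> rcases hk with rfl | rfl <;> simp [hz] <;> linarith

theorem waveComp_crossTerm_W5 : waveComp ((nullFrame h).crossTerm ((nullFrame h).W5 M)) j k = 0 := by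
  rw [waveComp_crossTerm h _ hj hk]
  simp only [Frame.W5, Pi.smul_apply, altPart, Pi.sub_apply, wedge_one_one,
    nullFrame.θLow, interiorProd_self h 1 _ _ (e_one h)]
  simp

theorem waveComp_crossTerm_Z3 : waveComp ((nullFrame h).crossTerm ((nullFrame h).Z3 M)) j k = 0 := by
  have hc : ∀ (B : Fin 4 → Form 1) μ, (nullFrame h).coframeWedge B ![μ, μ] = 0 := fun B μ => by
    simp [Frame.coframeWedge, Finset.sum_apply, wedge_one_one]
  rw [waveComp_crossTerm h _ hj hk]
  simp only [Frame.Z3, Pi.smul_apply, symPart, Pi.sub_apply, Pi.add_apply, wedge_one_one,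
    nullFrame.θLow, interiorProd_self h 1 _ _ (e_one h), nullFrame_g, hc]
  simp [nullMetric]

theorem waveComp_crossTerm_Z4 : waveComp ((nullFrame h).crossTerm ((nullFrame h).Z4 M)) j k
    = -(2 * (if j = k then 1 else 0) * (nullFrame h).Y M 1 ![1]) := by
  rw [waveComp_crossTerm h _ hj hk, ← Phi_one]
  simp only [Frame.Z4, Pi.smul_apply, symPart, Pi.add_apply, wedge_one_one, nullFrame.θLow]
  simp; ring_nf

theorem waveComp_crossTerm_Z5 (hM : ∀ i j μ ν, M i j ![ν, μ] = - M i j ![μ, ν]) :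
    waveComp ((nullFrame h).crossTerm ((nullFrame h).Z5 M)) j k = 0 := by
  have hz : ∀ i j μ, M i j ![μ, μ] = 0 := fun i j μ => by linarith [hM i j μ μ]
  rw [waveComp_crossTerm h _ hj hk]
  simp only [Frame.Z5, Pi.smul_apply, Finset.sum_apply, nullFrame_g, hz]
  simp [nullMetric]

/-- This coupling, antisymmetric in j and k, is the source of the v₂ term in the connection
equation. Of the remaining cross terms only that of ⁽⁴⁾Z contributes, and only for j = k. -/
theorem waveComp_crossTerm'_Z2 : waveComp ((nullFrame h).crossTerm' ((nullFrame h).Z2 M)) j k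
    = -(2 * (nullFrame h).Ybar M 1 ![1] *
      (if j = 2 ∧ k = 3 then 1 else if j = 3 ∧ k = 2 then -1 else 0)) := by
  rw [waveComp_crossTerm' h _ hj hk, ← PhiBar_one]
  · simp only [Frame.Z2, Pi.smul_apply, star_two_table (nullFrame.coordMetric h), symPart,
      Pi.add_apply, wedge_one_one, nullFrame.θLow, nullFrame.sgn]
    rcases hj with rfl | rfl <;> rcases hk with rfl | rfl <;> simp <;> ring
  · intro i j μ ν
    simp only [Frame.Z2, Pi.smul_apply, smul_eq_mul]
    rw [star_two_antisymm (nullFrame.coordMetric h), mul_neg]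

end

section
variable (h : ℝ) (M : TwoForms) (hM : ∀ i j μ ν, M i j ![ν, μ] = - M i j ![μ, ν])
include hM

theorem X_one (hA : M 1 1 = 0) : (nullFrame h).X M 1 ![1] = M 1 2 ![1, 2] + M 1 3 ![1, 3] := by
  have hz : ∀ i j μ, M i j ![μ, μ] = 0 := fun i j μ => by linarith [hM i j μ μ]
  simp only [Frame.X, Finset.sum_apply, interiorProd_two, nullFrame.eUp, Fin.sum_univ_four]
  simp [hz, hA, hM 1 2 1 2, hM 1 3 1 3]

theorem Xbar_one (hA : M 1 1 = 0) :
    (nullFrame h).Xbar M 1 ![1] = M 2 1 ![3, 1] + M 3 1 ![1, 2] := by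
  rw [Frame.Xbar, star_wedge_sum h (nullFrame.coordMetric h) _ _ hM]
  simp only [Fin.sum_univ_four, nullFrame_θ, nullCoframe]
  simp [hA]

theorem Z5_antisymm (i j μ ν : Fin 4) :
    (nullFrame h).Z5 M i j ![ν, μ] = - (nullFrame h).Z5 M i j ![μ, ν] := by
  simp only [Frame.Z5, Pi.smul_apply, Finset.sum_apply, hM _ _ μ ν, smul_neg,
    Finset.sum_neg_distrib]

theorem Y_one : (nullFrame h).Y M 1 ![1]
    = M 1 1 ![0, 1] + M 1 2 ![1, 2] + M 1 3 ![1, 3] := by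
  have hz : ∀ i j μ, M i j ![μ, μ] = 0 := fun i j μ => by linarith [hM i j μ μ]
  simp only [Frame.Y, Finset.sum_apply, interiorProd_two, nullFrame.eUp, Fin.sum_univ_four,
    Pi.sub_apply, Frame.Z5, Pi.smul_apply, hz, nullFrame_g]
  simp [hM 1 2 1 2, hM 1 3 1 3, hz, nullMetric]

theorem Ybar_one : (nullFrame h).Ybar M 1 ![1]
    = M 1 1 ![2, 3] + M 2 1 ![3, 1] + M 3 1 ![1, 2] := by
  have h1 : (nullFrame h).Ybar M 1 = (nullFrame h).star (rfl : 3 + 1 = 4)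
      (∑ i, (wedge ((M - (nullFrame h).Z5 M) i 1) ((nullFrame h).θ i) : Form 3)) := rfl
  rw [h1, star_wedge_sum h (nullFrame.coordMetric h)]
  · simp only [Fin.sum_univ_four, nullFrame_θ, nullCoframe, Pi.sub_apply, Frame.Z5, Pi.smul_apply,
      nullFrame_g]
    simp [nullMetric]
  · intro i j μ ν
    simp only [Pi.sub_apply]
    rw [hM i j μ ν, Z5_antisymm h M hM i j μ ν]; ring

/-- Since ⁽¹⁾W is W minus the other pieces, the couplings of ⁽²⁾W and ⁽⁴⁾W acquire the coefficients
w₂ − w₁ and w₄ − w₁. -/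
theorem waveComp_strongBracket (P : StrongParams) {j k : Fin 4} (hj : j = 2 ∨ j = 3)
    (hk : k = 2 ∨ k = 3) : waveComp (strongBracket P (nullFrame h) M) j k
    = (fun W Z : TwoForms => P.w₁ * waveComp W j k + (P.w₂ - P.w₁) * (2 * (W 2 1 ![3, 1] + W 3 1 ![1, 2])
        * (if j = 2 ∧ k = 3 then 1 else if j = 3 ∧ k = 2 then -1 else 0))
      + (P.w₄ - P.w₁) * (2 * (W 1 2 ![1, 2] + W 1 3 ![1, 3]) * (if j = k then 1 else 0))
      - P.v₂ * (2 * (Z 1 1 ![2, 3] + Z 2 1 ![3, 1] + Z 3 1 ![1, 2])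
        * (if j = 2 ∧ k = 3 then 1 else if j = 3 ∧ k = 2 then -1 else 0))
      - P.v₄ * (2 * (if j = k then 1 else 0) * (Z 1 1 ![0, 1] + Z 1 2 ![1, 2] + Z 1 3 ![1, 3])))
      (altPart ((nullFrame h).lowerCurv M)) (symPart ((nullFrame h).lowerCurv M)) := by
  have hl : ∀ i j μ ν, (nullFrame h).lowerCurv M i j ![ν, μ]
      = - (nullFrame h).lowerCurv M i j ![μ, ν] := fun i j μ ν => by
    simp only [Frame.lowerCurv, Finset.sum_apply, Pi.smul_apply, hM i _ μ ν, smul_neg,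
      Finset.sum_neg_distrib]
  have hW : ∀ i j μ ν, altPart ((nullFrame h).lowerCurv M) i j ![ν, μ]
      = - altPart ((nullFrame h).lowerCurv M) i j ![μ, ν] := fun i j μ ν => by
    simp only [altPart, Pi.smul_apply, Pi.sub_apply, hl i j μ ν, hl j i μ ν, smul_eq_mul]; ring
  have hZ : ∀ i j μ ν, symPart ((nullFrame h).lowerCurv M) i j ![ν, μ]
      = - symPart ((nullFrame h).lowerCurv M) i j ![μ, ν] := fun i j μ ν => by
    simp only [symPart, Pi.smul_apply, Pi.add_apply, hl i j μ ν, hl j i μ ν, smul_eq_mul]; ring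
  have hWA : altPart ((nullFrame h).lowerCurv M) 1 1 = 0 := by simp [altPart]
  have hsymm : ∀ N i j, symPart N j i = symPart N i j := fun N i j => by
    simp only [symPart, add_comm]
  have hZs := hsymm ((nullFrame h).lowerCurv M)
  simp only [strongBracket]
  generalize altPart ((nullFrame h).lowerCurv M) = W at *
  generalize symPart ((nullFrame h).lowerCurv M) = Z at *
  have z2 : ∀ i j, (nullFrame h).Z2 Z j i = (nullFrame h).Z2 Z i j := fun i j => by
    rw [Frame.Z2, hsymm]; rfl
  have hg : ∀ i j, (nullFrame h).g j i = (nullFrame h).g i j := fun i j => by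
    rw [nullFrame_g, nullFrame_g]; fin_cases i <;> fin_cases j <;> rfl
  have z3 : ∀ i j, (nullFrame h).Z3 Z j i = (nullFrame h).Z3 Z i j := fun i j => by
    rw [Frame.Z3, hsymm, hg]; rfl
  have z4 : ∀ i j, (nullFrame h).Z4 Z j i = (nullFrame h).Z4 Z i j := fun i j => by
    rw [Frame.Z4, hsymm]; rfl
  have z5 : ∀ i j, (nullFrame h).Z5 Z j i = (nullFrame h).Z5 Z i j := fun i j => by
    rw [Frame.Z5, hg]; rfl
  have z1 : ∀ i j, (nullFrame h).Z1 Z j i = (nullFrame h).Z1 Z i j := fun i j => by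
    rw [Frame.Z1, hZs, z2, z3, z4, z5]; rfl
  simp only [waveComp_add, waveComp_smul, waveComp_W1 h W hj hk, waveComp_W2 h W hj hk,
    waveComp_W3 h W hj hk, waveComp_W4 h W hj hk, waveComp_W5 h W hj hk, waveComp_W6 h W hj hk,
    waveComp_of_symm _ z1, waveComp_of_symm _ z2, waveComp_of_symm _ z3, waveComp_of_symm _ z4,
    waveComp_of_symm _ z5, waveComp_crossTerm_W5 h W hj hk, waveComp_crossTerm'_Z2 h Z hj hk,
    waveComp_crossTerm_Z3 h Z hj hk, waveComp_crossTerm_Z4 h Z hj hk,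
    waveComp_crossTerm_Z5 h Z hj hk hZ, X_one h W hW hWA, Xbar_one h W hW hWA, Y_one h Z hZ,
    Ybar_one h Z hZ]
  ring

/-- First variation of the Lagrangian form with respect to the curvature at the wave. -/
theorem strongForm_variation (P : StrongParams) (a b c d : ℝ) :
    strongForm P (nullFrame h) (waveCurv a b c d) M
      + strongForm P (nullFrame h) M (waveCurv a b c d)
    = P.w₁ * ((a - d) * (M 1 2 ![1, 2] - M 1 3 ![1, 3] + M 2 0 ![1, 2] - M 3 0 ![1, 3])
        + (b + c) * (M 1 2 ![1, 3] + M 1 3 ![1, 2] + M 2 0 ![1, 3] + M 3 0 ![1, 2]))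
      + P.w₂ * ((b - c) * (M 1 2 ![1, 3] - M 1 3 ![1, 2] + M 2 0 ![1, 3] - M 3 0 ![1, 2]))
      + P.w₄ * ((a + d) * (M 1 2 ![1, 2] + M 1 3 ![1, 3] + M 2 0 ![1, 2] + M 3 0 ![1, 3]))
      + P.v₂ * ((b - c) * (M 1 0 ![2, 3] + (M 1 2 ![1, 3] - M 1 3 ![1, 2] - M 2 0 ![1, 3]
        + M 3 0 ![1, 2]) / 2))
      + P.v₄ * ((a + d) * (M 1 0 ![0, 1] + (-M 1 2 ![1, 2] - M 1 3 ![1, 3] + M 2 0 ![1, 2]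
        + M 3 0 ![1, 3]) / 2)) := by
  -- The form is not symmetric a priori, so the wave is inserted into each slot by a separate
  -- formula.
  rw [strongForm_waveCurv_right h a b c d P M hM, strongForm_waveCurv_left]
  simp only [waveComp_strongBracket h M hM P (Or.inl rfl) (Or.inl rfl),
    waveComp_strongBracket h M hM P (Or.inl rfl) (Or.inr rfl),
    waveComp_strongBracket h M hM P (Or.inr rfl) (Or.inl rfl),
    waveComp_strongBracket h M hM P (Or.inr rfl) (Or.inr rfl)]
  simp only [waveComp, altPart, symPart, Pi.smul_apply, Pi.sub_apply, Pi.add_apply, Frame.lowerCurv,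
    nullFrame_g, Fin.sum_univ_four]
  simp [nullMetric, hM _ _ 1 2, hM _ _ 1 3]
  ring

end
end
end MAG

namespace MAG
noncomputable section

/-! ### Second-order smallness of the Lagrangian under variations of the coframe -/

/-- Paired with the wave, a curvature enters only through components with a ∂_v argument, whereas
every component of the wave is du ∧ (x dx + y dy). -/
theorem strongForm_waveCurv_self (P : StrongParams) (h a b c d : ℝ) :
    strongForm P (nullFrame h) (waveCurv a b c d) (waveCurv a b c d) = 0 := by
  have ha : ∀ i j μ ν, waveCurv a b c d i j ![ν, μ] = - waveCurv a b c d i j ![μ, ν] := by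
    intro i j μ ν
    have hd : ∀ x y μ ν, duWedge x y ![ν, μ] = - duWedge x y ![μ, ν] := fun x y μ ν => by
      fin_cases μ <;> fin_cases ν <;> simp
    fin_cases i <;> fin_cases j <;> simp only [waveCurv] <;>
      first | exact hd _ _ _ _ | simp
  rw [strongForm_waveCurv_right h a b c d P _ ha]
  simp [waveCurv]

theorem strongForm_smul_smul (P : StrongParams) (F : Frame) (r : ℝ) (R : TwoForms) :
    strongForm P F (r • R) (r • R) = r ^ 2 * strongForm P F R R := by
  have h0 : ∀ S, strongForm P F 0 S = 0 := fun S => by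
    simpa using strongForm_lin_left P F (-1) 0 0 S
  have h0' : ∀ S, strongForm P F S 0 = 0 := fun S => by
    simpa using strongForm_lin_right P F (-1) S 0 0
  have h1 := strongForm_lin_left P F r R 0 (r • R)
  have h2 := strongForm_lin_right P F r R R 0
  rw [add_zero, h0] at h1
  rw [add_zero, h0'] at h2
  rw [h1, h2]; ring

/-- The boost weights of the coordinates. -/
def boost (s : ℝ) : Fin 4 → ℝ := ![s, s⁻¹, 1, 1]

theorem boost_ne {s : ℝ} (hs : s ≠ 0) (μ : Fin 4) : boost s μ ≠ 0 := by
  fin_cases μ <;> simp [boost, hs]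

/-- A boost combined with the corresponding change of coordinates. -/
theorem frameRel_boost {s : ℝ} (hs : s ≠ 0) (θ : Fin 4 → Form 1) :
    FrameRel (Matrix.diagonal (boost s)) (Matrix.diagonal fun a => (boost s a)⁻¹) (boost s)
      ⟨nullMetric, θ⟩ ⟨nullMetric, fun a => (boost s a)⁻¹ • scale (boost s) (θ a)⟩ where
  inv := by
    rw [Matrix.diagonal_mul_diagonal]
    simp [boost_ne hs]
  prod := by simp [Fin.prod_univ_four, boost, hs]
  g a b := by
    simp only [Fin.sum_univ_four]
    fin_cases a <;> fin_cases b <;> simp [nullMetric, boost, hs]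
  θ a := by
    simp only [Fin.sum_univ_four]
    fin_cases a <;> simp [Matrix.diagonal]

/-- The factor du contributes one power of s and the lower index 0 (or the upper index 1) another,
so the wave curvature has boost weight 2 and the quadratic form weight 4. -/
theorem strongForm_boost (P : StrongParams) {s : ℝ} (hs : s ≠ 0) (θ : Fin 4 → Form 1)
    (a b c d : ℝ) :
    strongForm P ⟨nullMetric, θ⟩ (waveCurv a b c d) (waveCurv a b c d)
      = s ^ 4 * strongForm P ⟨nullMetric, fun a => (boost s a)⁻¹ • scale (boost s) (θ a)⟩
        (waveCurv a b c d) (waveCurv a b c d) := by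
  rw [← strongForm_invariant (frameRel_boost hs θ) P (R := waveCurv a b c d)
    (R' := s ^ 2 • waveCurv a b c d), strongForm_smul_smul]
  · ring
  · intro i j
    have hd : ∀ x y, scale (boost s) (duWedge x y) = s • duWedge x y := by
      intro x y
      refine Form.ext2 fun μ ν => ?_
      rw [scale_apply, Fin.prod_univ_two]
      fin_cases μ <;> fin_cases ν <;> simp [boost]
    simp only [Fin.sum_univ_four, Matrix.diagonal_apply, Pi.smul_apply]
    fin_cases i <;> fin_cases j <;> simp [waveCurv, hd, smul_smul] <;> simp [boost, sq]

theorem continuous_waveCurv {τ : Type*} [TopologicalSpace τ] {a b c d : τ → ℝ} (ha : Continuous a)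
    (hb : Continuous b) (hc : Continuous c) (hd : Continuous d) :
    Continuous fun s => waveCurv (a s) (b s) (c s) (d s) := by
  refine continuous_pi fun i => continuous_pi fun j => continuous_pi fun k => ?_
  have hdu : ∀ {x y : τ → ℝ}, Continuous x → Continuous y →
      Continuous fun s => duWedge (x s) (y s) k := fun {x y} hx hy => by
    simp only [duWedge]
    generalize k 0 = μ
    generalize k 1 = ν
    fin_cases μ <;> fin_cases ν <;> simp <;> fun_prop
  fin_cases i <;> fin_cases j <;> simp only [waveCurv] <;>
    first | exact continuous_const | exact hdu ha hb | exact hdu hc hd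

/-- A continuous function on a compact set: coframes in a closed ball around du, dv, dx, dy, small
enough for all of them to be invertible, times a cube of curvature entries. -/
theorem bounded_near_identity (P : StrongParams) (B : ℝ) : ∃ r > 0, ∃ C, ∀ θ : Fin 4 → Form 1,
    (∀ i μ, |θ i ![μ] - nullCoframe 0 i ![μ]| ≤ r) → ∀ a b c d : ℝ, |a| ≤ B → |b| ≤ B → |c| ≤ B →
    |d| ≤ B → |strongForm P ⟨nullMetric, θ⟩ (waveCurv a b c d) (waveCurv a b c d)| ≤ C := by
  have hdc : Continuous fun θ : Fin 4 → Form 1 => (Frame.mk nullMetric θ).coframeMatrix.det := by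
    refine Continuous.matrix_det (continuous_matrix fun a μ => ?_)
    simp only [Frame.coframeMatrix, Matrix.of_apply]; fun_prop
  have hopen : {θ : Fin 4 → Form 1 | (Frame.mk nullMetric θ).coframeMatrix.det ≠ 0}
      ∈ nhds (nullCoframe 0) := by
    refine (isOpen_ne_fun hdc continuous_const).mem_nhds ?_
    have := nullFrame.coframeMatrix_det 0
    rw [nullFrame] at this
    simp [this]
  obtain ⟨r, hr, hball⟩ := Metric.nhds_basis_closedBall.mem_iff.mp hopen
  refine ⟨r, hr, ?_⟩
  let K : Set ((Fin 4 → Form 1) × (Fin 4 → ℝ)) :=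
    Metric.closedBall (nullCoframe 0) r ×ˢ Metric.closedBall 0 B
  have hK : IsCompact K := (isCompact_closedBall _ _).prod (isCompact_closedBall _ _)
  have hF : ContFrame fun s : K => (⟨nullMetric, s.1.1⟩ : Frame) :=
    contFrame_of_coframe nullMetric (by rw [nullFrame.det_g]; norm_num) (by fun_prop)
      fun s => hball s.2.1
  have hR : Continuous fun s : K => waveCurv (s.1.2 0) (s.1.2 1) (s.1.2 2) (s.1.2 3) :=
    continuous_waveCurv (by fun_prop) (by fun_prop) (by fun_prop) (by fun_prop)
  have hL := hF.strongForm hR P hR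
  have hL' : ContinuousOn (fun s : (Fin 4 → Form 1) × (Fin 4 → ℝ) =>
      strongForm P ⟨nullMetric, s.1⟩ (waveCurv (s.2 0) (s.2 1) (s.2 2) (s.2 3))
        (waveCurv (s.2 0) (s.2 1) (s.2 2) (s.2 3))) K := continuousOn_iff_continuous_domRestrict.mpr hL
  obtain ⟨C, hC⟩ := hK.exists_bound_of_continuousOn hL'
  refine ⟨C, fun θ hθ a b c d ha hb hc hd => ?_⟩
  have hB : 0 ≤ B := (abs_nonneg a).trans ha
  refine hC (θ, ![a, b, c, d]) ⟨?_, ?_⟩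
  · rw [mem_closedBall_iff_norm]
    refine (pi_norm_le_iff_of_nonneg hr.le).mpr fun i => (pi_norm_le_iff_of_nonneg hr.le).mpr
      fun k => ?_
    have : k = ![k 0] := by ext m; fin_cases m; rfl
    rw [this]
    exact hθ i (k 0)
  · rw [mem_closedBall_zero_iff]
    refine (pi_norm_le_iff_of_nonneg hB).mpr fun i => ?_
    fin_cases i <;> simpa

/-- Boosting with s² = K|ε| gains the factor s⁴ = K²ε² and moves the perturbed coframe into the
compact ball of `bounded_near_identity`: the perturbation grows at most by s⁻², while the profile
term shrinks to s²h/2. -/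
theorem coframe_variation_bound (P : StrongParams) {B : ℝ} (hB : 0 < B) : ∃ C, ∃ ε₀ > 0, ∀ ε : ℝ,
    |ε| ≤ ε₀ → ∀ (h a b c d : ℝ) (δ : Fin 4 → Form 1), |h| ≤ B → |a| ≤ B → |b| ≤ B → |c| ≤ B →
    |d| ≤ B → (∀ i μ, |δ i ![μ]| ≤ B) →
    |strongForm P ⟨nullMetric, nullCoframe h + ε • δ⟩ (waveCurv a b c d) (waveCurv a b c d)|
      ≤ C * ε ^ 2 := by
  obtain ⟨r, hr, C, hC⟩ := bounded_near_identity P B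
  -- This K makes the amplified perturbation s⁻²|ε|B equal to r/2. The two bounds on ε give s ≤ 1
  -- and s²|h|/2 ≤ r/2.
  set K := 2 * B / r with hKdef
  have hK : 0 < K := by positivity
  refine ⟨K ^ 2 * C, min (1 / K) (r / (K * B)), by positivity, ?_⟩
  intro ε hε h a b c d δ hh ha hb hc hd hδ
  -- For ε = 0 there is no boost, as s would be 0; there the form vanishes exactly.
  by_cases h0 : ε = 0
  · subst h0
    have := strongForm_waveCurv_self P h a b c d
    rw [nullFrame] at this
    simp [this]
  have hε0 : 0 < |ε| := abs_pos.mpr h0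
  have hε1 : K * |ε| ≤ 1 := by
    have := hε.trans (min_le_left _ _)
    rw [le_div_iff₀ hK] at this; linarith
  have hε2 : K * |ε| * B ≤ r := by
    have := hε.trans (min_le_right _ _)
    rw [le_div_iff₀ (by positivity)] at this; linarith
  set s := √(K * |ε|) with hs
  have hs0 : 0 < s := Real.sqrt_pos.mpr (by positivity)
  have hs2 : s ^ 2 = K * |ε| := Real.sq_sqrt (by positivity)
  have hs1 : s ≤ 1 := by
    rw [hs]; exact Real.sqrt_le_one.mpr hε1
  rw [strongForm_boost P hs0.ne', abs_mul]
  have h4 : |s ^ 4| = K ^ 2 * ε ^ 2 := by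
    rw [abs_of_pos (by positivity), show s ^ 4 = (s ^ 2) ^ 2 by ring, hs2, mul_pow, sq_abs]
  rw [h4]
  suffices hmain : ∀ i μ, |((boost s i)⁻¹ • scale (boost s) ((nullCoframe h + ε • δ) i)) ![μ]
      - nullCoframe 0 i ![μ]| ≤ r by
    calc _ ≤ K ^ 2 * ε ^ 2 * C :=
          mul_le_mul_of_nonneg_left (hC _ hmain a b c d ha hb hc hd) (by positivity)
      _ = _ := by ring
  intro i μ
  -- The ratios of boost weights are powers of s between s⁻² and s²; for s ≤ 1 the largest is s⁻².
  have hρ : |(boost s i)⁻¹ * boost s μ| ≤ (s ^ 2)⁻¹ := by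
    have hp : 1 ≤ s⁻¹ := (one_le_inv₀ hs0).mpr hs1
    have hpp : s⁻¹ ≤ s⁻¹ * s⁻¹ := by nlinarith
    have hs5 : s * s ≤ 1 := by nlinarith
    rw [show (s ^ 2)⁻¹ = s⁻¹ * s⁻¹ by rw [sq, mul_inv]]
    fin_cases i <;> fin_cases μ <;> simp [boost, hs0.ne', abs_of_pos hs0] <;> linarith
  have hn : (boost s i)⁻¹ * boost s μ * nullCoframe h i ![μ] - nullCoframe 0 i ![μ]
      = if i = 1 ∧ μ = 0 then s ^ 2 * (h / 2) else 0 := by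
    fin_cases i <;> fin_cases μ <;> simp [boost, hs0.ne', nullCoframe]
    exact Or.inl (sq s).symm
  have hsplit : ((boost s i)⁻¹ • scale (boost s) ((nullCoframe h + ε • δ) i)) ![μ]
      - nullCoframe 0 i ![μ] = (boost s i)⁻¹ * boost s μ * (ε * δ i ![μ])
        + if i = 1 ∧ μ = 0 then s ^ 2 * (h / 2) else 0 := by
    rw [← hn]
    simp [scale_apply]; ring
  rw [hsplit]
  have h1 : |(boost s i)⁻¹ * boost s μ * (ε * δ i ![μ])| ≤ r / 2 := by
    rw [abs_mul, abs_mul ε]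
    calc _ ≤ (s ^ 2)⁻¹ * (|ε| * B) := mul_le_mul hρ
          (mul_le_mul_of_nonneg_left (hδ i μ) (abs_nonneg _)) (by positivity) (by positivity)
      _ = r / 2 := by rw [hs2, hKdef]; field_simp
  have h2 : |if i = 1 ∧ μ = 0 then s ^ 2 * (h / 2) else 0| ≤ r / 2 := by
    split_ifs
    · rw [abs_mul, hs2, abs_of_pos (by positivity : (0:ℝ) < K * |ε|), abs_div]
      have : K * |ε| * |h| ≤ K * |ε| * B := mul_le_mul_of_nonneg_left hh (by positivity)
      norm_num
      linarith
    · rw [abs_zero]; linarith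
  exact (abs_add_le _ _).trans (by linarith)

end
end MAG

namespace MAG
noncomputable section

/-! ### Partial derivatives -/

section pd

variable {f g : Pt → ℝ} {x : Pt} (μ ν : Fin 4)

theorem pd_congr (h : f =ᶠ[nhds x] g) : pd μ f x = pd μ g x := by
  rw [pd, pd, h.fderiv_eq]

theorem pd_const (c : ℝ) : pd μ (fun _ => c) x = 0 := by simp [pd]

theorem pd_add (hf : DifferentiableAt ℝ f x) (hg : DifferentiableAt ℝ g x) :
    pd μ (fun y => f y + g y) x = pd μ f x + pd μ g x := by
  simp [pd, fderiv_fun_add hf hg]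

theorem pd_sub (hf : DifferentiableAt ℝ f x) (hg : DifferentiableAt ℝ g x) :
    pd μ (fun y => f y - g y) x = pd μ f x - pd μ g x := by
  simp [pd, fderiv_fun_sub hf hg]

theorem pd_neg : pd μ (fun y => -f y) x = -pd μ f x := by
  simp [pd]

theorem pd_mul (hf : DifferentiableAt ℝ f x) (hg : DifferentiableAt ℝ g x) :
    pd μ (fun y => f y * g y) x = pd μ f x * g x + f x * pd μ g x := by
  simp [pd, fderiv_fun_mul hf hg]; ring

theorem pd_const_mul (c : ℝ) (hf : DifferentiableAt ℝ f x) :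
    pd μ (fun y => c * f y) x = c * pd μ f x := by
  rw [pd_mul μ (differentiableAt_const c) hf, pd_const]; ring

theorem pd_sum {ι : Type*} {s : Finset ι} {f : ι → Pt → ℝ}
    (hf : ∀ i ∈ s, DifferentiableAt ℝ (f i) x) :
    pd μ (fun y => ∑ i ∈ s, f i y) x = ∑ i ∈ s, pd μ (f i) x := by
  simp only [pd]
  rw [fderiv_fun_sum hf, _root_.sum_apply]

variable {D : Set Pt}

theorem contDiffOn_pd (hD : IsOpen D) (hf : ContDiffOn ℝ ∞ f D) : ContDiffOn ℝ ∞ (pd μ f) D :=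
  (hf.fderiv_of_isOpen hD (m := ∞) (by simp)).clm_apply contDiffOn_const

theorem differentiableAt_of_contDiffOn (hD : IsOpen D) (hf : ContDiffOn ℝ ∞ f D) (hx : x ∈ D) :
    DifferentiableAt ℝ f x :=
  (hf.contDiffAt (hD.mem_nhds hx)).differentiableAt (by simp)

theorem pd_comm (hf : ContDiffAt ℝ 2 f x) : pd μ (pd ν f) x = pd ν (pd μ f) x := by
  have hsym : IsSymmSndFDerivAt ℝ f x := hf.isSymmSndFDerivAt (by simp)
  have hd : DifferentiableAt ℝ (fderiv ℝ f) x :=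
    (hf.fderiv_right (m := 1) (by norm_num)).differentiableAt (by simp)
  have key : ∀ μ ν, pd μ (pd ν f) x
      = fderiv ℝ (fderiv ℝ f) x (Pi.single μ 1) (Pi.single ν 1) := by
    intro μ ν
    have h : pd ν f = fun y => fderiv ℝ f y (Pi.single ν 1) := rfl
    rw [pd, h, fderiv_clm_apply hd (differentiableAt_const _)]
    simp
  rw [key, key, hsym.eq]

end pd

theorem extd_one (α : Pt → Form 1) (x : Pt) (μ ν : Fin 4) :
    extd α x ![μ, ν] = pd μ (fun y => α y ![ν]) x - pd ν (fun y => α y ![μ]) x := by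
  have h0 : ∀ y, (α y fun m : Fin 1 => ![μ, ν] ((0 : Fin 2).succAbove m)) = α y ![ν] := fun y =>
    congrArg (α y) (by ext m; fin_cases m; rfl)
  have h1 : ∀ y, (α y fun m : Fin 1 => ![μ, ν] ((1 : Fin 2).succAbove m)) = α y ![μ] := fun y =>
    congrArg (α y) (by ext m; fin_cases m; rfl)
  rw [extd, Fin.sum_univ_two]
  simp only [h0, h1]
  simp [sub_eq_add_neg]

/-! ### Matrix-valued functions -/

section pdM

variable {m n k : Type} [Fintype n] {x : Pt} (μ ν : Fin 4)

/-- The entrywise partial derivative of a matrix-valued function. -/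
def pdM (G : Pt → Matrix m k ℝ) (x : Pt) : Matrix m k ℝ :=
  Matrix.of fun a b => pd μ (fun y => G y a b) x

/-- Entrywise differentiability. -/
def DiffM (G : Pt → Matrix m k ℝ) (x : Pt) : Prop :=
  ∀ a b, DifferentiableAt ℝ (fun y => G y a b) x

theorem DiffM.mul {G : Pt → Matrix m n ℝ} {K : Pt → Matrix n k ℝ} (hG : DiffM G x)
    (hK : DiffM K x) : DiffM (fun y => G y * K y) x := fun a b => by
  simp only [Matrix.mul_apply]
  exact DifferentiableAt.fun_sum fun i _ => (hG a i).mul (hK i b)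

theorem DiffM.transpose {G : Pt → Matrix m k ℝ} (hG : DiffM G x) :
    DiffM (fun y => (G y).transpose) x := fun a b => hG b a

theorem pdM_congr {G K : Pt → Matrix m k ℝ} (h : G =ᶠ[nhds x] K) : pdM μ G x = pdM μ K x := by
  ext a b
  exact pd_congr μ (h.mono fun y hy => congrFun (congrFun hy a) b)

theorem pdM_const (M : Matrix m k ℝ) : pdM μ (fun _ => M) x = 0 := by
  ext a b; exact pd_const μ _

theorem pdM_transpose (G : Pt → Matrix m k ℝ) :
    pdM μ (fun y => (G y).transpose) x = (pdM μ G x).transpose := rfl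

theorem pdM_add {G K : Pt → Matrix m k ℝ} (hG : DiffM G x) (hK : DiffM K x) :
    pdM μ (fun y => G y + K y) x = pdM μ G x + pdM μ K x := by
  ext a b; exact pd_add μ (hG a b) (hK a b)

theorem pdM_mul {G : Pt → Matrix m n ℝ} {K : Pt → Matrix n k ℝ} (hG : DiffM G x)
    (hK : DiffM K x) :
    pdM μ (fun y => G y * K y) x = pdM μ G x * K x + G x * pdM μ K x := by
  ext a b
  simp only [pdM, Matrix.of_apply, Matrix.add_apply, Matrix.mul_apply]
  rw [pd_sum μ fun i _ => (hG a i).fun_mul (hK i b), ← Finset.sum_add_distrib]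
  exact Finset.sum_congr rfl fun i _ => pd_mul μ (hG a i) (hK i b)

theorem pdM_comm {G : Pt → Matrix m k ℝ} (hG : ∀ a b, ContDiffAt ℝ 2 (fun y => G y a b) x) :
    pdM μ (pdM ν G) x = pdM ν (pdM μ G) x := by
  ext a b; exact pd_comm μ ν (hG a b)

end pdM

namespace Fields

variable (Φ : Fields) (x : Pt) (μ ν : Fin 4)

/-- The connection matrix `Γ_a^b(∂_μ)` (row index `b`, column index `a`). -/
def connMat : Matrix (Fin 4) (Fin 4) ℝ := Matrix.of fun b a => Φ.Γ x a b ![μ]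

/-- The column of components `ϑ^a(∂_μ)`. -/
def coMat : Matrix (Fin 4) (Fin 1) ℝ := Matrix.of fun a _ => Φ.θ x a ![μ]

/-- With the upper index as row index, Γ_c^b ∧ Γ_a^c becomes an ordinary matrix commutator, and
gauge transformations can be handled by noncommutative algebra. -/
theorem curvature_matrix : (Matrix.of fun b a => Φ.curvature x a b ![μ, ν])
    = pdM μ (fun y => Φ.connMat y ν) x - pdM ν (fun y => Φ.connMat y μ) x
      + Φ.connMat x μ * Φ.connMat x ν - Φ.connMat x ν * Φ.connMat x μ := by
  ext b a
  simp only [Matrix.of_apply, curvature, Pi.add_apply, extd_one, Finset.sum_apply, pdM, connMat,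
    Matrix.sub_apply, Matrix.add_apply, Matrix.mul_apply, add_sub_assoc, ← Finset.sum_sub_distrib]
  congr 1
  exact Finset.sum_congr rfl fun c _ => wedge_one_one _ _ _ _

theorem torsion_matrix : (Matrix.of fun a (_ : Fin 1) => Φ.torsion x a ![μ, ν])
    = pdM μ (fun y => Φ.coMat y ν) x - pdM ν (fun y => Φ.coMat y μ) x
      + Φ.connMat x μ * Φ.coMat x ν - Φ.connMat x ν * Φ.coMat x μ := by
  ext a b
  simp only [Matrix.of_apply, torsion, Pi.add_apply, extd_one, Finset.sum_apply, pdM, connMat, coMat,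
    Matrix.sub_apply, Matrix.add_apply, Matrix.mul_apply, add_sub_assoc, ← Finset.sum_sub_distrib]
  congr 1
  exact Finset.sum_congr rfl fun c _ => wedge_one_one _ _ _ _

theorem covD_matrix (B : Pt → Fin 4 → Fin 4 → ℝ) : (Matrix.of fun a b => Φ.covD B x a b ![μ])
    = pdM μ (fun y => Matrix.of (B y)) x - (Φ.connMat x μ).transpose * Matrix.of (B x)
      - Matrix.of (B x) * Φ.connMat x μ := by
  ext a b
  simp only [Matrix.of_apply, covD, Pi.sub_apply, Finset.sum_apply, pdM, connMat,
    Matrix.sub_apply, Matrix.mul_apply, Matrix.transpose_apply, gradForm, Pi.smul_apply, smul_eq_mul,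
    Matrix.cons_val_fin_one]
  congr 1
  congr 1
  exact Finset.sum_congr rfl fun c _ => mul_comm _ _

end Fields

/-! ### Changes of frame -/

/-- On `D`, the fields `Φ'` arise from `Φ` by the change of frame `e'_a = U^c_a e_c`, with inverse
matrix `V`. -/
structure GaugeRel (D : Set Pt) (U V : Pt → Matrix (Fin 4) (Fin 4) ℝ) (Φ Φ' : Fields) : Prop where
  isOpen : IsOpen D
  smooth_U : ∀ a b, ContDiffOn ℝ ∞ (fun y => U y a b) D
  smooth_V : ∀ a b, ContDiffOn ℝ ∞ (fun y => V y a b) D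
  inv : ∀ x ∈ D, U x * V x = 1
  diff_θ : ∀ x ∈ D, ∀ a μ, DifferentiableAt ℝ (fun y => Φ.θ y a ![μ]) x
  diff_Γ : ∀ x ∈ D, ∀ a b μ, DifferentiableAt ℝ (fun y => Φ.Γ y a b ![μ]) x
  g : ∀ x ∈ D, Matrix.of (Φ'.g x) = (U x).transpose * Matrix.of (Φ.g x) * U x
  θ : ∀ x ∈ D, ∀ μ, Φ'.coMat x μ = V x * Φ.coMat x μ
  Γ : ∀ x ∈ D, ∀ μ, Φ'.connMat x μ = V x * Φ.connMat x μ * U x + V x * pdM μ U x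

namespace GaugeRel

variable {D : Set Pt} {U V : Pt → Matrix (Fin 4) (Fin 4) ℝ} {Φ Φ' : Fields}
  (h : GaugeRel D U V Φ Φ') {x : Pt} (hx : x ∈ D)
include h hx

theorem inv' : V x * U x = 1 := mul_eq_one_comm.mp (h.inv x hx)

theorem eventually {p : Pt → Prop} (hp : ∀ y ∈ D, p y) : ∀ᶠ y in nhds x, p y :=
  Filter.eventually_of_mem (h.isOpen.mem_nhds hx) hp

theorem diffM_U : DiffM U x := fun a b =>
  differentiableAt_of_contDiffOn h.isOpen (h.smooth_U a b) hx

theorem diffM_V : DiffM V x := fun a b =>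
  differentiableAt_of_contDiffOn h.isOpen (h.smooth_V a b) hx

theorem diffM_pdM_U (μ : Fin 4) : DiffM (pdM μ U) x := fun a b =>
  differentiableAt_of_contDiffOn h.isOpen (contDiffOn_pd μ h.isOpen (h.smooth_U a b)) hx

theorem pdM_V (μ : Fin 4) : pdM μ V x = -(V x * pdM μ U x * V x) := by
  have h1 : pdM μ (fun y => U y * V y) x = 0 := by
    rw [pdM_congr μ (h.eventually hx fun y hy => h.inv y hy), pdM_const]
  rw [pdM_mul μ (h.diffM_U hx) (h.diffM_V hx)] at h1
  have h2 := congrArg (V x * ·) h1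
  simp only [mul_add, mul_zero, ← mul_assoc, h.inv' hx, one_mul] at h2
  exact eq_neg_of_add_eq_zero_right h2

/-- The inhomogeneous terms cancel: the second derivatives of U by symmetry, the products of first
derivatives through dV = −V dU V. -/
theorem curvature_matrix (μ ν : Fin 4) : (Matrix.of fun b a => Φ'.curvature x a b ![μ, ν])
    = V x * (Matrix.of fun b a => Φ.curvature x a b ![μ, ν]) * U x := by
  have hG : ∀ ν, DiffM (fun y => Φ.connMat y ν) x := fun ν a b => h.diff_Γ x hx b a ν
  have hU := h.diffM_U hx
  have hV := h.diffM_V hx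
  have hder : ∀ μ ν, pdM μ (fun y => Φ'.connMat y ν) x
      = (pdM μ V x * Φ.connMat x ν + V x * pdM μ (fun y => Φ.connMat y ν) x) * U x
        + V x * Φ.connMat x ν * pdM μ U x
        + (pdM μ V x * pdM ν U x + V x * pdM μ (pdM ν U) x) := by
    intro μ ν
    rw [pdM_congr μ (h.eventually hx fun y hy => h.Γ y hy ν),
      pdM_add μ ((hV.mul (hG ν)).mul hU) (hV.mul (h.diffM_pdM_U hx ν)),
      pdM_mul μ (hV.mul (hG ν)) hU, pdM_mul μ hV (hG ν), pdM_mul μ hV (h.diffM_pdM_U hx ν)]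
  have hcomm : pdM μ (pdM ν U) x = pdM ν (pdM μ U) x := pdM_comm μ ν fun a b =>
    mod_cast contDiffAt_infty.mp ((h.smooth_U a b).contDiffAt (h.isOpen.mem_nhds hx)) 2
  have hUV : ∀ X, U x * (V x * X) = X := fun X => by rw [← mul_assoc, h.inv x hx, one_mul]
  rw [Fields.curvature_matrix, Fields.curvature_matrix, hder, hder, h.Γ x hx, h.Γ x hx,
    h.pdM_V hx, h.pdM_V hx, hcomm]
  simp only [mul_add, add_mul, mul_sub, sub_mul, mul_assoc, neg_mul, hUV]
  abel

theorem torsion_matrix (μ ν : Fin 4) : (Matrix.of fun a (_ : Fin 1) => Φ'.torsion x a ![μ, ν])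
    = V x * Matrix.of fun a (_ : Fin 1) => Φ.torsion x a ![μ, ν] := by
  have hθ : ∀ ν, DiffM (fun y => Φ.coMat y ν) x := fun ν a b => h.diff_θ x hx a ν
  have hV := h.diffM_V hx
  have hder : ∀ μ ν, pdM μ (fun y => Φ'.coMat y ν) x
      = pdM μ V x * Φ.coMat x ν + V x * pdM μ (fun y => Φ.coMat y ν) x := by
    intro μ ν
    rw [pdM_congr μ (h.eventually hx fun y hy => h.θ y hy ν), pdM_mul μ hV (hθ ν)]
  have hUV : ∀ X : Matrix (Fin 4) (Fin 1) ℝ, U x * (V x * X) = X := fun X => by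
    rw [← Matrix.mul_assoc, h.inv x hx, Matrix.one_mul]
  rw [Fields.torsion_matrix, Fields.torsion_matrix, hder, hder, h.Γ x hx, h.Γ x hx,
    h.pdM_V hx, h.pdM_V hx, h.θ x hx, h.θ x hx]
  simp only [Matrix.mul_add, Matrix.add_mul, Matrix.mul_sub, Matrix.mul_assoc,
    Matrix.neg_mul, hUV]
  abel

theorem covD_matrix {B B' : Pt → Fin 4 → Fin 4 → ℝ}
    (hB : ∀ y ∈ D, Matrix.of (B' y) = (U y).transpose * Matrix.of (B y) * U y)
    (hd : ∀ a b, DifferentiableAt ℝ (fun y => B y a b) x) (μ : Fin 4) :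
    (Matrix.of fun a b => Φ'.covD B' x a b ![μ])
      = (U x).transpose * (Matrix.of fun a b => Φ.covD B x a b ![μ]) * U x := by
  have hU := h.diffM_U hx
  have hUV : ∀ X, U x * (V x * X) = X := fun X => by rw [← mul_assoc, h.inv x hx, one_mul]
  have hVU : ∀ X, (V x).transpose * ((U x).transpose * X) = X := fun X => by
    rw [← mul_assoc, ← Matrix.transpose_mul, h.inv x hx, Matrix.transpose_one, one_mul]
  have hder : pdM μ (fun y => Matrix.of (B' y)) x
      = ((pdM μ U x).transpose * Matrix.of (B x)
          + (U x).transpose * pdM μ (fun y => Matrix.of (B y)) x) * U x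
        + (U x).transpose * Matrix.of (B x) * pdM μ U x := by
    have hB' : DiffM (fun y => Matrix.of (B y)) x := hd
    rw [pdM_congr μ (h.eventually hx hB), pdM_mul μ (hU.transpose.mul hB') hU,
      pdM_mul μ hU.transpose hB', pdM_transpose]
  rw [Fields.covD_matrix, Fields.covD_matrix, hder, h.Γ x hx, hB x hx]
  simp only [mul_add, add_mul, mul_sub, sub_mul, mul_assoc, Matrix.transpose_mul,
    Matrix.transpose_add, hUV, hVU]
  abel

end GaugeRel

end
end MAG

/-! ### Transfer of the Ricci condition and of both variational derivatives along a change of frame.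
-/

namespace MAG
noncomputable section

theorem scaleVec_one (e : Pt) : scaleVec 1 e = e := by
  ext i; simp [scaleVec_apply]

theorem Frame.kUp_eq (F : Frame) (a : Fin 4) :
    F.kUp a = (interiorProd (F.eUp a) waveForm).scalar := by
  rw [Frame.kUp, Frame.eUp, interiorProd_sum_left, scalar_sum]
  refine Finset.sum_congr rfl fun b _ => ?_
  rw [interiorProd_smul_left, scalar_smul]; rfl

namespace FrameRel

variable {U V : Matrix (Fin 4) (Fin 4) ℝ} {F F' : Frame} (h : FrameRel U V 1 F F')
include h

theorem kLow (a : Fin 4) : F'.kLow a = ∑ b, U b a * F.kLow b := by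
  rw [Frame.kLow, h.e, interiorProd_sum_left, scalar_sum]
  refine Finset.sum_congr rfl fun b _ => ?_
  rw [interiorProd_smul_left, scalar_smul, scaleVec_one]; rfl

theorem kUp (a : Fin 4) : F'.kUp a = ∑ b, V a b * F.kUp b := by
  rw [Frame.kUp_eq, h.eUp, interiorProd_sum_left, scalar_sum]
  refine Finset.sum_congr rfl fun b _ => ?_
  rw [interiorProd_smul_left, scalar_smul, scaleVec_one, ← Frame.kUp_eq]

theorem star_one_scale {p q : ℕ} (hpq : p + q = 4) (α : Form p) : F'.star hpq α = F.star hpq α := by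
  simpa only [scale_one] using h.star hpq α

theorem sum_kUp_kLow {δ δ' : Fin 4 → Fin 4 → Form 1}
    (hδ : ∀ a b, δ' a b = ∑ c, ∑ d, (U c a * V b d) • δ c d) :
    ∑ a, ∑ b, (F'.kUp a * F'.kLow b) • δ' a b = ∑ a, ∑ b, (F.kUp a * F.kLow b) • δ a b := by
  have h1 : ∀ c, ∑ b, F'.kLow b • ∑ d, V b d • δ c d = ∑ b, F.kLow b • δ c b := fun c => by
    have := contract h.inv (LinearMap.lsmul ℝ (Form 1)).flip (δ c) F.kLow
    simp only [LinearMap.flip_apply, LinearMap.lsmul_apply, smul_eq_mul] at this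
    simpa only [h.kLow] using this
  have h2 := contract h.inv (LinearMap.lsmul ℝ (Form 1)) F.kUp fun c => ∑ b, F.kLow b • δ c b
  simp only [LinearMap.lsmul_apply, smul_eq_mul, ← h.kUp] at h2
  simp only [mul_smul, ← Finset.smul_sum]
  rw [← h2]
  refine Finset.sum_congr rfl fun a _ => ?_
  congr 1
  simp only [← h1, hδ, mul_smul, Finset.smul_sum]
  rw [Finset.sum_comm]
  refine Finset.sum_congr rfl fun c _ => Finset.sum_congr rfl fun b _ =>
    Finset.sum_congr rfl fun d _ => ?_
  rw [smul_comm]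

end FrameRel

/-- The matrices U and V are smooth on D only. A transformed test field is still smooth everywhere,
because its support lies in D and it vanishes near every point outside the support. -/
theorem IsVariation.of_contDiffOn {E E' : Type*} [NormedAddCommGroup E] [NormedSpace ℝ E]
    [NormedAddCommGroup E'] [NormedSpace ℝ E'] {D : Set Pt} (hD : IsOpen D) {δ : Pt → E}
    {δ' : Pt → E'} (hδ : IsVariation D δ) (hs : ContDiffOn ℝ ∞ δ' D) (h0 : ∀ x, δ x = 0 → δ' x = 0) :
    IsVariation D δ' := by
  have hsub : tsupport δ' ⊆ tsupport δ := closure_mono fun x hx hx0 => hx (h0 x hx0)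
  refine ⟨?_, hδ.2.1.mono' (subset_closure.trans hsub), hsub.trans hδ.2.2⟩
  refine contDiff_iff_contDiffAt.mpr fun x => ?_
  by_cases hx : x ∈ tsupport δ'
  · exact hs.contDiffAt (hD.mem_nhds (hδ.2.2 (hsub hx)))
  · exact contDiffAt_const.congr_of_eventuallyEq (notMem_tsupport_iff_eventuallyEq.mp hx)

namespace GaugeRel

variable {D : Set Pt} {U V : Pt → Matrix (Fin 4) (Fin 4) ℝ} {Φ Φ' : Fields}
  (h : GaugeRel D U V Φ Φ') {x : Pt} (hx : x ∈ D)
include h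

include hx in
theorem coframe (a : Fin 4) : Φ'.θ x a = ∑ b, V x a b • Φ.θ x b := by
  refine Form.ext1 fun μ => ?_
  have := congrFun (congrFun (h.θ x hx μ) a) 0
  simpa [Fields.coMat, Matrix.mul_apply] using this

include hx in
theorem frameRel : FrameRel (U x) (V x) 1 (Φ.frame x) (Φ'.frame x) where
  inv := h.inv x hx
  prod := by simp
  g a b := by
    have := congrFun (congrFun (h.g x hx) a) b
    simp only [Matrix.of_apply, Matrix.mul_apply, Matrix.transpose_apply, Finset.sum_mul] at this
    refine this.trans ?_
    rw [Finset.sum_comm]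
    exact Finset.sum_congr rfl fun c _ => Finset.sum_congr rfl fun d _ => by
      simp only [Fields.frame]; ring
  θ a := by simp only [scale_one]; exact h.coframe hx a

include hx in
theorem curvature (a b : Fin 4) :
    Φ'.curvature x a b = ∑ c, ∑ d, (U x c a * V x b d) • Φ.curvature x c d := by
  refine Form.ext2 fun μ ν => ?_
  have := congrFun (congrFun (h.curvature_matrix hx μ ν) b) a
  simp only [Matrix.of_apply, Matrix.mul_apply, Finset.sum_mul] at this
  rw [this]
  simp only [Finset.sum_apply, Pi.smul_apply, smul_eq_mul]
  exact Finset.sum_congr rfl fun c _ => Finset.sum_congr rfl fun d _ => by ring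

include hx in
theorem lagrangianDensity (P : StrongParams) :
    Φ'.lagrangianDensity P x = Φ.lagrangianDensity P x := by
  rw [Fields.lagrangianDensity, Fields.lagrangianDensity, strongLagrangian_top,
    strongLagrangian_top, strongForm_invariant (h.frameRel hx) P]
  intro a b
  simp only [scale_one]
  exact h.curvature hx a b

include hx in
theorem ricci : Matrix.of (Φ'.ricci x) = (U x).transpose * Matrix.of (Φ.ricci x) * U x := by
  ext a b
  have hF := h.frameRel hx
  have h1 := contract hF.inv ((interiorProdₗ 0).flip ∘ₗ interiorProdₗ 1 ((Φ'.frame x).e a))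
    (fun d => ∑ c, U x c b • Φ.curvature x c d) (Φ.frame x).e
  have he : ∀ c, (Φ'.frame x).e c = ∑ d, U x d c • (Φ.frame x).e d := fun c => by
    simpa only [scaleVec_one] using hF.e c
  have hR : ∀ c, Φ'.curvature x b c
      = ∑ d, V x c d • ∑ c', U x c' b • Φ.curvature x c' d := fun c => by
    rw [h.curvature hx, Finset.sum_comm]
    simp only [Finset.smul_sum, smul_smul]
    exact Finset.sum_congr rfl fun c _ => Finset.sum_congr rfl fun d _ => by rw [mul_comm]
  simp only [← he, ← hR] at h1
  have h2 := congrArg Form.scalar h1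
  simp only [LinearMap.comp_apply, LinearMap.flip_apply] at h2
  have h3 : ∀ {p} (e : Pt) (α : Form (p + 1)), interiorProdₗ p e α = interiorProd e α :=
    fun _ _ => rfl
  simp only [h3, scalar_sum] at h2
  rw [Matrix.of_apply, Fields.ricci, h2]
  simp only [Matrix.mul_apply, Matrix.transpose_apply, Matrix.of_apply, Fields.ricci, he,
    interiorProd_sum_left, interiorProd_sum_right, interiorProd_smul_left,
    interiorProd_smul_right, scalar_sum, scalar_smul, Finset.sum_mul, Finset.mul_sum]
  rw [Finset.sum_comm]
  refine Finset.sum_congr rfl fun c _ => ?_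
  rw [Finset.sum_comm]
  exact Finset.sum_congr rfl fun d _ => Finset.sum_congr rfl fun d _ => by ring

theorem ricciParallelOn_iff (hd : ∀ x ∈ D, ∀ a b, DifferentiableAt ℝ (fun y => Φ'.ricci y a b) x) :
    Φ.RicciParallelOn D ↔ Φ'.RicciParallelOn D := by
  have hR : ∀ y ∈ D, Matrix.of (Φ.ricci y) = (V y).transpose * Matrix.of (Φ'.ricci y) * V y := by
    intro y hy
    rw [h.ricci hy]
    simp only [mul_assoc, h.inv y hy, mul_one]
    rw [← mul_assoc, ← Matrix.transpose_mul, h.inv y hy, Matrix.transpose_one, one_mul]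
  have hd' : ∀ x ∈ D, ∀ a b, DifferentiableAt ℝ (fun y => Φ.ricci y a b) x := by
    intro x hx a b
    have hV := h.diffM_V hx
    have : DiffM (fun y => (V y).transpose * Matrix.of (Φ'.ricci y) * V y) x :=
      (hV.transpose.mul (hd x hx)).mul hV
    exact (this a b).congr_of_eventuallyEq (h.eventually hx fun y hy =>
      congrFun (congrFun (hR y hy) a) b)
  have key : ∀ x ∈ D, ∀ μ, (Matrix.of fun a b => Φ'.covD Φ'.ricci x a b ![μ])
      = (U x).transpose * (Matrix.of fun a b => Φ.covD Φ.ricci x a b ![μ]) * U x :=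
    fun x hx μ => h.covD_matrix hx (fun y hy => h.ricci hy) (hd' x hx) μ
  refine ⟨fun hp x hx a b => Form.ext1 fun μ => ?_, fun hp x hx a b => Form.ext1 fun μ => ?_⟩
  · have h0 : (Matrix.of fun a b => Φ.covD Φ.ricci x a b ![μ]) = 0 := by
      ext a b; simp [hp x hx]
    have := congrFun (congrFun (key x hx μ) a) b
    rw [h0] at this
    simpa using this
  · have h0 : (Matrix.of fun a b => Φ'.covD Φ'.ricci x a b ![μ]) = 0 := by
      ext a b; simp [hp x hx]
    have h1 := congrArg (fun M => (V x).transpose * M * V x) (key x hx μ)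
    simp only [h0, mul_assoc, h.inv x hx, mul_one] at h1
    rw [← mul_assoc (V x).transpose (U x).transpose, ← Matrix.transpose_mul, h.inv x hx, Matrix.transpose_one, one_mul] at h1
    have := congrFun (congrFun h1 a) b
    simpa using this.symm

/-- Replacing δ by Vδ keeps the two varied coframes related by the same U and V, and the curvatures
are untouched; the two action increments therefore agree for every ε. -/
theorem coframeEquation {P : StrongParams} (hE : CoframeEquation P D Φ') :
    CoframeEquation P D Φ := by
  intro δ hδ
  set δ' : Pt → Fin 4 → Form 1 := fun x a => ∑ b, V x a b • δ x b with hδ'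
  have hv : IsVariation D δ' := hδ.of_contDiffOn h.isOpen (by
    refine contDiffOn_pi.mpr fun a => ContDiffOn.sum fun b _ => ?_
    exact (h.smooth_V a b).smul (contDiff_pi.mp hδ.1 b).contDiffOn) fun x hx => by
      simp [hδ', hx]; rfl
  have := hE δ' hv
  simp only [Pi.zero_apply, wedge_zero_right] at this ⊢
  refine this.congr_of_eventuallyEq (Filter.Eventually.of_forall fun ε => ?_)
  refine MeasureTheory.setIntegral_congr_fun h.isOpen.measurableSet fun x hx => ?_
  have hF := h.frameRel hx
  simp only [h.lagrangianDensity hx]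
  congr 1
  have hF' : FrameRel (U x) (V x) 1 ((Φ.addCoframe (ε • δ)).frame x)
      ((Φ'.addCoframe (ε • δ')).frame x) := by
    refine ⟨hF.inv, hF.prod, hF.g, fun a => ?_⟩
    have := hF.θ a
    simp only [Fields.frame, Fields.addCoframe, Pi.add_apply, Pi.smul_apply, scale_one] at this ⊢
    rw [this, hδ']
    simp only [smul_add, Finset.sum_add_distrib, Finset.smul_sum]
    congr 1
    exact Finset.sum_congr rfl fun b _ => smul_comm _ _ _
  rw [Fields.lagrangianDensity, Fields.lagrangianDensity, strongLagrangian_top,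
    strongLagrangian_top, strongForm_invariant hF' P]
  intro a b
  simp only [scale_one]
  exact h.curvature hx a b

/-- The difference of two connections is a tensor: the inhomogeneous term V dU is not affected by
it. -/
theorem addConnection {δ δ' : Pt → Fin 4 → Fin 4 → Form 1}
    (hδ : ∀ x ∈ D, ∀ a b μ, DifferentiableAt ℝ (fun y => δ y a b ![μ]) x)
    (hδ' : ∀ x ∈ D, ∀ a b, δ' x a b = ∑ c, ∑ d, (U x c a * V x b d) • δ x c d) :
    GaugeRel D U V (Φ.addConnection δ) (Φ'.addConnection δ') where
  isOpen := h.isOpen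
  smooth_U := h.smooth_U
  smooth_V := h.smooth_V
  inv := h.inv
  diff_θ := h.diff_θ
  diff_Γ x hx a b μ := (h.diff_Γ x hx a b μ).add (hδ x hx a b μ)
  g := h.g
  θ := h.θ
  Γ x hx μ := by
    have h1 : ∀ (Ψ : Fields) η, (Ψ.addConnection η).connMat x μ
        = Ψ.connMat x μ + Matrix.of fun b a => η x a b ![μ] := fun _ _ => rfl
    rw [h1, h1, h.Γ x hx, mul_add, add_mul, add_right_comm]
    congr 1
    congr 1
    ext b a
    simp only [Matrix.of_apply, hδ' x hx, Matrix.mul_apply, Finset.sum_mul, Finset.sum_apply,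
      Pi.smul_apply, smul_eq_mul]
    exact Finset.sum_congr rfl fun c _ => Finset.sum_congr rfl fun d _ => by ring

/-- The one-form k^a k_b δΓ_a^b does not depend on the frame, and ⋆k depends only on the coordinate
metric, so both sides of the derivative formula carry over. -/
theorem hasConnectionDerivative {P : StrongParams} (s : Pt → ℝ)
    (hE : HasConnectionDerivative P D Φ' fun x a b =>
      s x • (((Φ'.frame x).kUp a * (Φ'.frame x).kLow b) •
        (Φ'.frame x).star (rfl : 1 + 3 = 4) waveForm)) :
    HasConnectionDerivative P D Φ fun x a b =>
      s x • (((Φ.frame x).kUp a * (Φ.frame x).kLow b) •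
        (Φ.frame x).star (rfl : 1 + 3 = 4) waveForm) := by
  intro δ hδ
  set δ' : Pt → Fin 4 → Fin 4 → Form 1 := fun x a b =>
    ∑ c, ∑ d, (U x c a * V x b d) • δ x c d with hδ'
  have hv : IsVariation D δ' := hδ.of_contDiffOn h.isOpen (by
    refine contDiffOn_pi.mpr fun a => contDiffOn_pi.mpr fun b => ContDiffOn.sum fun c _ =>
      ContDiffOn.sum fun d _ => ?_
    exact ((h.smooth_U c a).mul (h.smooth_V b d)).smul
      (contDiff_pi.mp (contDiff_pi.mp hδ.1 c) d).contDiffOn) fun x hx => by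
      simp [hδ', hx]; rfl
  have hdiff : ∀ (ε : ℝ), ∀ x ∈ D, ∀ a b μ,
      DifferentiableAt ℝ (fun y => (ε • δ) y a b ![μ]) x := fun ε x _ a b μ =>
    ((contDiff_pi.mp (contDiff_pi.mp (contDiff_pi.mp hδ.1 a) b) ![μ]).differentiable
      (by simp) x).const_smul ε
  have hform : ∀ (F : Frame) (s : ℝ) (S : Form 3) (δ : Fin 4 → Fin 4 → Form 1),
      ∑ a, ∑ b, (wedge (δ a b) (s • ((F.kUp a * F.kLow b) • S)) : Form 4).top
      = (wedge (∑ a, ∑ b, (F.kUp a * F.kLow b) • δ a b) (s • S) : Form 4).top := by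
    intro F s S δ
    simp only [wedge_sum_left, wedge_smul_left, wedge_smul_right]
    simp only [Form.top, Finset.sum_apply, Pi.smul_apply, smul_eq_mul, Finset.mul_sum]
  have := hE δ' hv
  refine (this.congr_of_eventuallyEq (Filter.Eventually.of_forall fun ε => ?_)).congr_deriv ?_
  · refine MeasureTheory.setIntegral_congr_fun h.isOpen.measurableSet fun x hx => ?_
    simp only [h.lagrangianDensity hx]
    rw [(h.addConnection (δ := ε • δ) (δ' := ε • δ') (hdiff ε) fun x hx a b => ?_).lagrangianDensity hx]
    simp only [Pi.smul_apply, hδ', Finset.smul_sum]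
    exact Finset.sum_congr rfl fun b _ => Finset.sum_congr rfl fun b _ => smul_comm _ _ _
  · refine MeasureTheory.setIntegral_congr_fun h.isOpen.measurableSet fun x hx => ?_
    have hF := h.frameRel hx
    simp only [hform]
    rw [hF.sum_kUp_kLow fun a b => rfl, hF.star_one_scale]

end GaugeRel

end
end MAG

namespace MAG
noncomputable section

/-! ### The wave in its adapted frame -/

/-- The connection forms `Γ_0^2 = Γ_2^1 = s du + f dy`, `Γ_0^3 = Γ_3^1 = t du - f dx`,
`Γ_2^3 = -Γ_3^2 = f du`. -/
def waveConn (s t f : ℝ) : Fin 4 → Fin 4 → Form 1 :=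
  ![![0, 0, oneForm ![s, 0, 0, f], oneForm ![t, 0, -f, 0]], 0,
    ![0, oneForm ![s, 0, 0, f], 0, oneForm ![f, 0, 0, 0]],
    ![0, oneForm ![t, 0, -f, 0], oneForm ![-f, 0, 0, 0], 0]]

/-- The pp-wave with profile `h` and axial torsion `a`, in the adapted frame. -/
def waveFields (h a : Pt → ℝ) : Fields where
  g _ := nullMetric
  θ x := nullCoframe (h x)
  Γ x := waveConn (1 / 2 * pd 2 h x) (1 / 2 * pd 3 h x) (1 / 6 * a x)

/-- The profile functions of a wave on `D`, independent of `v`, with `a` a function of `u` only. -/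
structure WaveData (D : Set Pt) (h a : Pt → ℝ) : Prop where
  isOpen : IsOpen D
  smooth_h : ContDiffOn ℝ ∞ h D
  smooth_a : ContDiffOn ℝ ∞ a D
  pd_h : ∀ x ∈ D, pd 1 h x = 0
  pd_a : ∀ x ∈ D, ∀ μ ≠ 0, pd μ a x = 0

/-- The trace of the matrix `M`, where `R_0^i = R_i^1 = du ∧ M_ij dx^j`. -/
def waveTrace (h a : Pt → ℝ) (x : Pt) : ℝ :=
  1 / 18 * a x ^ 2 - 1 / 2 * transverseLaplacian h x

section

variable {s t f : Pt → ℝ} {x : Pt}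

theorem differentiableAt_waveConn (hs : DifferentiableAt ℝ s x) (ht : DifferentiableAt ℝ t x)
    (hf : DifferentiableAt ℝ f x) (i j ν : Fin 4) :
    DifferentiableAt ℝ (fun y => waveConn (s y) (t y) (f y) i j ![ν]) x := by
  fin_cases i <;> fin_cases j <;> simp [waveConn] <;> fin_cases ν <;> simp [hs, ht, hf]

theorem pd_waveConn (μ i j ν : Fin 4) :
    pd μ (fun y => waveConn (s y) (t y) (f y) i j ![ν]) x
      = waveConn (pd μ s x) (pd μ t x) (pd μ f x) i j ![ν] := by
  fin_cases i <;> fin_cases j <;> simp [waveConn, pd_const] <;> fin_cases ν <;>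
    simp [pd_const, pd_neg]

end

namespace WaveData

variable {D : Set Pt} {h a : Pt → ℝ} (w : WaveData D h a) {x : Pt} (hx : x ∈ D)
include w

theorem smooth_pd_h (μ : Fin 4) : ContDiffOn ℝ ∞ (pd μ h) D := contDiffOn_pd μ w.isOpen w.smooth_h

theorem smooth_pd_pd_h (μ ν : Fin 4) : ContDiffOn ℝ ∞ (pd μ (pd ν h)) D :=
  contDiffOn_pd μ w.isOpen (w.smooth_pd_h ν)

theorem smooth_pd_a (μ : Fin 4) : ContDiffOn ℝ ∞ (pd μ a) D := contDiffOn_pd μ w.isOpen w.smooth_a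

include hx

theorem diff_h : DifferentiableAt ℝ h x := differentiableAt_of_contDiffOn w.isOpen w.smooth_h hx

theorem diff_a : DifferentiableAt ℝ a x := differentiableAt_of_contDiffOn w.isOpen w.smooth_a hx

theorem diff_pd_h (μ : Fin 4) : DifferentiableAt ℝ (pd μ h) x :=
  differentiableAt_of_contDiffOn w.isOpen (w.smooth_pd_h μ) hx

theorem diff_pd_pd_h (μ ν : Fin 4) : DifferentiableAt ℝ (pd μ (pd ν h)) x :=
  differentiableAt_of_contDiffOn w.isOpen (w.smooth_pd_pd_h μ ν) hx

theorem diff_pd_a (μ : Fin 4) : DifferentiableAt ℝ (pd μ a) x :=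
  differentiableAt_of_contDiffOn w.isOpen (w.smooth_pd_a μ) hx

theorem pd_pd_h (μ ν : Fin 4) : pd μ (pd ν h) x = pd ν (pd μ h) x :=
  pd_comm μ ν (mod_cast contDiffAt_infty.mp (w.smooth_h.contDiffAt (w.isOpen.mem_nhds hx)) 2)

theorem pd_v_h (ν : Fin 4) : pd 1 (pd ν h) x = 0 := by
  have h0 : pd 1 h =ᶠ[nhds x] fun _ => 0 :=
    Filter.eventually_of_mem (w.isOpen.mem_nhds hx) w.pd_h
  rw [w.pd_pd_h hx, pd_congr ν h0, pd_const]

theorem diff_Γ (i j ν : Fin 4) :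
    DifferentiableAt ℝ (fun y => (waveFields h a).Γ y i j ![ν]) x :=
  differentiableAt_waveConn ((w.diff_pd_h hx 2).const_mul _) ((w.diff_pd_h hx 3).const_mul _)
    ((w.diff_a hx).const_mul _) i j ν

theorem pd_Γ (μ i j ν : Fin 4) : pd μ (fun y => (waveFields h a).Γ y i j ![ν]) x
    = waveConn (1 / 2 * pd μ (pd 2 h) x) (1 / 2 * pd μ (pd 3 h) x) (1 / 6 * pd μ a x) i j ![ν] := by
  rw [← pd_const_mul μ _ (w.diff_pd_h hx 2), ← pd_const_mul μ _ (w.diff_pd_h hx 3),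
    ← pd_const_mul μ _ (w.diff_a hx)]
  exact pd_waveConn μ i j ν

/-- With f = a/6 the differentials of ½∂_x h du + f dy and ½∂_y h du − f dx supply the Hessian of h
and ± ∂_u a/6, while the rotation Γ_2^3 = f du acting on f dy and −f dx supplies f² = a²/36 on the
diagonal. -/
theorem curvature : (waveFields h a).curvature x
    = waveCurv (1 / 36 * a x ^ 2 - 1 / 2 * pd 2 (pd 2 h) x)
      (1 / 6 * pd 0 a x - 1 / 2 * pd 2 (pd 3 h) x)
      (-(1 / 6 * pd 0 a x) - 1 / 2 * pd 2 (pd 3 h) x)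
      (1 / 36 * a x ^ 2 - 1 / 2 * pd 3 (pd 3 h) x) := by
  refine TwoForms.ext fun i j μ ν => ?_
  rw [Fields.curvature, Pi.add_apply, extd_one, w.pd_Γ hx, w.pd_Γ hx, Finset.sum_apply,
    Fin.sum_univ_four]
  have e : (waveFields h a).Γ x = waveConn (1 / 2 * pd 2 h x) (1 / 2 * pd 3 h x) (1 / 6 * a x) := rfl
  have hw : ∀ α β : Form 1, wedge α β ![μ, ν] = α ![μ] * β ![ν] - α ![ν] * β ![μ] :=
    fun α β => wedge_one_one α β μ ν
  simp only [hw, e]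
  have h1 := w.pd_v_h hx 2
  have h2 := w.pd_v_h hx 3
  have h3 := w.pd_pd_h hx 3 2
  have a1 := w.pd_a x hx 1 (by decide)
  have a2 := w.pd_a x hx 2 (by decide)
  have a3 := w.pd_a x hx 3 (by decide)
  fin_cases i <;> fin_cases j <;> simp [waveConn, waveCurv] <;> fin_cases μ <;> fin_cases ν <;>
    simp [h1, h2, h3, a1, a2, a3] <;> ring

omit hx w in
theorem nonmetricity (i j : Fin 4) : (waveFields h a).nonmetricity x i j = 0 := by
  refine Form.ext1 fun μ => ?_
  simp only [Fields.nonmetricity, Fields.covD, Fin.sum_univ_four]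
  have : gradForm (fun y => (waveFields h a).g y i j) x = 0 := funext fun k => pd_const _ _
  rw [this]
  fin_cases i <;> fin_cases j <;> simp [waveFields, nullMetric, waveConn] <;> fin_cases μ <;> simp

omit hx w in
theorem pd_coframe (hd : DifferentiableAt ℝ h x) (μ ν i : Fin 4) :
    pd μ (fun y => nullCoframe (h y) i ![ν]) x = if i = 1 ∧ ν = 0 then 1 / 2 * pd μ h x else 0 := by
  have h1 : pd μ (fun y => h y / 2) x = 1 / 2 * pd μ h x := by
    rw [← pd_const_mul μ _ hd]; congr 1; ext y; ring
  fin_cases i <;> simp [nullCoframe] <;> fin_cases ν <;> simp [pd_const, h1]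

theorem torsion (i : Fin 4) : (waveFields h a).torsion x i =
    (1 / 3 : ℝ) • interiorProd (((waveFields h a).frame x).eUp i)
      (((waveFields h a).frame x).star (rfl : 1 + 3 = 4) (a x • waveForm)) := by
  refine Form.ext2 fun μ ν => ?_
  have hF : (waveFields h a).frame x = nullFrame (h x) := rfl
  have hi : ∀ (e : Pt) (α : Form 3), interiorProd e α ![μ, ν] = ∑ κ, e κ * α ![κ, μ, ν] :=
    fun _ _ => rfl
  rw [hF, Frame.star_smul, interiorProd_smul_right, Pi.smul_apply, Pi.smul_apply, hi,
    nullFrame.eUp, Fields.torsion, Pi.add_apply, extd_one, Finset.sum_apply]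
  simp only [star_waveForm (nullFrame.coordMetric (h x))]
  have e : (waveFields h a).Γ x = waveConn (1 / 2 * pd 2 h x) (1 / 2 * pd 3 h x) (1 / 6 * a x) := rfl
  have hw : ∀ α β : Form 1, wedge α β ![μ, ν] = α ![μ] * β ![ν] - α ![ν] * β ![μ] :=
    fun α β => wedge_one_one α β μ ν
  have e' : ∀ y, (waveFields h a).θ y = nullCoframe (h y) := fun _ => rfl
  simp only [hw, e, e', pd_coframe (w.diff_h hx), Fin.sum_univ_four]
  have h1 := w.pd_h x hx
  have s2 : Int.sign 2 = 1 := rfl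
  have s3 : Int.sign 3 = 1 := rfl
  fin_cases i <;> simp [waveConn, nullCoframe] <;> fin_cases μ <;> fin_cases ν <;>
    simp [h1, leviInt, s2, s3] <;> ring

theorem ricci (i j : Fin 4) : (waveFields h a).ricci x i j
    = if i = 0 ∧ j = 0 then waveTrace h a x else 0 := by
  have hF : (waveFields h a).frame x = nullFrame (h x) := rfl
  have hi : ∀ (e e' : Pt) (α : Form 2), (interiorProd e (interiorProd e' α)).scalar
    = ∑ κ, e κ * ∑ l, e' l * α ![l, κ] := fun _ _ _ => rfl
  rw [Fields.ricci, w.curvature hx, hF]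
  simp only [hi, nullFrame.e, Fin.sum_univ_four]
  fin_cases i <;> fin_cases j <;> simp [waveCurv, waveTrace, transverseLaplacian] <;> ring

end WaveData

end
end MAG

namespace MAG
noncomputable section

/-! ### Reduction to the adapted frame -/

/-- A metric-compatible torsion-free difference of two connections vanishes. -/
theorem connection_unique {g E E' : Matrix (Fin 4) (Fin 4) ℝ} (hg : g.transpose = g)
    (hgdet : g.det ≠ 0) (hE : E * E' = 1) {Δ : Fin 4 → Matrix (Fin 4) (Fin 4) ℝ}
    (hmet : ∀ μ, (Δ μ).transpose * g + g * Δ μ = 0)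
    (htor : ∀ μ ν a, ∑ b, Δ μ a b * E b ν = ∑ b, Δ ν a b * E b μ) (μ : Fin 4) : Δ μ = 0 := by
  have hE' : E' * E = 1 := mul_eq_one_comm.mp hE
  have hL : ∀ μ a b, (g * Δ μ) a b = - (g * Δ μ) b a := fun μ a b => by
    have h1 : (g * Δ μ).transpose = - (g * Δ μ) := by
      rw [Matrix.transpose_mul, hg]; exact eq_neg_of_add_eq_zero_left (hmet μ)
    have := congrFun (congrFun h1 b) a
    simpa using this
  -- The difference with its frame index lowered, the form index still being a coordinate index;
  -- multiplication by E' converts the latter to a frame index.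
  let L : Fin 4 → Matrix (Fin 4) (Fin 4) ℝ := fun a => Matrix.of fun b μ => (g * Δ μ) a b
  have hM : ∀ a, ((L a).transpose * E).transpose = (L a).transpose * E := by
    intro a
    ext μ ν
    have key : ∀ μ ν, ((L a).transpose * E) μ ν = ∑ c, g a c * ∑ b, Δ μ c b * E b ν := by
      intro μ ν
      simp only [L, Matrix.mul_apply, Matrix.transpose_apply, Matrix.of_apply, Finset.sum_mul,
        Finset.mul_sum]
      rw [Finset.sum_comm]
      exact Finset.sum_congr rfl fun c _ => Finset.sum_congr rfl fun b _ => by ring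
    rw [Matrix.transpose_apply, key, key]
    exact Finset.sum_congr rfl fun c _ => by rw [htor]
  have hX : ∀ a, (L a * E').transpose = L a * E' := by
    intro a
    have hEt : E'.transpose * E.transpose = 1 := by
      rw [← Matrix.transpose_mul, hE, Matrix.transpose_one]
    have h1 : L a * E' = E'.transpose * ((L a).transpose * E).transpose * E' := by
      rw [Matrix.transpose_mul, Matrix.transpose_transpose, ← mul_assoc, hEt, one_mul]
    have h2 : (L a * E').transpose = E'.transpose * ((L a).transpose * E) * E' := by
      rw [Matrix.transpose_mul, mul_assoc, mul_assoc, hE, mul_one]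
    rw [h2, h1, hM]
  have hs : ∀ a b c, (L a * E') b c = (L a * E') c b := fun a b c =>
    (congrFun (congrFun (hX a) b) c).symm
  have ha : ∀ a b c, (L a * E') b c = - (L b * E') a c := fun a b c => by
    simp only [L, Matrix.mul_apply, Matrix.of_apply, ← Finset.sum_neg_distrib]
    simp only [← Matrix.mul_apply]
    exact Finset.sum_congr rfl fun μ _ => by rw [hL]; ring
  have hz : ∀ a, L a * E' = 0 := fun a => by
    ext b c
    have := ha a b c
    have := hs b a c
    have := ha b c a
    have := hs c b a
    have := ha c a b
    have := hs a c b
    simp only [Matrix.zero_apply]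
    linarith
  have hL0 : ∀ a, L a = 0 := fun a => by
    rw [← mul_one (L a), ← hE', ← mul_assoc, hz, zero_mul]
  have hgΔ : g * Δ μ = 0 := by
    ext a b
    exact congrFun (congrFun (hL0 a) b) μ
  have := congrArg (g⁻¹ * ·) hgΔ
  simpa [← mul_assoc, Matrix.nonsing_inv_mul g (isUnit_iff_ne_zero.mpr hgdet)] using this

/-- Entrywise smoothness of a matrix-valued function. -/
def SmoothM (D : Set Pt) (G : Pt → Matrix (Fin 4) (Fin 4) ℝ) : Prop :=
  ∀ a b, ContDiffOn ℝ ∞ (fun y => G y a b) D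

theorem SmoothM.mul {D : Set Pt} {G K : Pt → Matrix (Fin 4) (Fin 4) ℝ} (hG : SmoothM D G)
    (hK : SmoothM D K) : SmoothM D fun y => G y * K y := fun a b => by
  simp only [Matrix.mul_apply]
  exact ContDiffOn.sum fun i _ => (hG a i).mul (hK i b)

/-- Smoothness is assumed for the composites H(u, x, y) and 𝒜(u + φ₀) as functions on D, not for H
and 𝒜 themselves. Vanishing derivatives are therefore read off from constancy along coordinate
lines, not from the chain rule. -/
theorem pd_eq_zero_of_line {f : Pt → ℝ} {x : Pt} {μ : Fin 4} (hf : DifferentiableAt ℝ f x)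
    (h : ∀ t : ℝ, f (x + t • Pi.single μ 1) = f x) : pd μ f x = 0 := by
  rw [pd, ← hf.lineDeriv_eq_fderiv, lineDeriv]
  simp only [h, deriv_const]

theorem waveData {D : Set Pt} (hD : IsOpen D) {H : ℝ → ℝ → ℝ → ℝ} {A : ℝ → ℝ} {φ₀ : ℝ}
    (hH : ContDiffOn ℝ ∞ (fun x : Pt => H (x 0) (x 2) (x 3)) D)
    (hA : ContDiffOn ℝ ∞ (fun x : Pt => A (x 0 + φ₀)) D) :
    WaveData D (fun x => H (x 0) (x 2) (x 3)) fun x => A (x 0 + φ₀) where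
  isOpen := hD
  smooth_h := hH
  smooth_a := hA
  pd_h x hx := pd_eq_zero_of_line (differentiableAt_of_contDiffOn hD hH hx) fun t => by simp
  pd_a x hx μ hμ := pd_eq_zero_of_line (differentiableAt_of_contDiffOn hD hA hx) fun t => by
    simp [hμ.symm]

section

variable {D : Set Pt} {h a : Pt → ℝ} (w : WaveData D h a) {Φ : Fields} (hΦ : Φ.SmoothOn D)
  (hm : ∀ x ∈ D, (Φ.frame x).coordMetric = ppMetric (h x))

/-- The matrix of the change from the frame of `Φ` to the adapted frame. -/
def toAdapted (h : Pt → ℝ) (Φ : Fields) (x : Pt) : Matrix (Fin 4) (Fin 4) ℝ :=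
  (nullFrame (h x)).coframeMatrix * (ppMetric (h x))⁻¹ * (Φ.frame x).coframeMatrix.transpose *
    Matrix.of (Φ.g x)

/-- The matrix of the change from the adapted frame to the frame of `Φ`. -/
def ofAdapted (h : Pt → ℝ) (Φ : Fields) (x : Pt) : Matrix (Fin 4) (Fin 4) ℝ :=
  (Φ.frame x).coframeMatrix * (nullFrame (h x)).coframeMatrix⁻¹

/-- The fields `Φ` in the adapted frame. -/
def adapted (h : Pt → ℝ) (Φ : Fields) : Fields where
  g _ := nullMetric
  θ x := nullCoframe (h x)
  Γ x a b := oneForm fun μ => (toAdapted h Φ x * Φ.connMat x μ * ofAdapted h Φ x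
    + toAdapted h Φ x * pdM μ (ofAdapted h Φ) x) b a

include w hΦ hm

theorem gaugeRel_adapted : GaugeRel D (ofAdapted h Φ) (toAdapted h Φ) Φ (adapted h Φ) := by
  have hN : SmoothM D fun y => (nullFrame (h y)).coframeMatrix := fun i j => by
    have hc : ∀ c : ℝ, ContDiffOn ℝ ∞ (fun _ : Pt => c) D := fun c => contDiffOn_const
    simp only [nullFrame, Frame.coframeMatrix, nullCoframe, Matrix.of_apply, oneForm_apply]
    fin_cases i <;> fin_cases j <;> simp [hc]
    exact w.smooth_h.div_const 2
  have hN' : SmoothM D fun y => (nullFrame (h y)).coframeMatrix⁻¹ := fun i j => by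
    have hc : ∀ c : ℝ, ContDiffOn ℝ ∞ (fun _ : Pt => c) D := fun c => contDiffOn_const
    simp only [nullFrame.coframeMatrix_inv]
    fin_cases i <;> fin_cases j <;> simp [hc]
    exact w.smooth_h.neg.div_const 2
  have hp : SmoothM D fun y => (ppMetric (h y))⁻¹ := fun i j => by
    have hc : ∀ c : ℝ, ContDiffOn ℝ ∞ (fun _ : Pt => c) D := fun c => contDiffOn_const
    simp only [nullFrame.ppMetric_inv]
    fin_cases i <;> fin_cases j <;> simp [hc]
    exact w.smooth_h.neg
  have hg : SmoothM D fun y => Matrix.of (Φ.g y) := fun i j =>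
    contDiffOn_pi.mp (contDiffOn_pi.mp hΦ.1 i) j
  have hE : SmoothM D fun y => (Φ.frame y).coframeMatrix := fun i j =>
    contDiffOn_pi.mp (contDiffOn_pi.mp hΦ.2.1 i) ![j]
  have hE' : SmoothM D fun y => (Φ.frame y).coframeMatrix.transpose := fun i j => hE j i
  have hdet : ∀ y, IsUnit (nullFrame (h y)).coframeMatrix.det := fun y => by
    rw [nullFrame.coframeMatrix_det]; exact isUnit_one
  have hdp : ∀ y, IsUnit (ppMetric (h y)).det := fun y => by
    rw [nullFrame.ppMetric_det]; exact isUnit_one.neg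
  -- Because Eᵀ g E is the pp-wave metric, (pp metric)⁻¹ Eᵀ g is the inverse of the coframe matrix E
  -- on D. Written in this way it is visibly smooth.
  have hVE : ∀ x ∈ D, toAdapted h Φ x * (Φ.frame x).coframeMatrix
      = (nullFrame (h x)).coframeMatrix := by
    intro x hx
    have h1 := hm x hx
    rw [FrameRel.coordMetric_eq] at h1
    have h2 : (Φ.frame x).coframeMatrix.transpose *
        (Matrix.of (Φ.g x) * (Φ.frame x).coframeMatrix) = ppMetric (h x) := by
      rw [← mul_assoc]; exact h1
    rw [toAdapted, mul_assoc, mul_assoc, h2, mul_assoc, Matrix.nonsing_inv_mul _ (hdp x), mul_one]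
  have hVU : ∀ x ∈ D, toAdapted h Φ x * ofAdapted h Φ x = 1 := by
    intro x hx
    rw [ofAdapted, ← mul_assoc, hVE x hx, Matrix.mul_nonsing_inv _ (hdet x)]
  refine ⟨w.isOpen, hE.mul hN', ((hN.mul hp).mul hE').mul hg,
    fun x hx => mul_eq_one_comm.mp (hVU x hx), fun x hx i μ => ?_, fun x hx i j μ => ?_,
    fun x hx => ?_, fun x hx μ => ?_, fun x hx μ => rfl⟩
  · exact differentiableAt_of_contDiffOn w.isOpen (hE i μ) hx
  · exact differentiableAt_of_contDiffOn w.isOpen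
      (contDiffOn_pi.mp (contDiffOn_pi.mp (contDiffOn_pi.mp hΦ.2.2 i) j) ![μ]) hx
  · have h1 := hm x hx
    rw [← nullFrame.coordMetric, FrameRel.coordMetric_eq, FrameRel.coordMetric_eq] at h1
    have h2 : (nullFrame (h x)).coframeMatrix⁻¹.transpose *
        (nullFrame (h x)).coframeMatrix.transpose = 1 := by
      rw [← Matrix.transpose_mul, Matrix.mul_nonsing_inv _ (hdet x), Matrix.transpose_one]
    calc Matrix.of nullMetric
        = (nullFrame (h x)).coframeMatrix⁻¹.transpose *
          ((nullFrame (h x)).coframeMatrix.transpose * Matrix.of (nullFrame (h x)).g *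
            (nullFrame (h x)).coframeMatrix) * (nullFrame (h x)).coframeMatrix⁻¹ := by
          simp only [mul_assoc, Matrix.mul_nonsing_inv _ (hdet x), mul_one]
          rw [← mul_assoc, h2, one_mul]; rfl
      _ = _ := by
          rw [← h1, ofAdapted, Matrix.transpose_mul]
          simp only [mul_assoc]; rfl
  · ext i j
    have := congrFun (congrFun (hVE x hx) i) μ
    exact this.symm

/-- In the adapted frame Φ and `waveFields` share metric, coframe, nonmetricity and torsion, so the
difference of their connections satisfies the hypotheses of `connection_unique`. -/
theorem gaugeRel_waveFields (hQ : ∀ x ∈ D, ∀ i j, Φ.nonmetricity x i j = 0)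
    (hT : ∀ x ∈ D, ∀ i, Φ.torsion x i = (1 / 3 : ℝ) • interiorProd ((Φ.frame x).eUp i)
      ((Φ.frame x).star (rfl : 1 + 3 = 4) (a x • waveForm))) :
    GaugeRel D (ofAdapted h Φ) (toAdapted h Φ) Φ (waveFields h a) := by
  have hG := gaugeRel_adapted w hΦ hm
  suffices hΓ : ∀ x ∈ D, ∀ μ, (adapted h Φ).connMat x μ = (waveFields h a).connMat x μ from
    ⟨hG.isOpen, hG.smooth_U, hG.smooth_V, hG.inv, hG.diff_θ, hG.diff_Γ, hG.g, hG.θ,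
      fun x hx μ => by rw [← hΓ x hx]; exact hG.Γ x hx μ⟩
  intro x hx μ
  have hF := hG.frameRel hx
  have hT' : ∀ i, (adapted h Φ).torsion x i = (waveFields h a).torsion x i := by
    intro i
    have h1 : (adapted h Φ).torsion x i = ∑ j, toAdapted h Φ x i j • Φ.torsion x j := by
      refine Form.ext2 fun μ ν => ?_
      have := congrFun (congrFun (hG.torsion_matrix hx μ ν) i) 0
      simpa [Matrix.mul_apply] using this
    have h2 : (nullFrame (h x)).eUp i = ∑ j, toAdapted h Φ x i j • (Φ.frame x).eUp j := by
      have := hF.eUp i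
      simp only [scaleVec_one] at this
      exact this
    have h3 : (nullFrame (h x)).star (rfl : 1 + 3 = 4) (a x • waveForm)
      = (Φ.frame x).star (rfl : 1 + 3 = 4) (a x • waveForm) := hF.star_one_scale _ _
    have h4 : (waveFields h a).frame x = nullFrame (h x) := rfl
    rw [w.torsion hx, h4, h1, h2, h3, interiorProd_sum_left, Finset.smul_sum]
    refine Finset.sum_congr rfl fun j _ => ?_
    rw [hT x hx, interiorProd_smul_left, smul_comm]
  have hQ' : ∀ i j, (adapted h Φ).covD (adapted h Φ).g x i j
      = (waveFields h a).covD (waveFields h a).g x i j := by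
    intro i j
    have h1 : (waveFields h a).covD (waveFields h a).g x i j = 0 :=
      neg_eq_zero.mp (WaveData.nonmetricity i j)
    rw [h1]
    refine Form.ext1 fun μ => ?_
    have h2 := hG.covD_matrix hx hG.g (fun i j => differentiableAt_of_contDiffOn w.isOpen
      (contDiffOn_pi.mp (contDiffOn_pi.mp hΦ.1 i) j) hx) μ
    have h3 : (Matrix.of fun i j => Φ.covD Φ.g x i j ![μ]) = 0 := by
      ext i j
      have := neg_eq_zero.mp (hQ x hx i j)
      simp [this]
    rw [h3, mul_zero, zero_mul] at h2
    exact congrFun (congrFun h2 i) j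
  refine sub_eq_zero.mp (connection_unique (g := Matrix.of nullMetric)
    (E := (nullFrame (h x)).coframeMatrix) (E' := (nullFrame (h x)).coframeMatrix⁻¹)
    (Δ := fun μ => (adapted h Φ).connMat x μ - (waveFields h a).connMat x μ) ?_ ?_ ?_ ?_ ?_ μ)
  · ext i j; fin_cases i <;> fin_cases j <;> simp [nullMetric]
  · rw [nullFrame.det_g]; norm_num
  · exact Matrix.mul_nonsing_inv _ (by rw [nullFrame.coframeMatrix_det]; exact isUnit_one)
  · intro μ
    have h1 := (adapted h Φ).covD_matrix x μ (adapted h Φ).g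
    have h2 := (waveFields h a).covD_matrix x μ (waveFields h a).g
    simp only [hQ'] at h1
    have h3 := h1.symm.trans h2
    have h4 : (adapted h Φ).g = (waveFields h a).g := rfl
    have h5 : Matrix.of nullMetric = Matrix.of ((waveFields h a).g x) := rfl
    rw [h4] at h3
    rw [h5, Matrix.transpose_sub, sub_mul, mul_sub]
    rw [sub_sub, sub_sub, sub_right_inj] at h3
    rw [sub_add_sub_comm, h3, sub_self]
  · intro μ ν i
    have h1 := (adapted h Φ).torsion_matrix x μ ν
    have h2 := (waveFields h a).torsion_matrix x μ ν
    simp only [hT'] at h1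
    have h3 := h1.symm.trans h2
    have h4 : (adapted h Φ).coMat = (waveFields h a).coMat := rfl
    rw [h4, add_sub_assoc, add_sub_assoc, add_right_inj] at h3
    have h5 := congrFun (congrFun h3 i) 0
    simp only [Matrix.sub_apply, Matrix.mul_apply, sub_mul, Finset.sum_sub_distrib] at h5 ⊢
    have h6 : ∀ b ν, (waveFields h a).coMat x ν b 0 = (nullFrame (h x)).coframeMatrix b ν :=
      fun _ _ => rfl
    simp only [h6] at h5
    linarith

end

end
end MAG

namespace MAG
noncomputable section

/-! ### Parallel Ricci tensor -/

namespace WaveData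

variable {D : Set Pt} {h a : Pt → ℝ} (w : WaveData D h a)
include w

theorem differentiableAt_waveTrace {x : Pt} (hx : x ∈ D) : DifferentiableAt ℝ (waveTrace h a) x :=
  (((w.diff_a hx).pow 2).const_mul _).sub
    (((w.diff_pd_pd_h hx 2 2).add (w.diff_pd_pd_h hx 3 3)).const_mul _)

theorem ricci_eventuallyEq {x : Pt} (hx : x ∈ D) (i j : Fin 4) :
    (fun y => (waveFields h a).ricci y i j)
      =ᶠ[nhds x] fun y => if i = 0 ∧ j = 0 then waveTrace h a y else 0 :=
  Filter.eventually_of_mem (w.isOpen.mem_nhds hx) fun _ hy => w.ricci hy i j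

theorem differentiableAt_ricci : ∀ x ∈ D, ∀ i j,
    DifferentiableAt ℝ (fun y => (waveFields h a).ricci y i j) x := by
  intro x hx i j
  refine DifferentiableAt.congr_of_eventuallyEq ?_ (w.ricci_eventuallyEq hx i j)
  split_ifs
  · exact w.differentiableAt_waveTrace hx
  · exact differentiableAt_const _

/-- All connection terms contain some Γ_i^0 = 0: the wave covector is parallel, and only the
gradient of the trace remains. -/
theorem covD_ricci {x : Pt} (hx : x ∈ D) (i j μ : Fin 4) :
    (waveFields h a).covD (waveFields h a).ricci x i j ![μ]
      = if i = 0 ∧ j = 0 then pd μ (waveTrace h a) x else 0 := by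
  have h1 : gradForm (fun y => (waveFields h a).ricci y i j) x ![μ]
      = if i = 0 ∧ j = 0 then pd μ (waveTrace h a) x else 0 := by
    refine (pd_congr μ (w.ricci_eventuallyEq hx i j)).trans ?_
    split_ifs
    · rfl
    · exact pd_const _ _
  have h2 : ∀ i, (waveFields h a).Γ x i 0 = 0 := fun i => by
    fin_cases i <;> simp [waveFields, waveConn]
  simp only [Fields.covD, Pi.sub_apply, h1, w.ricci hx, Fin.sum_univ_four]
  simp [h2]

theorem ricciParallelOn_iff_pd : (waveFields h a).RicciParallelOn D ↔
    ∀ x ∈ D, ∀ μ, pd μ (waveTrace h a) x = 0 := by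
  refine ⟨fun hp x hx μ => ?_, fun hp x hx i j => Form.ext1 fun μ => ?_⟩
  · have := congrFun (hp x hx 0 0) ![μ]
    rw [w.covD_ricci hx] at this
    simpa using this
  · rw [w.covD_ricci hx, hp x hx]
    simp

theorem ricciParallelOn_iff (hD : IsPreconnected D) : (waveFields h a).RicciParallelOn D ↔
    ∃ C : ℝ, ∀ x ∈ D, transverseLaplacian h x = 1 / 9 * a x ^ 2 + C := by
  rw [w.ricciParallelOn_iff_pd]
  constructor
  · intro hp
    have hf : D.EqOn (fderiv ℝ (waveTrace h a)) 0 := fun x hx => by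
      refine ContinuousLinearMap.coe_injective (LinearMap.pi_ext' fun μ => ?_)
      refine LinearMap.ext_ring ?_
      simpa [pd] using hp x hx μ
    -- A preconnected set may be empty, and then there is no base point.
    rcases D.eq_empty_or_nonempty with rfl | ⟨x₀, hx₀⟩
    · exact ⟨0, fun x hx => hx.elim⟩
    -- The trace is a²/18 − ½ Δh; solving for Δh gives a²/9 minus twice the trace.
    refine ⟨-2 * waveTrace h a x₀, fun x hx => ?_⟩
    have := w.isOpen.is_const_of_fderiv_eq_zero hD
      (fun x hx => (w.differentiableAt_waveTrace hx).differentiableWithinAt) hf hx hx₀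
    rw [← this, waveTrace]
    ring
  · rintro ⟨C, hC⟩ x hx μ
    have : waveTrace h a =ᶠ[nhds x] fun _ => -(1 / 2) * C :=
      Filter.eventually_of_mem (w.isOpen.mem_nhds hx) fun y hy => by
        simp only [waveTrace, hC y hy]; ring
    rw [pd_congr μ this, pd_const]

end WaveData

end
end MAG

namespace MAG
noncomputable section

/-! ### The coframe equation -/

theorem hasDerivAt_zero_of_quadratic {F : ℝ → ℝ} {C ε₀ : ℝ} (hε₀ : 0 < ε₀)
    (hF : ∀ ε, |ε| ≤ ε₀ → |F ε| ≤ C * ε ^ 2) : HasDerivAt F 0 0 := by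
  have h0 : F 0 = 0 := by
    have := hF 0 (by simpa using hε₀.le)
    simpa using this
  rw [hasDerivAt_iff_isLittleO_nhds_zero]
  simp only [zero_add, h0, sub_zero, smul_zero]
  have hO : F =O[nhds 0] fun ε : ℝ => ε ^ 2 := by
    refine Asymptotics.IsBigO.of_bound C ?_
    filter_upwards [Metric.closedBall_mem_nhds (0 : ℝ) hε₀] with ε hε
    have : |ε| ≤ ε₀ := by simpa using hε
    simpa using hF ε this
  exact hO.trans_isLittleO (Asymptotics.isLittleO_pow_id one_lt_two)

theorem exists_common_bound {ι : Type*} [Finite ι] {K : Set Pt} (hK : IsCompact K)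
    {f : ι → Pt → ℝ} (hf : ∀ i, ContinuousOn (f i) K) : ∃ B > 0, ∀ x ∈ K, ∀ i, |f i x| ≤ B := by
  have := Fintype.ofFinite ι
  choose B hB using fun i => hK.exists_bound_of_continuousOn (hf i)
  refine ⟨1 + ∑ i, |B i|, by positivity, fun x hx i => ?_⟩
  have h1 := Finset.single_le_sum (f := fun i => |B i|) (fun i _ => abs_nonneg _) (Finset.mem_univ i)
  have h2 := hB i x hx
  rw [Real.norm_eq_abs] at h2
  have := le_abs_self (B i)

  linarith

namespace WaveData

variable {D : Set Pt} {h a : Pt → ℝ} (w : WaveData D h a)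

/-- The entries of the matrix `M`, where `R_0^i = R_i^1 = du ∧ M_ij dx^j`. -/
def curvEntry (h a : Pt → ℝ) : Fin 4 → Pt → ℝ :=
  ![fun x => 1 / 36 * a x ^ 2 - 1 / 2 * pd 2 (pd 2 h) x,
    fun x => 1 / 6 * pd 0 a x - 1 / 2 * pd 2 (pd 3 h) x,
    fun x => -(1 / 6 * pd 0 a x) - 1 / 2 * pd 2 (pd 3 h) x,
    fun x => 1 / 36 * a x ^ 2 - 1 / 2 * pd 3 (pd 3 h) x]

include w

theorem smooth_curvEntry (i : Fin 4) : ContDiffOn ℝ ∞ (curvEntry h a i) D := by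
  fin_cases i
  · exact (contDiffOn_const.mul (w.smooth_a.pow 2)).sub (contDiffOn_const.mul (w.smooth_pd_pd_h 2 2))
  · exact (contDiffOn_const.mul (w.smooth_pd_a 0)).sub (contDiffOn_const.mul (w.smooth_pd_pd_h 2 3))
  · exact (contDiffOn_const.mul (w.smooth_pd_a 0)).neg.sub
      (contDiffOn_const.mul (w.smooth_pd_pd_h 2 3))
  · exact (contDiffOn_const.mul (w.smooth_a.pow 2)).sub (contDiffOn_const.mul (w.smooth_pd_pd_h 3 3))

theorem curvature_eq {x : Pt} (hx : x ∈ D) : (waveFields h a).curvature x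
    = waveCurv (curvEntry h a 0 x) (curvEntry h a 1 x) (curvEntry h a 2 x) (curvEntry h a 3 x) :=
  w.curvature hx

theorem lagrangianDensity_eq_zero (P : StrongParams) {x : Pt} (hx : x ∈ D) :
    (waveFields h a).lagrangianDensity P x = 0 := by
  have hF : (waveFields h a).frame x = nullFrame (h x) := rfl
  rw [Fields.lagrangianDensity, strongLagrangian_top, w.curvature_eq hx, hF,
    strongForm_waveCurv_self, mul_zero]

/-- The Lagrangian of the wave itself is zero, and that of the perturbed coframe is at most a
multiple of ε², uniformly on the compact support of δ. The change of the action is hence O(ε²). -/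
theorem coframeEquation (P : StrongParams) : CoframeEquation P D (waveFields h a) := by
  intro δ hδ
  have hK : IsCompact (tsupport δ) := hδ.2.1
  simp only [Pi.zero_apply, wedge_zero_right]
  have hz : ∑ a : Fin 4, (0 : Form (1 + 3)).top = 0 := by simp [Form.top]
  rw [show (∫ x in D, ∑ a : Fin 4, (0 : Form (1 + 3)).top) = 0 by simp [hz]]
  have hδc : ∀ i μ, Continuous fun x => δ x i ![μ] := fun i μ =>
    (contDiff_pi.mp (contDiff_pi.mp hδ.1 i) ![μ]).continuous
  -- The index `none` stands for the profile h, `some i` for the entries of M.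
  obtain ⟨B₁, hB₁, hb₁⟩ := exists_common_bound hK (f := fun i : Option (Fin 4) =>
    i.elim h (curvEntry h a)) fun i => by
      rcases i with _ | i
      · exact w.smooth_h.continuousOn.mono hδ.2.2
      · exact (w.smooth_curvEntry i).continuousOn.mono hδ.2.2
  obtain ⟨B₂, hB₂, hb₂⟩ := exists_common_bound hK (f := fun (i : Fin 4 × Fin 4) x => δ x i.1 ![i.2])
    fun i => (hδc _ _).continuousOn
  obtain ⟨C, ε₀, hε₀, hC⟩ := coframe_variation_bound P (B := max B₁ B₂) (lt_max_of_lt_left hB₁)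
  refine hasDerivAt_zero_of_quadratic (C := |1 / (2 * P.ρ)| * C * MeasureTheory.volume.real (tsupport δ))
    hε₀ fun ε hε => ?_
  rw [MeasureTheory.setIntegral_eq_of_subset_of_forall_sdiff_eq_zero w.isOpen.measurableSet hδ.2.2]
  · have := MeasureTheory.norm_setIntegral_le_of_norm_le_const (μ := MeasureTheory.volume)
      (f := fun x => ((waveFields h a).addCoframe (ε • δ)).lagrangianDensity P x
        - (waveFields h a).lagrangianDensity P x) (s := tsupport δ)
      (C := |1 / (2 * P.ρ)| * (C * ε ^ 2)) hK.measure_lt_top fun x hx => ?_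
    · rw [Real.norm_eq_abs] at this
      refine this.trans (le_of_eq ?_)
      ring
    · have hxD := hδ.2.2 hx
      rw [w.lagrangianDensity_eq_zero P hxD, sub_zero, Fields.lagrangianDensity,
        strongLagrangian_top, Real.norm_eq_abs, abs_mul, abs_neg]
      refine mul_le_mul_of_nonneg_left ?_ (abs_nonneg _)
      have hcurv : ((waveFields h a).addCoframe (ε • δ)).curvature x
        = (waveFields h a).curvature x := rfl
      have hframe : ((waveFields h a).addCoframe (ε • δ)).frame x
        = ⟨nullMetric, nullCoframe (h x) + ε • δ x⟩ := rfl
      have hb : ∀ i, |curvEntry h a i x| ≤ max B₁ B₂ := fun i =>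
        (hb₁ x hx (some i)).trans (le_max_left _ _)
      rw [hcurv, hframe, w.curvature_eq hxD]
      exact hC ε hε _ _ _ _ _ _ ((hb₁ x hx none).trans (le_max_left _ _)) (hb 0) (hb 1) (hb 2) (hb 3)
        fun i μ => (hb₂ x hx (i, μ)).trans (le_max_right _ _)
  · intro x hx
    have h0 : δ x = 0 := image_eq_zero_of_notMem_tsupport hx.2
    have hframe : ((waveFields h a).addCoframe (ε • δ)).frame x = (waveFields h a).frame x := by
      simp [Fields.frame, Fields.addCoframe, h0]
    rw [Fields.lagrangianDensity, Fields.lagrangianDensity, hframe]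
    exact sub_self _

end WaveData

end
end MAG

namespace MAG
noncomputable section

/-! ### The first variation with respect to the connection is a divergence up to a multiple of `v₂` -/

/-- The current, linear in the variation `φ i j μ` of the connection, whose divergence appears in
the first variation of the Lagrangian. The curvature enters through `d = M_22 - M_33`,
`s = M_23 + M_32`, `m = M_23 - M_32` and `t = M_22 + M_33`. -/
def current (P : StrongParams) (d s m t : ℝ) (φ : Fin 4 → Fin 4 → Fin 4 → ℝ) : Fin 4 → ℝ :=
  ![t * (P.v₄ * φ 1 0 1),
    d * (P.w₁ * (φ 1 2 2 - φ 1 3 3 + φ 2 0 2 - φ 3 0 3))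
      + s * (P.w₁ * (φ 1 2 3 + φ 1 3 2 + φ 2 0 3 + φ 3 0 2))
      + m * (P.w₂ * (φ 1 2 3 - φ 1 3 2 + φ 2 0 3 - φ 3 0 2)
        + P.v₂ / 2 * (φ 1 2 3 - φ 1 3 2 - φ 2 0 3 + φ 3 0 2))
      + t * (P.w₄ * (φ 1 2 2 + φ 1 3 3 + φ 2 0 2 + φ 3 0 3)
        + P.v₄ / 2 * (φ 2 0 2 + φ 3 0 3 - φ 1 2 2 - φ 1 3 3) - P.v₄ * φ 1 0 0),
    d * (-P.w₁ * (φ 1 2 1 + φ 2 0 1)) + s * (-P.w₁ * (φ 1 3 1 + φ 3 0 1))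
      + m * (P.w₂ * (φ 1 3 1 + φ 3 0 1) + P.v₂ / 2 * (φ 1 3 1 - φ 3 0 1) + P.v₂ * φ 1 0 3)
      + t * (-P.w₄ * (φ 1 2 1 + φ 2 0 1) + P.v₄ / 2 * (φ 1 2 1 - φ 2 0 1)),
    d * (P.w₁ * (φ 1 3 1 + φ 3 0 1)) + s * (-P.w₁ * (φ 1 2 1 + φ 2 0 1))
      + m * (-P.w₂ * (φ 1 2 1 + φ 2 0 1) + P.v₂ / 2 * (φ 2 0 1 - φ 1 2 1) - P.v₂ * φ 1 0 2)
      + t * (-P.w₄ * (φ 1 3 1 + φ 3 0 1) + P.v₄ / 2 * (φ 1 3 1 - φ 3 0 1))]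

/-- By the product rule the two sides differ by derivatives of d, s, m, t. Those of t vanish, m
depends on u only and does not occur in the u component of the current, d and s do not depend on v,
and their transverse derivatives cancel by the Cauchy–Riemann type relations `ds` and `sd`. The
undifferentiated f φ_101 terms have signs −, +, +, − in M_12, M_13, M_20, M_30; they cancel in the
combinations multiplying w₁ and w₂, do not occur in those of w₄ and v₄, and add up to −2f in that of
v₂. -/
theorem divergence_current (P : StrongParams) {d s m t : Pt → ℝ}
    {φ : Fin 4 → Fin 4 → Fin 4 → Pt → ℝ} {x : Pt} (hd : DifferentiableAt ℝ d x)
    (hs : DifferentiableAt ℝ s x) (hm : DifferentiableAt ℝ m x) (ht : DifferentiableAt ℝ t x)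
    (hφ : ∀ i j κ, DifferentiableAt ℝ (φ i j κ) x)
    (d1 : pd 1 d x = 0) (s1 : pd 1 s x = 0) (ds : pd 2 d x = -pd 3 s x) (sd : pd 2 s x = pd 3 d x)
    (m0 : ∀ μ ≠ 0, pd μ m x = 0) (t0 : ∀ μ, pd μ t x = 0) (M : TwoForms) {f : ℝ}
    (h12 : ∀ ν ≠ 0, M 1 2 ![1, ν] = pd 1 (φ 1 2 ν) x - pd ν (φ 1 2 1) x
      - if ν = 3 then f * φ 1 0 1 x else 0)
    (h13 : ∀ ν ≠ 0, M 1 3 ![1, ν] = pd 1 (φ 1 3 ν) x - pd ν (φ 1 3 1) x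
      + if ν = 2 then f * φ 1 0 1 x else 0)
    (h20 : ∀ ν ≠ 0, M 2 0 ![1, ν] = pd 1 (φ 2 0 ν) x - pd ν (φ 2 0 1) x
      + if ν = 3 then f * φ 1 0 1 x else 0)
    (h30 : ∀ ν ≠ 0, M 3 0 ![1, ν] = pd 1 (φ 3 0 ν) x - pd ν (φ 3 0 1) x
      - if ν = 2 then f * φ 1 0 1 x else 0)
    (h10 : M 1 0 ![2, 3] = pd 2 (φ 1 0 3) x - pd 3 (φ 1 0 2) x)
    (h10' : M 1 0 ![0, 1] = pd 0 (φ 1 0 1) x - pd 1 (φ 1 0 0) x) :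
    P.w₁ * (d x * (M 1 2 ![1, 2] - M 1 3 ![1, 3] + M 2 0 ![1, 2] - M 3 0 ![1, 3])
        + s x * (M 1 2 ![1, 3] + M 1 3 ![1, 2] + M 2 0 ![1, 3] + M 3 0 ![1, 2]))
      + P.w₂ * (m x * (M 1 2 ![1, 3] - M 1 3 ![1, 2] + M 2 0 ![1, 3] - M 3 0 ![1, 2]))
      + P.w₄ * (t x * (M 1 2 ![1, 2] + M 1 3 ![1, 3] + M 2 0 ![1, 2] + M 3 0 ![1, 3]))
      + P.v₂ * (m x * (M 1 0 ![2, 3] + (M 1 2 ![1, 3] - M 1 3 ![1, 2] - M 2 0 ![1, 3]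
        + M 3 0 ![1, 2]) / 2))
      + P.v₄ * (t x * (M 1 0 ![0, 1] + (-M 1 2 ![1, 2] - M 1 3 ![1, 3] + M 2 0 ![1, 2]
        + M 3 0 ![1, 3]) / 2))
    = ∑ μ, pd μ (fun y => current P (d y) (s y) (m y) (t y) (fun i j κ => φ i j κ y) μ) x
      - 2 * P.v₂ * (m x * f * φ 1 0 1 x) := by
  rw [Fin.sum_univ_four]
  simp only [current, Matrix.cons_val]
  simp (disch := fun_prop) only [pd_add, pd_sub, pd_mul, pd_const]
  rw [h12 2 (by decide), h12 3 (by decide), h13 2 (by decide),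
    h13 3 (by decide), h20 2 (by decide), h20 3 (by decide), h30 2 (by decide),
    h30 3 (by decide), h10, h10', d1, s1, ds, sd, m0 1 (by decide), m0 2 (by decide),
    m0 3 (by decide), t0, t0, t0, t0]
  simp only [if_true, show (2 : Fin 4) ≠ 3 by decide, show (3 : Fin 4) ≠ 2 by decide, if_false]
  ring

end
end MAG

namespace MAG
noncomputable section

/-! ### Integrals over the domain -/

section integrals

open MeasureTheory

variable {D K : Set Pt}

theorem integrableOn_of_eq_zero_off {f : Pt → ℝ} (hD : IsOpen D) (hK : IsCompact K) (hKD : K ⊆ D)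
    (hf : ContinuousOn f D) (h0 : ∀ x ∈ D \ K, f x = 0) : IntegrableOn f D :=
  ((hf.mono hKD).integrableOn_compact hK).of_forall_sdiff_eq_zero hD.measurableSet h0

theorem integral_pd_eq_zero {J : Pt → ℝ} (hJ : IsVariation D J) (μ : Fin 4) :
    ∫ x in D, pd μ J x = 0 := by
  have hc : Continuous (pd μ J) := (hJ.1.continuous_fderiv (by simp)).clm_apply continuous_const
  have hsub : tsupport (fderiv ℝ J) ⊆ tsupport J := tsupport_fderiv_subset ℝ
  have h0 : ∀ x ∉ tsupport J, pd μ J x = 0 := fun x hx => by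
    rw [pd, image_eq_zero_of_notMem_tsupport fun h => hx (hsub h)]; rfl
  rw [setIntegral_eq_integral_of_forall_compl_eq_zero fun x hx => h0 x fun h => hx (hJ.2.2 h)]
  have hi : Integrable (pd μ J) := hc.integrable_of_hasCompactSupport
    (HasCompactSupport.intro hJ.2.1 h0)
  have hi' : Integrable J := hJ.1.continuous.integrable_of_hasCompactSupport hJ.2.1
  -- Integration by parts against the constant function 1.
  have := integral_mul_fderiv_eq_neg_fderiv_mul_of_integrable (μ := volume) (f := fun _ : Pt => (1 : ℝ))
    (g := J) (v := Pi.single μ 1) (by simp) (by simp only [one_mul]; exact hi) (by simpa using hi')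
    (fun _ _ => differentiableAt_const _) fun x _ => hJ.1.differentiable (by simp) x
  simpa [pd] using this

/-- The integrand is a polynomial in ε without constant term, `l k` being the coefficient of
ε^(k+1). The integral is then a polynomial too, and no dominated convergence is needed. -/
theorem hasDerivAt_integral_polynomial {n : ℕ} {f : ℝ → Pt → ℝ} {l : Fin (n + 1) → Pt → ℝ}
    (hD : IsOpen D) (hl : ∀ k, IntegrableOn (l k) D)
    (hf : ∀ ε, ∀ x ∈ D, f ε x = ∑ k : Fin (n + 1), ε ^ ((k : ℕ) + 1) * l k x) :
    HasDerivAt (fun ε => ∫ x in D, f ε x) (∫ x in D, l 0 x) 0 := by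
  have h1 : (fun ε => ∫ x in D, f ε x)
      = fun ε => ∑ k : Fin (n + 1), ε ^ ((k : ℕ) + 1) * ∫ x in D, l k x := by
    funext ε
    rw [setIntegral_congr_fun hD.measurableSet (hf ε), integral_finsetSum _ fun k _ =>
      (hl k).const_mul _]
    simp only [integral_const_mul]
  rw [h1]
  have h2 := HasDerivAt.fun_sum (u := Finset.univ) (x := (0 : ℝ))
    (A := fun (k : Fin (n + 1)) ε => ε ^ ((k : ℕ) + 1) * ∫ x in D, l k x)
    fun k _ => (hasDerivAt_pow ((k : ℕ) + 1) (0 : ℝ)).mul_const _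
  refine h2.congr_deriv ?_
  rw [Fin.sum_univ_succ]
  simp

end integrals

/-! ### Expansion of the curvature -/

/-- The linear part of the change of the curvature under a change of the connection. -/
def linCurv (Γ : Fin 4 → Fin 4 → Form 1) (δ : Pt → Fin 4 → Fin 4 → Form 1) (x : Pt) : TwoForms :=
  fun a b => extd (fun y => δ y a b) x
    + ∑ c, ((wedge (Γ c b) (δ x a c) : Form 2) + wedge (δ x c b) (Γ a c))

/-- The quadratic part of the change of the curvature under a change of the connection. -/
def quadCurv (δ : Fin 4 → Fin 4 → Form 1) : TwoForms := fun a b =>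
  ∑ c, (wedge (δ c b) (δ a c) : Form 2)

/-- The expansion is nested as ε • (ε • Q + L) + R to match the shape c • M + N of the linearity
lemmas. -/
theorem Fields.curvature_addConnection {Φ : Fields} {δ : Pt → Fin 4 → Fin 4 → Form 1} {x : Pt}
    (hΓ : ∀ a b μ, DifferentiableAt ℝ (fun y => Φ.Γ y a b ![μ]) x)
    (hδ : ∀ a b μ, DifferentiableAt ℝ (fun y => δ y a b ![μ]) x) (ε : ℝ) :
    (Φ.addConnection (ε • δ)).curvature x
      = ε • (ε • quadCurv (δ x) + linCurv (Φ.Γ x) δ x) + Φ.curvature x := by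
  funext a b
  have h1 : extd (fun y => (Φ.addConnection (ε • δ)).Γ y a b) x
      = extd (fun y => Φ.Γ y a b) x + ε • extd (fun y => δ y a b) x := by
    refine Form.ext2 fun μ ν => ?_
    have h2 : ∀ μ ν, pd μ (fun y => (Φ.addConnection (ε • δ)).Γ y a b ![ν]) x
        = pd μ (fun y => Φ.Γ y a b ![ν]) x + ε * pd μ (fun y => δ y a b ![ν]) x := fun μ ν => by
      rw [← pd_const_mul μ ε (hδ a b ν), ← pd_add μ (hΓ a b ν) ((hδ a b ν).const_mul ε)]
      rfl
    rw [extd_one, Pi.add_apply, Pi.smul_apply, extd_one, extd_one, h2, h2, smul_eq_mul]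
    ring
  have h3 : ∀ c, (wedge ((Φ.addConnection (ε • δ)).Γ x c b) ((Φ.addConnection (ε • δ)).Γ x a c) : Form 2)
      = wedge (Φ.Γ x c b) (Φ.Γ x a c)
        + ε • ((wedge (Φ.Γ x c b) (δ x a c) : Form 2) + wedge (δ x c b) (Φ.Γ x a c))
        + (ε * ε) • wedge (δ x c b) (δ x a c) := fun c => by
    have h4 : ∀ a b, (Φ.addConnection (ε • δ)).Γ x a b = Φ.Γ x a b + ε • δ x a b := fun _ _ => rfl
    rw [h4, h4, wedge_add_left, wedge_add_right, wedge_add_right, wedge_smul_left, wedge_smul_left,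
      wedge_smul_right, wedge_smul_right]
    module
  rw [Fields.curvature, h1]
  simp only [h3, Finset.sum_add_distrib, ← Finset.smul_sum]
  simp only [Pi.add_apply, Pi.smul_apply, linCurv, quadCurv, Fields.curvature,
    Finset.sum_add_distrib]
  module

theorem linCurv_antisymm (Γ : Fin 4 → Fin 4 → Form 1) (δ : Pt → Fin 4 → Fin 4 → Form 1) (x : Pt)
    (i j μ ν : Fin 4) : linCurv Γ δ x i j ![ν, μ] = -linCurv Γ δ x i j ![μ, ν] := by
  have hw : ∀ (α β : Form 1) μ ν, (wedge α β : Form (1 + 1)) ![μ, ν]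
    = α ![μ] * β ![ν] - α ![ν] * β ![μ] := wedge_one_one
  simp only [linCurv, Pi.add_apply, Finset.sum_apply, extd_one]
  rw [neg_add, ← Finset.sum_neg_distrib]
  congr 1
  · ring
  · refine Finset.sum_congr rfl fun c _ => ?_
    rw [wedge_one_one, wedge_one_one, hw, hw]; ring

theorem linCurv_waveConn (s t f : ℝ) (δ : Pt → Fin 4 → Fin 4 → Form 1) (x : Pt) (i j μ ν : Fin 4) :
    linCurv (waveConn s t f) δ x i j ![μ, ν]
      = pd μ (fun y => δ y i j ![ν]) x - pd ν (fun y => δ y i j ![μ]) x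
        + ∑ c, (waveConn s t f c j ![μ] * δ x i c ![ν] - waveConn s t f c j ![ν] * δ x i c ![μ]
          + (δ x c j ![μ] * waveConn s t f i c ![ν] - δ x c j ![ν] * waveConn s t f i c ![μ])) := by
  have hw : ∀ (α β : Form 1) μ ν, (wedge α β : Form (1 + 1)) ![μ, ν]
    = α ![μ] * β ![ν] - α ![ν] * β ![μ] := wedge_one_one
  simp only [linCurv, Pi.add_apply, Finset.sum_apply, extd_one]
  congr 1
  refine Finset.sum_congr rfl fun c _ => ?_
  rw [wedge_one_one, hw]

/-- The linear part contains derivatives of δ, so vanishing of δ at the point would not suffice; off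
the closed support δ vanishes in a neighbourhood. -/
theorem linCurv_eq_zero {Γ : Fin 4 → Fin 4 → Form 1} {δ : Pt → Fin 4 → Fin 4 → Form 1} {x : Pt}
    (hx : x ∉ tsupport δ) : linCurv Γ δ x = 0 := by
  have h0 : δ =ᶠ[nhds x] 0 := notMem_tsupport_iff_eventuallyEq.mp hx
  refine TwoForms.ext fun i j μ ν => ?_
  have hx0 : δ x = 0 := h0.eq_of_nhds
  have h1 : ∀ μ ν, pd μ (fun y => δ y i j ![ν]) x = 0 := fun μ ν => by
    rw [pd_congr μ (g := fun _ => 0) (h0.mono fun y hy => by simp [hy]), pd_const]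
  have h2 : ∀ a b, δ x a b = 0 := fun a b => by rw [hx0]; rfl
  simp only [linCurv, Pi.add_apply, extd_one, h1, h2, wedge_zero_left, wedge_zero_right]
  simp

end
end MAG

namespace MAG
noncomputable section

/-! ### The connection equation -/

theorem strongForm_polynomial (P : StrongParams) (F : Frame) (R L Q : TwoForms) (ε : ℝ) :
    strongForm P F (ε • (ε • Q + L) + R) (ε • (ε • Q + L) + R) = strongForm P F R R
      + (ε * (strongForm P F R L + strongForm P F L R)
      + ε ^ 2 * (strongForm P F R Q + strongForm P F Q R + strongForm P F L L)
      + ε ^ 3 * (strongForm P F L Q + strongForm P F Q L) + ε ^ 4 * strongForm P F Q Q) := by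
  simp only [strongForm_lin_left, strongForm_lin_right]
  ring

theorem strongForm_zero_left (P : StrongParams) (F : Frame) (S : TwoForms) :
    strongForm P F 0 S = 0 := by
  simpa using strongForm_lin_left P F (-1) 0 0 S

theorem strongForm_zero_right (P : StrongParams) (F : Frame) (S : TwoForms) :
    strongForm P F S 0 = 0 := by
  simpa using strongForm_lin_right P F (-1) S 0 0

/-- In the null frame k^a is nonzero only for a = 1 and k_b only for b = 0, and α ∧ ⋆k picks out
α(∂_v), as ∂_v is the vector dual to k. -/
theorem wedge_kUp_kLow_top (h c : ℝ) (δ : Fin 4 → Fin 4 → Form 1) :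
    ∑ a, ∑ b, (wedge (δ a b) (c • (((nullFrame h).kUp a * (nullFrame h).kLow b) •
      (nullFrame h).star (rfl : 1 + 3 = 4) waveForm)) : Form 4).top = c * δ 1 0 ![1] := by
  have hlow : ∀ b, (nullFrame h).kLow b = if b = 0 then 1 else 0 := fun b => by
    rw [Frame.kLow, interiorProd_one, nullFrame.e]
    fin_cases b <;> simp [waveForm]
  have hup : ∀ a, (nullFrame h).kUp a = if a = 1 then 1 else 0 := fun a => by
    simp only [Frame.kUp, hlow, nullFrame.gInv]
    fin_cases a <;> simp [nullMetric]
  have hS : ∀ κ l m, ((nullFrame h).star (rfl : 1 + 3 = 4) waveForm) ![κ, l, m] = leviInt 1 κ l m :=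
    star_waveForm (nullFrame.coordMetric h)
  have hw : ∀ α : Form 1, (wedge α ((nullFrame h).star (rfl : 1 + 3 = 4) waveForm) : Form 4).top
      = α ![1] := fun α => by
    rw [wedge_one_three_top _ _ (fun μ ν κ => ?_) fun μ ν κ => ?_, hS, hS, hS, hS]
    · have s2 : Int.sign 2 = 1 := rfl
      have s3 : Int.sign 3 = 1 := rfl
      simp [leviInt, s2, s3]
    · rw [hS, hS]
      have : ∀ a b c : Fin 4, leviInt 1 b a c = - leviInt 1 a b c := by decide
      rw [this]; push_cast; rfl
    · rw [hS, hS]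
      have : ∀ a b c : Fin 4, leviInt 1 a c b = - leviInt 1 a b c := by decide
      rw [this]; push_cast; rfl
  have ht : ∀ (r : ℝ) (α : Form (1 + 3)), Form.top (r • α) = r * Form.top α := fun _ _ => rfl
  simp only [wedge_smul_right, ht, hw, hup, hlow]
  simp

theorem continuous_quadCurv {δ : Pt → Fin 4 → Fin 4 → Form 1} (hδ : ContDiff ℝ ∞ δ) :
    Continuous fun x => quadCurv (δ x) := by
  have hδ' : ∀ i j, Continuous fun x => δ x i j := fun i j =>
    (continuous_apply j).comp ((continuous_apply i).comp hδ.continuous)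
  exact continuous_pi fun i => continuous_pi fun j => continuous_finsetSum _ fun c _ =>
    continuous_wedge (hδ' _ _) (hδ' _ _)

namespace WaveData

variable {D : Set Pt} {h a : Pt → ℝ} (w : WaveData D h a)
include w

theorem continuousOn_strongForm (P : StrongParams) {R S : Pt → TwoForms} (hR : ContinuousOn R D)
    (hS : ContinuousOn S D) :
    ContinuousOn (fun x => strongForm P (nullFrame (h x)) (R x) (S x)) D := by
  rw [continuousOn_iff_continuous_domRestrict] at hR hS ⊢
  have hh : Continuous fun x : D => h x :=
    continuousOn_iff_continuous_domRestrict.mp w.smooth_h.continuousOn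
  have hF : ContFrame fun x : D => (⟨nullMetric, nullCoframe (h x)⟩ : Frame) := by
    refine contFrame_of_coframe nullMetric (by rw [nullFrame.det_g]; norm_num) ?_ fun x => ?_
    · refine continuous_pi fun i => continuous_pi fun k => ?_
      simp only [nullCoframe, oneForm]
      generalize k 0 = μ
      fin_cases i <;> fin_cases μ <;> simp <;>
        first | exact continuous_const | exact hh.div_const 2
    · have := nullFrame.coframeMatrix_det (h x)
      rw [nullFrame] at this
      simp [this]
  exact hF.strongForm hR P hS

theorem continuousOn_curvature : ContinuousOn (waveFields h a).curvature D := by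
  have hc : ∀ i, Continuous fun x : D => curvEntry h a i x := fun i =>
    continuousOn_iff_continuous_domRestrict.mp (w.smooth_curvEntry i).continuousOn
  have : ContinuousOn (fun x => waveCurv (curvEntry h a 0 x) (curvEntry h a 1 x)
      (curvEntry h a 2 x) (curvEntry h a 3 x)) D :=
    continuousOn_iff_continuous_domRestrict.mpr
      (continuous_waveCurv (hc 0) (hc 1) (hc 2) (hc 3))
  exact this.congr fun x hx => w.curvature_eq hx

theorem continuousOn_Γ : ContinuousOn (waveFields h a).Γ D := by
  refine continuousOn_pi.mpr fun i => continuousOn_pi.mpr fun j => continuousOn_pi.mpr fun k => ?_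
  have hk : k = ![k 0] := by ext m; fin_cases m; rfl
  rw [hk]
  exact fun x hx => (w.diff_Γ hx i j (k 0)).continuousAt.continuousWithinAt

theorem continuousOn_linCurv {δ : Pt → Fin 4 → Fin 4 → Form 1} (hδ : ContDiff ℝ ∞ δ) :
    ContinuousOn (fun x => linCurv ((waveFields h a).Γ x) δ x) D := by
  have hΓ := continuousOn_iff_continuous_domRestrict.mp w.continuousOn_Γ
  have hc : Continuous fun x : D => δ x := hδ.continuous.comp continuous_subtype_val
  rw [continuousOn_iff_continuous_domRestrict]
  refine continuous_pi fun i => continuous_pi fun j => ?_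
  have hΓ' : ∀ i j, Continuous fun x : D => (waveFields h a).Γ x i j := fun i j =>
    (continuous_apply j).comp ((continuous_apply i).comp hΓ)
  have hδ' : ∀ i j, Continuous fun x : D => δ x i j := fun i j =>
    (continuous_apply j).comp ((continuous_apply i).comp hc)
  refine Continuous.add ?_ (continuous_finsetSum _ fun c _ =>
    (continuous_wedge (hΓ' _ _) (hδ' _ _)).add (continuous_wedge (hδ' _ _) (hΓ' _ _)))
  refine continuous_pi fun k => ?_
  simp only [extd, pd]
  refine continuous_finsetSum _ fun l _ => continuous_const.mul ?_
  have hs : ContDiff ℝ ∞ fun y => δ y i j fun m => k (l.succAbove m) :=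
    contDiff_pi.mp (contDiff_pi.mp (contDiff_pi.mp hδ i) j) _
  exact ((hs.continuous_fderiv (by simp)).clm_apply continuous_const).comp continuous_subtype_val

/-- The derivative of the action along a variation of the connection. -/
theorem hasDerivAt_action (P : StrongParams) {δ : Pt → Fin 4 → Fin 4 → Form 1}
    (hδ : IsVariation D δ) :
    HasDerivAt (fun ε : ℝ => ∫ x in D, (((waveFields h a).addConnection (ε • δ)).lagrangianDensity P x
        - (waveFields h a).lagrangianDensity P x))
      (∫ x in D, -(1 / (2 * P.ρ)) *
        (strongForm P (nullFrame (h x)) ((waveFields h a).curvature x)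
            (linCurv ((waveFields h a).Γ x) δ x)
          + strongForm P (nullFrame (h x)) (linCurv ((waveFields h a).Γ x) δ x)
            ((waveFields h a).curvature x))) 0 := by
  have hR := w.continuousOn_curvature
  have hL := w.continuousOn_linCurv hδ.1
  have hQ := (continuous_quadCurv hδ.1).continuousOn (s := D)
  let q : (Pt → TwoForms) → (Pt → TwoForms) → Pt → ℝ := fun R S x =>
    strongForm P (nullFrame (h x)) (R x) (S x)
  let R := (waveFields h a).curvature
  let L := fun x => linCurv ((waveFields h a).Γ x) δ x
  let Q := fun x => quadCurv (δ x)
  have hq : ∀ {R S}, ContinuousOn R D → ContinuousOn S D → ContinuousOn (q R S) D :=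
    fun hR hS => w.continuousOn_strongForm P hR hS
  have hL0 : ∀ x ∈ D \ tsupport δ, L x = 0 := fun x hx => linCurv_eq_zero hx.2
  have hQ0 : ∀ x ∈ D \ tsupport δ, Q x = 0 := fun x hx => by
    have h0 : δ x = 0 := image_eq_zero_of_notMem_tsupport hx.2
    have h1 : ∀ a b, δ x a b = 0 := fun a b => by rw [h0]; rfl
    funext a b
    simp only [Q, quadCurv, h1, wedge_zero_left]
    simp
  have hi : ∀ {f : Pt → ℝ}, ContinuousOn f D → (∀ x ∈ D \ tsupport δ, f x = 0) →
      MeasureTheory.IntegrableOn (fun x => -(1 / (2 * P.ρ)) * f x) D := fun hf h0 =>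
    (integrableOn_of_eq_zero_off w.isOpen hδ.2.1 hδ.2.2 hf h0).const_mul _
  refine hasDerivAt_integral_polynomial (n := 3) (l := ![
    fun x => -(1 / (2 * P.ρ)) * (q R L x + q L R x),
    fun x => -(1 / (2 * P.ρ)) * (q R Q x + q Q R x + q L L x),
    fun x => -(1 / (2 * P.ρ)) * (q L Q x + q Q L x),
    fun x => -(1 / (2 * P.ρ)) * q Q Q x]) w.isOpen (fun k => ?_) fun ε x hx => ?_
  · fin_cases k
    · exact hi ((hq hR hL).add (hq hL hR)) fun x hx => by
        simp only [q, hL0 x hx, strongForm_zero_left, strongForm_zero_right, add_zero]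
    · exact hi (((hq hR hQ).add (hq hQ hR)).add (hq hL hL)) fun x hx => by
        simp only [q, hL0 x hx, hQ0 x hx, strongForm_zero_left, strongForm_zero_right, add_zero]
    · exact hi ((hq hL hQ).add (hq hQ hL)) fun x hx => by
        simp only [q, hL0 x hx, strongForm_zero_left, strongForm_zero_right, add_zero]
    · exact hi (hq hQ hQ) fun x hx => by
        simp only [q, hQ0 x hx, strongForm_zero_left]
  · have hδd : ∀ i j μ, DifferentiableAt ℝ (fun y => δ y i j ![μ]) x := fun i j μ =>
      (contDiff_pi.mp (contDiff_pi.mp (contDiff_pi.mp hδ.1 i) j) ![μ]).differentiable (by simp) x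
    have hF : ((waveFields h a).addConnection (ε • δ)).frame x = nullFrame (h x) := rfl
    have hF' : (waveFields h a).frame x = nullFrame (h x) := rfl
    rw [Fields.lagrangianDensity, Fields.lagrangianDensity, strongLagrangian_top,
      strongLagrangian_top, hF, hF', Fields.curvature_addConnection (w.diff_Γ hx) hδd,
      strongForm_polynomial, Fin.sum_univ_four]
    simp only [q, R, L, Q, Matrix.cons_val]
    norm_num
    ring

end WaveData

end
end MAG

/-! ### The first variation with respect to the connection. -/

namespace MAG
noncomputable section

section

variable (s t f : ℝ) (δ : Pt → Fin 4 → Fin 4 → Form 1) (x : Pt)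

/-- The connection has no dv component, and for ν ≠ 0 its du components do not enter. What remains
are the dx and dy components ± f, coming from the torsion. -/
theorem linCurv_one_two {ν : Fin 4} (hν : ν ≠ 0) : linCurv (waveConn s t f) δ x 1 2 ![1, ν]
    = pd 1 (fun y => δ y 1 2 ![ν]) x - pd ν (fun y => δ y 1 2 ![1]) x
      - if ν = 3 then f * δ x 1 0 ![1] else 0 := by
  rw [linCurv_waveConn, sub_eq_add_neg (_ - _)]
  congr 1
  rw [Fin.sum_univ_four]
  fin_cases ν <;> simp [waveConn] at hν ⊢

theorem linCurv_one_three {ν : Fin 4} (hν : ν ≠ 0) : linCurv (waveConn s t f) δ x 1 3 ![1, ν]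
    = pd 1 (fun y => δ y 1 3 ![ν]) x - pd ν (fun y => δ y 1 3 ![1]) x
      + if ν = 2 then f * δ x 1 0 ![1] else 0 := by
  rw [linCurv_waveConn]
  congr 1
  rw [Fin.sum_univ_four]
  fin_cases ν <;> simp [waveConn] at hν ⊢

theorem linCurv_two_zero {ν : Fin 4} (hν : ν ≠ 0) : linCurv (waveConn s t f) δ x 2 0 ![1, ν]
    = pd 1 (fun y => δ y 2 0 ![ν]) x - pd ν (fun y => δ y 2 0 ![1]) x
      + if ν = 3 then f * δ x 1 0 ![1] else 0 := by
  rw [linCurv_waveConn]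
  congr 1
  rw [Fin.sum_univ_four]
  fin_cases ν <;> simp [waveConn, mul_comm] at hν ⊢

theorem linCurv_three_zero {ν : Fin 4} (hν : ν ≠ 0) : linCurv (waveConn s t f) δ x 3 0 ![1, ν]
    = pd 1 (fun y => δ y 3 0 ![ν]) x - pd ν (fun y => δ y 3 0 ![1]) x
      - if ν = 2 then f * δ x 1 0 ![1] else 0 := by
  rw [linCurv_waveConn, sub_eq_add_neg (_ - _)]
  congr 1
  rw [Fin.sum_univ_four]
  fin_cases ν <;> simp [waveConn, mul_comm] at hν ⊢

theorem linCurv_one_zero (μ ν : Fin 4) : linCurv (waveConn s t f) δ x 1 0 ![μ, ν]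
    = pd μ (fun y => δ y 1 0 ![ν]) x - pd ν (fun y => δ y 1 0 ![μ]) x := by
  rw [linCurv_waveConn]
  simp [waveConn, Fin.sum_univ_four]

end

namespace WaveData

variable {D : Set Pt} {h a : Pt → ℝ} (w : WaveData D h a)
include w

theorem isVariation_current (P : StrongParams) {d s m t : Pt → ℝ} (hd : ContDiffOn ℝ ∞ d D)
    (hs : ContDiffOn ℝ ∞ s D) (hm : ContDiffOn ℝ ∞ m D) (ht : ContDiffOn ℝ ∞ t D)
    {δ : Pt → Fin 4 → Fin 4 → Form 1} (hδ : IsVariation D δ) (μ : Fin 4) :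
    IsVariation D fun x => current P (d x) (s x) (m x) (t x) (fun i j κ => δ x i j ![κ]) μ := by
  have hφ : ∀ i j κ, ContDiffOn ℝ ∞ (fun x => δ x i j ![κ]) D := fun i j κ =>
    (contDiff_pi.mp (contDiff_pi.mp (contDiff_pi.mp hδ.1 i) j) ![κ]).contDiffOn
  refine hδ.of_contDiffOn w.isOpen ?_ fun x hx => ?_
  · fin_cases μ <;> simp only [current, Fin.zero_eta, Fin.mk_one, Fin.reduceFinMk, Matrix.cons_val] <;>
      fun_prop
  · simp only [hx]
    fin_cases μ <;> simp [current]

/-- The first variation of the action with respect to the connection. -/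
theorem integral_first_variation (P : StrongParams) (hpar : (waveFields h a).RicciParallelOn D)
    {δ : Pt → Fin 4 → Fin 4 → Form 1} (hδ : IsVariation D δ) :
    ∫ x in D, -(1 / (2 * P.ρ)) *
        (strongForm P (nullFrame (h x)) ((waveFields h a).curvature x)
            (linCurv ((waveFields h a).Γ x) δ x)
          + strongForm P (nullFrame (h x)) (linCurv ((waveFields h a).Γ x) δ x)
            ((waveFields h a).curvature x))
      = ∫ x in D, 1 / (18 * P.ρ) * (P.v₂ * a x * pd 0 a x) * δ x 1 0 ![1] := by
  -- The combinations M_22 − M_33, M_23 + M_32 and M_23 − M_32 of the curvature matrix; in the first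
  -- the 𝒜² terms cancel, in the second the 𝒜' terms.
  let d : Pt → ℝ := fun x => -(1 / 2) * (pd 2 (pd 2 h) x - pd 3 (pd 3 h) x)
  let s : Pt → ℝ := fun x => -1 * pd 2 (pd 3 h) x
  let m : Pt → ℝ := fun x => 1 / 3 * pd 0 a x
  have hds : ContDiffOn ℝ ∞ d D :=
    contDiffOn_const.mul ((w.smooth_pd_pd_h 2 2).sub (w.smooth_pd_pd_h 3 3))
  have hss : ContDiffOn ℝ ∞ s D := contDiffOn_const.mul (w.smooth_pd_pd_h 2 3)
  have hms : ContDiffOn ℝ ∞ m D := contDiffOn_const.mul (w.smooth_pd_a 0)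
  have hts : ContDiffOn ℝ ∞ (waveTrace h a) D :=
    (contDiffOn_const.mul (w.smooth_a.pow 2)).sub
      (contDiffOn_const.mul ((w.smooth_pd_pd_h 2 2).add (w.smooth_pd_pd_h 3 3)))
  let J : Fin 4 → Pt → ℝ := fun μ x =>
    current P (d x) (s x) (m x) (waveTrace h a x) (fun i j κ => δ x i j ![κ]) μ
  have hJ : ∀ μ, IsVariation D (J μ) := w.isVariation_current P hds hss hms hts hδ
  have hcomm : ∀ x ∈ D, ∀ μ ν κ, pd μ (pd ν (pd κ h)) x = pd ν (pd μ (pd κ h)) x :=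
    fun x hx μ ν κ => pd_comm μ ν
      (mod_cast contDiffAt_infty.mp ((w.smooth_pd_h κ).contDiffAt (w.isOpen.mem_nhds hx)) 2)
  have hcomm' : ∀ x ∈ D, ∀ μ ν κ, pd μ (pd ν (pd κ h)) x = pd μ (pd κ (pd ν h)) x :=
    fun x hx μ ν κ => pd_congr μ (Filter.eventually_of_mem (w.isOpen.mem_nhds hx)
      fun y hy => w.pd_pd_h hy ν κ)
  have hv : ∀ x ∈ D, ∀ ν κ, pd 1 (pd ν (pd κ h)) x = 0 := fun x hx ν κ => by
    rw [hcomm x hx, pd_congr ν (g := fun _ => 0) (Filter.eventually_of_mem (w.isOpen.mem_nhds hx)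
      fun y hy => w.pd_v_h hy κ), pd_const]
  have hm0 : ∀ x ∈ D, ∀ μ ≠ 0, pd μ (pd 0 a) x = 0 := fun x hx μ hμ => by
    rw [pd_comm μ 0 (mod_cast contDiffAt_infty.mp (w.smooth_a.contDiffAt (w.isOpen.mem_nhds hx)) 2),
      pd_congr 0 (g := fun _ => 0) (Filter.eventually_of_mem (w.isOpen.mem_nhds hx)
        fun y hy => w.pd_a y hy μ hμ), pd_const]
  have ht0 := w.ricciParallelOn_iff_pd.mp hpar
  -- Since a depends on u only, constancy of the trace says that Δh has vanishing derivatives in all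
  -- directions other than u.
  have hpt : ∀ x ∈ D, ∀ μ ≠ 0, pd μ (pd 2 (pd 2 h)) x = -pd μ (pd 3 (pd 3 h)) x := by
    intro x hx μ hμ
    have h1 := ht0 x hx μ
    have h2 : pd μ (waveTrace h a) x = 1 / 18 * pd μ (fun y => a y * a y) x
        - 1 / 2 * (pd μ (pd 2 (pd 2 h)) x + pd μ (pd 3 (pd 3 h)) x) := by
      have hda := (w.diff_a hx).fun_mul (w.diff_a hx)
      have hdl := (w.diff_pd_pd_h hx 2 2).fun_add (w.diff_pd_pd_h hx 3 3)
      rw [← pd_add μ (w.diff_pd_pd_h hx 2 2) (w.diff_pd_pd_h hx 3 3), ← pd_const_mul μ _ hda,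
        ← pd_const_mul μ _ hdl, ← pd_sub μ (hda.const_mul _) (hdl.const_mul _)]
      simp only [← sq]
      rfl
    rw [h2, pd_mul μ (w.diff_a hx) (w.diff_a hx), w.pd_a x hx μ hμ] at h1
    linarith
  have hpd : ∀ x ∈ D, ∀ μ, pd μ d x
      = -(1 / 2) * (pd μ (pd 2 (pd 2 h)) x - pd μ (pd 3 (pd 3 h)) x) := fun x hx μ => by
    have hsub := (w.diff_pd_pd_h hx 2 2).fun_sub (w.diff_pd_pd_h hx 3 3)
    rw [← pd_sub μ (w.diff_pd_pd_h hx 2 2) (w.diff_pd_pd_h hx 3 3), ← pd_const_mul μ _ hsub]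
  have hps : ∀ x ∈ D, ∀ μ, pd μ s x = -1 * pd μ (pd 2 (pd 3 h)) x := fun x hx μ =>
    pd_const_mul μ _ (w.diff_pd_pd_h hx 2 3)
  have hident : ∀ x ∈ D, strongForm P (nullFrame (h x)) ((waveFields h a).curvature x)
            (linCurv ((waveFields h a).Γ x) δ x)
          + strongForm P (nullFrame (h x)) (linCurv ((waveFields h a).Γ x) δ x)
            ((waveFields h a).curvature x)
      = ∑ μ, pd μ (J μ) x - 2 * P.v₂ * (m x * (1 / 6 * a x) * δ x 1 0 ![1]) := by
    intro x hx
    have hδd : ∀ i j μ, DifferentiableAt ℝ (fun y => δ y i j ![μ]) x := fun i j μ =>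
      (contDiff_pi.mp (contDiff_pi.mp (contDiff_pi.mp hδ.1 i) j) ![μ]).differentiable (by simp) x
    have e1 : curvEntry h a 0 x - curvEntry h a 3 x = d x := by simp [curvEntry, d]; ring
    have e2 : curvEntry h a 1 x + curvEntry h a 2 x = s x := by simp [curvEntry, s]; ring
    have e3 : curvEntry h a 1 x - curvEntry h a 2 x = m x := by simp [curvEntry, m]; ring
    have e4 : curvEntry h a 0 x + curvEntry h a 3 x = waveTrace h a x := by
      simp [curvEntry, waveTrace, transverseLaplacian]; ring
    rw [w.curvature_eq hx, strongForm_variation (h x) _ (linCurv_antisymm _ _ _), e1, e2, e3, e4]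
    refine divergence_current P (φ := fun i j κ y => δ y i j ![κ])
      (differentiableAt_of_contDiffOn w.isOpen hds hx)
      (differentiableAt_of_contDiffOn w.isOpen hss hx)
      (differentiableAt_of_contDiffOn w.isOpen hms hx)
      (differentiableAt_of_contDiffOn w.isOpen hts hx) hδd ?_ ?_ ?_ ?_ (fun μ hμ => ?_)
      (ht0 x hx) _ (fun ν hν => linCurv_one_two _ _ _ δ x hν)
      (fun ν hν => linCurv_one_three _ _ _ δ x hν) (fun ν hν => linCurv_two_zero _ _ _ δ x hν)
      (fun ν hν => linCurv_three_zero _ _ _ δ x hν) (linCurv_one_zero _ _ _ δ x 2 3)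
      (linCurv_one_zero _ _ _ δ x 0 1)
    · rw [hpd x hx, hv x hx, hv x hx]; ring
    · rw [hps x hx, hv x hx]; ring
    -- The two Cauchy–Riemann type relations: both sides are third derivatives of h, identified
    -- through ∂_i Δh = 0 and symmetry.
    · rw [hpd x hx, hps x hx, hpt x hx 2 (by decide), hcomm x hx 3 2 3]; ring
    · rw [hps x hx, hpd x hx, hcomm' x hx 2 2 3, hcomm x hx 2 3 2, hpt x hx 3 (by decide)]; ring
    · rw [pd_const_mul _ _ (w.diff_pd_a hx 0), hm0 x hx μ hμ, mul_zero]
  have hint : ∀ μ, MeasureTheory.IntegrableOn (pd μ (J μ)) D := by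
    intro μ
    have hc : Continuous (pd μ (J μ)) :=
      ((hJ μ).1.continuous_fderiv (by simp)).clm_apply continuous_const
    refine integrableOn_of_eq_zero_off w.isOpen (hJ μ).2.1 (hJ μ).2.2 hc.continuousOn fun x hx => ?_
    rw [pd, image_eq_zero_of_notMem_tsupport fun h => hx.2 (tsupport_fderiv_subset ℝ h)]; rfl
  have hint' : MeasureTheory.IntegrableOn
      (fun x => 1 / (18 * P.ρ) * (P.v₂ * a x * pd 0 a x) * δ x 1 0 ![1]) D := by
    have hc : Continuous fun x => δ x 1 0 ![1] :=
      (contDiff_pi.mp (contDiff_pi.mp (contDiff_pi.mp hδ.1 1) 0) ![1]).continuous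
    refine integrableOn_of_eq_zero_off w.isOpen hδ.2.1 hδ.2.2
      ((continuousOn_const.mul ((continuousOn_const.mul w.smooth_a.continuousOn).mul
        (w.smooth_pd_a 0).continuousOn)).mul hc.continuousOn) fun x hx => ?_
    have h0 : δ x = 0 := image_eq_zero_of_notMem_tsupport hx.2
    simp [h0]
  -- The constant is −1/(2ρ) · (−2 v₂) · (∂_u a/3)(a/6) = v₂ a ∂_u a/(18ρ).
  have hsplit : ∀ x ∈ D, -(1 / (2 * P.ρ)) *
        (strongForm P (nullFrame (h x)) ((waveFields h a).curvature x)
            (linCurv ((waveFields h a).Γ x) δ x)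
          + strongForm P (nullFrame (h x)) (linCurv ((waveFields h a).Γ x) δ x)
            ((waveFields h a).curvature x))
      = -(1 / (2 * P.ρ)) * ∑ μ, pd μ (J μ) x
        + 1 / (18 * P.ρ) * (P.v₂ * a x * pd 0 a x) * δ x 1 0 ![1] := by
    intro x hx
    rw [hident x hx]
    simp only [m, one_div, mul_inv]
    ring
  rw [MeasureTheory.setIntegral_congr_fun w.isOpen.measurableSet hsplit,
    MeasureTheory.integral_add ((MeasureTheory.integrable_finsetSum _ fun μ _ => hint μ).const_mul _)
      hint', MeasureTheory.integral_const_mul, MeasureTheory.integral_finsetSum _ fun μ _ => hint μ]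
  simp [integral_pd_eq_zero (hJ _)]

theorem hasConnectionDerivative (P : StrongParams) (hpar : (waveFields h a).RicciParallelOn D) :
    HasConnectionDerivative P D (waveFields h a) fun x i j =>
      (1 / (18 * P.ρ) * (P.v₂ * a x * pd 0 a x)) •
        ((((waveFields h a).frame x).kUp i * ((waveFields h a).frame x).kLow j) •
          ((waveFields h a).frame x).star (rfl : 1 + 3 = 4) waveForm) := by
  intro δ hδ
  refine (w.hasDerivAt_action P hδ).congr_deriv ?_
  rw [w.integral_first_variation P hpar hδ]
  refine MeasureTheory.setIntegral_congr_fun w.isOpen.measurableSet fun x _ => ?_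
  exact (wedge_kUp_kLow_top (h x) _ (δ x)).symm

end WaveData

/-- Only the composite is known to be differentiable; its restriction to the u-line is a translate
of 𝒜, which identifies the derivative with `deriv A`. -/
theorem pd_comp_add (A : ℝ → ℝ) (φ₀ : ℝ) {x : Pt}
    (hA : DifferentiableAt ℝ (fun x : Pt => A (x 0 + φ₀)) x) :
    pd 0 (fun x : Pt => A (x 0 + φ₀)) x = deriv A (x 0 + φ₀) := by
  rw [pd, ← hA.lineDeriv_eq_fderiv, lineDeriv]
  have : (fun t : ℝ => A ((x + t • (Pi.single 0 1 : Pt)) 0 + φ₀))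
      = fun t => A (t + (x 0 + φ₀)) := by
    funext t
    congr 1
    simp
    ring
  rw [this, deriv_comp_add_const, zero_add]

end
end MAG

theorem theorem8 (D : Set Pt) (hD : IsOpen D) (hDc : IsPreconnected D)
    (H : ℝ → ℝ → ℝ → ℝ) (A : ℝ → ℝ) (φ₀ : ℝ) (Φ : Fields) (P : StrongParams) (hρ : P.ρ ≠ 0)
    (hH : ContDiffOn ℝ ∞ (fun x : Pt => H (x 0) (x 2) (x 3)) D)
    (hA : ContDiffOn ℝ ∞ (fun x : Pt => A (x 0 + φ₀)) D)
    (hΦ : Φ.SmoothOn D) (hgeo : IsAxialPPWave D H A φ₀ Φ) :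
    (Φ.RicciParallelOn D ↔
      ∃ C : ℝ, ∀ x ∈ D, transverseLaplacian (fun y : Pt => H (y 0) (y 2) (y 3)) x
        = (1 / 9) * A (x 0 + φ₀) ^ 2 + C) ∧
    (Φ.RicciParallelOn D →
      CoframeEquation P D Φ ∧
      HasConnectionDerivative P D Φ (fun x a b =>
        (1 / (18 * P.ρ) * (P.v₂ * A (x 0 + φ₀) * deriv A (x 0 + φ₀))) •
          (((Φ.frame x).kUp a * (Φ.frame x).kLow b) •
            (Φ.frame x).star (rfl : 1 + 3 = 4) waveForm)) ∧
      (P.v₂ = 0 → ConnectionEquation P D Φ)) := by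
  have w := waveData hD hH hA
  have hG := gaugeRel_waveFields w hΦ hgeo.metric hgeo.compatible hgeo.axial
  have hpar := hG.ricciParallelOn_iff w.differentiableAt_ricci
  refine ⟨hpar.trans (w.ricciParallelOn_iff hDc), fun hp => ?_⟩
  have hconn : HasConnectionDerivative P D Φ (fun x a b =>
      (1 / (18 * P.ρ) * (P.v₂ * A (x 0 + φ₀) * deriv A (x 0 + φ₀))) •
        (((Φ.frame x).kUp a * (Φ.frame x).kLow b) •
          (Φ.frame x).star (rfl : 1 + 3 = 4) waveForm)) := by
    have h1 := hG.hasConnectionDerivative _ (w.hasConnectionDerivative P (hpar.mp hp))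
    intro δ hδ
    refine (h1 δ hδ).congr_deriv ?_
    refine MeasureTheory.setIntegral_congr_fun hD.measurableSet fun x hx => ?_
    simp only [pd_comp_add A φ₀ (w.diff_a hx)]
  refine ⟨hG.coframeEquation (w.coframeEquation P), hconn, fun hv δ hδ => ?_⟩
  refine (hconn δ hδ).congr_deriv ?_
  simp [hv]
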